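/- **Conventions.** For a presheaf $X$ on a category $\mathcal{C}$, let $\int_{\mathcal{C}} X$ be its category of elements: objects are pairs $(\Gamma, x)$ with $x \in X(\Gamma)$, and a morphism $(\Delta,x') \to (\Gamma,x)$ is a map $\rho : \Delta \to \Gamma$ with $x' = x[\rho]$. A *dependent presheaf* $Y$ over $X$ is a presheaf on $\int_{\mathcal{C}} X$; the pair $(X,Y)$ is called a *family*. The presheaf $X$ is *familially representable* if every connected component of $\int_{\mathcal{C}} X$ has a terminal object (equivalently, $X$ is a coproduct of representable presheaves). A family $Y$ over $X$ is *locally (familially) representable* if for all $\Gamma$ and $x \in X(\Gamma)$ the presheaf $Y_{|x}$ on $\mathcal{C}/\Gamma$, $(\rho : \Delta \to \Gamma) \mapsto Y(\Delta, x[\rho])$, is (familially) representable. A *category with families* (CwF) is a small category $\mathcal{C}$ with a chosen terminal object $\diamond$, a presheaf $\mathsf{Ty}$ and a dependent presheaf $\mathsf{Tm}$ over $\mathsf{Ty}$ that is locally representable, with chosen context extensions $p : \Gamma.A \to \Gamma$ and variables $q \in \mathsf{Tm}(\Gamma.A, A[p])$. Morphisms of CwFs are functors with natural actions on types and terms that strictly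 preserve $\diamond$, context extensions, $p$ and $q$. Let $I$ consist of the two maps $\mathsf{Free}(\Gamma : \mathsf{Ob}) \to \mathsf{Free}(\Gamma, A \in \mathsf{Ty}(\Gamma))$ and $\mathsf{Free}(\Gamma, A) \to \mathsf{Free}(\Gamma, A, a \in \mathsf{Tm}(\Gamma,A))$ between CwFs freely generated by the indicated data. A CwF $\mathcal{C}$ is *$I$-cellular* if the map $\mathbf{0} \to \mathcal{C}$ from the initial CwF is the composite of an $\omega$-sequence of pushouts of coproducts of maps in $I$. A *telescope* $\Delta$ over $\Gamma$, with its extended context $\Gamma.\Delta$, is either empty (with $\Gamma.\Delta = \Gamma$) or of the form $\Delta'.A$ with $\Delta'$ a telescope over $\Gamma$ and $A \in \mathsf{Ty}(\Gamma.\Delta')$ (with $\Gamma.(\Delta'.A) = (\Gamma.\Delta').A$). A map $\sigma : \Gamma' \to \Gamma$ induces a telescope $\Delta[\sigma]$ over $\Gamma'$ and a map $\sigma^{+} : \Gamma'.\Delta[\sigma] \to \Gamma.\Delta$; so telescopes form a presheaf $\mathsf{Ty}^{\star}$. **Proposition.** Let $\mathcal{C}$ be an $I$-cellular CwF. The following families,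 with restriction maps induced by $\sigma \mapsto \sigma^{+}$, are locally familially representable: 1. over the presheaf of pairs $(\Delta, \Xi)$ of a telescope $\Delta$ over $\Gamma$ and an object $\Xi$ of $\mathcal{C}$ (constant in $\Gamma$): the set of maps $\Gamma.\Delta \to \Xi$; 2. over the presheaf $\mathsf{Ty}^{\star}$ of telescopes $\Delta$ over $\Gamma$: the set $\mathsf{Ty}(\Gamma.\Delta)$; 3. over the presheaf of pairs $(\Delta, A)$ of a telescope $\Delta$ over $\Gamma$ and a type $A \in \mathsf{Ty}(\Gamma.\Delta)$: the set $\mathsf{Tm}(\Gamma.\Delta, A)$. Let $\mathsf{BSort}$ be the family of basic sorts: a basic sort over $\Gamma$ is either $\mathbb{ty}$, with elements $\mathsf{Ty}(\Gamma)$, or $\mathbb{tm}(A)$ for some $A \in \mathsf{Ty}(\Gamma)$, with elements $\mathsf{Tm}(\Gamma,A)$. Let $\mathsf{MonoSort}$ be the family of monomial sorts: a monomial sort over $\Gamma$ is a telescope $\Delta$ over $\Gamma$ with a basic sort $S$ over $\Gamma.\Delta$, and its elements are the elements of $S$ over $\Gamma.\Delta$. Then $\mathsf{MonoSort}$ is isomorphic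 to the coproduct of the families (2) and (3), and it is locally familially representable. -/

import Mathlib

open CategoryTheory Opposite Limits

universe w v u

/-! ### Presheaves, dependent presheaves and familial representability

A dependent presheaf over `X : Cᵒᵖ ⥤ Type w` is a presheaf over the category of elements `∫ X`.
Mathlib's `X.Elements` is the opposite of `∫ X`, so a dependent presheaf over `X` is a
functor `X.Elements ⥤ Type w`. -/

section Presheaves

variable {C : Type u} [Category.{v} C]

/-- A presheaf is familially representable if every connected component of its category of
elements has a terminal object. -/
def FamiliallyRepresentable (X : Cᵒᵖ ⥤ Type w) : Prop :=
  ∀ c : ConnectedComponents X.Elementsᵒᵖ, HasTerminal c.Component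

/-- An element `x` of `X` over `Γ` sends `ρ : Δ ⟶ Γ` to the element `x[ρ]` over `Δ`. -/
def restrictElements (X : Cᵒᵖ ⥤ Type w) {Γ : C} (x : X.obj (op Γ)) :
    (Over Γ)ᵒᵖ ⥤ X.Elements where
  obj ρ := ⟨op ρ.unop.left, X.map ρ.unop.hom.op x⟩
  map {ρ ρ'} f := ⟨f.unop.left.op, by
    rw [← Over.w f.unop, op_comp, Functor.map_comp_apply]⟩

/-- The restricted presheaf `Y_{|x}` on `C / Γ`, sending `ρ` to `Y(x[ρ])`. -/
abbrev restrictedPresheaf {X : Cᵒᵖ ⥤ Type w} (Y : X.Elements ⥤ Type w) {Γ : C}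
    (x : X.obj (op Γ)) : (Over Γ)ᵒᵖ ⥤ Type w :=
  restrictElements X x ⋙ Y

/-- A dependent presheaf is locally familially representable if all its restrictions
are familially representable. -/
def LocallyFamiliallyRepresentable {X : Cᵒᵖ ⥤ Type w} (Y : X.Elements ⥤ Type w) : Prop :=
  ∀ (Γ : C) (x : X.obj (op Γ)), FamiliallyRepresentable (restrictedPresheaf Y x)

lemma sigma_map_eq {X : Cᵒᵖ ⥤ Type w} (Y : X.Elements ⥤ Type w) {Γ Δ : Cᵒᵖ} (f : Γ ⟶ Δ)
    {x : X.obj Γ} {x' : X.obj Δ} (h : X.map f x = x') (y : Y.obj ⟨Γ, x⟩) :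
    (⟨X.map f x, Y.map (X := ⟨Γ, x⟩) (Y := ⟨Δ, X.map f x⟩) ⟨f, rfl⟩ y⟩ :
      Σ x : X.obj Δ, Y.obj ⟨Δ, x⟩) =
      ⟨x', Y.map (X := ⟨Γ, x⟩) (Y := ⟨Δ, x'⟩) ⟨f, h⟩ y⟩ := by
  subst h; rfl

/-- The dependent sum `(x : X) × Y(x)`. -/
def totalPresheaf {X : Cᵒᵖ ⥤ Type w} (Y : X.Elements ⥤ Type w) : Cᵒᵖ ⥤ Type w where
  obj Γ := Σ x : X.obj Γ, Y.obj ⟨Γ, x⟩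
  map {Γ Δ} f := ↾fun z => ⟨X.map f z.1,
    Y.map (X := ⟨Γ, z.1⟩) (Y := ⟨Δ, X.map f z.1⟩) ⟨f, rfl⟩ z.2⟩
  map_id Γ := by
    refine ConcreteCategory.hom_ext _ _ fun ⟨x, y⟩ => ?_
    refine (sigma_map_eq Y (𝟙 Γ) (Functor.map_id_apply X Γ x) y).trans ?_
    exact congrArg (Sigma.mk x) (Functor.map_id_apply Y ⟨Γ, x⟩ y)
  map_comp {Γ Δ Θ} f g := by
    refine ConcreteCategory.hom_ext _ _ fun ⟨x, y⟩ => ?_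
    refine (sigma_map_eq Y (f ≫ g) (Functor.map_comp_apply X f g x) y).trans ?_
    exact congrArg (Sigma.mk (X.map g (X.map f x)))
      (Functor.map_comp_apply Y (X := ⟨Γ, x⟩) (Y := ⟨Δ, X.map f x⟩)
        (Z := ⟨Θ, X.map g (X.map f x)⟩) ⟨f, rfl⟩ ⟨g, rfl⟩ y)

/-- Elements of `(x : X) × Y(x)` are elements of `Y`. -/
def totalElements {X : Cᵒᵖ ⥤ Type w} (Y : X.Elements ⥤ Type w) :
    (totalPresheaf Y).Elements ⥤ Y.Elements where
  obj z := ⟨⟨z.1, z.2.1⟩, z.2.2⟩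
  map {z z'} f := ⟨⟨f.1, congrArg Sigma.fst f.2⟩, by
    obtain ⟨Δ, x', y'⟩ := z'
    have h := (sigma_map_eq Y f.1 (congrArg Sigma.fst f.2) z.2.2).symm.trans f.2
    exact eq_of_heq (Sigma.mk.inj h).2⟩

/-- The functor `∫ (G ⋙ F) ⥤ ∫ F`. -/
def pullElements {D : Type*} [Category D] (G : D ⥤ C) (F : C ⥤ Type w) :
    (G ⋙ F).Elements ⥤ F.Elements where
  obj z := ⟨G.obj z.1, z.2⟩
  map f := ⟨G.map f.1, f.2⟩

/-- A family over `C`: a presheaf and a dependent presheaf over it. -/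
structure PshFamily (C : Type u) [Category.{v} C] where
  base : Cᵒᵖ ⥤ Type w
  fib : base.Elements ⥤ Type w

/-- The coproduct of two presheaves. -/
def sumPresheaf (X X' : Cᵒᵖ ⥤ Type w) : Cᵒᵖ ⥤ Type w where
  obj Γ := X.obj Γ ⊕ X'.obj Γ
  map f := ↾fun z => Sum.map (fun x => X.map f x) (fun x => X'.map f x) z
  map_id Γ := by ext (x | x) <;> simp
  map_comp f g := by ext (x | x) <;> simp

/-- The dependent presheaf over `X ⊕ X'` that restricts to `Y` and to `Y'`. -/
def sumDepPresheaf {X X' : Cᵒᵖ ⥤ Type w} (Y : X.Elements ⥤ Type w) (Y' : X'.Elements ⥤ Type w) :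
    (sumPresheaf X X').Elements ⥤ Type w where
  obj z := Sum.elim (fun x => Y.obj ⟨z.1, x⟩) (fun x => Y'.obj ⟨z.1, x⟩) z.2
  map {z z'} f := match z, z', f with
    | ⟨Γ, Sum.inl x⟩, ⟨Δ, Sum.inl x'⟩, f =>
        Y.map (X := ⟨Γ, x⟩) (Y := ⟨Δ, x'⟩) ⟨f.1, Sum.inl.inj f.2⟩
    | ⟨Γ, Sum.inr x⟩, ⟨Δ, Sum.inr x'⟩, f =>
        Y'.map (X := ⟨Γ, x⟩) (Y := ⟨Δ, x'⟩) ⟨f.1, Sum.inr.inj f.2⟩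
    | ⟨_, Sum.inl _⟩, ⟨_, Sum.inr _⟩, f => (Sum.inl_ne_inr f.2).elim
    | ⟨_, Sum.inr _⟩, ⟨_, Sum.inl _⟩, f => (Sum.inr_ne_inl f.2).elim
  map_id z := by
    obtain ⟨Γ, x | x⟩ := z
    · exact Y.map_id ⟨Γ, x⟩
    · exact Y'.map_id ⟨Γ, x⟩
  map_comp {z z' z''} f g := by
    obtain ⟨Γ, x | x⟩ := z <;> obtain ⟨Δ, x' | x'⟩ := z' <;> obtain ⟨Θ, x'' | x''⟩ := z''
    · exact Y.map_comp (X := ⟨Γ, x⟩) (Y := ⟨Δ, x'⟩) (Z := ⟨Θ, x''⟩)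
        ⟨f.1, Sum.inl.inj f.2⟩ ⟨g.1, Sum.inl.inj g.2⟩
    · exact (Sum.inl_ne_inr g.2).elim
    · exact (Sum.inl_ne_inr f.2).elim
    · exact (Sum.inl_ne_inr f.2).elim
    · exact (Sum.inr_ne_inl f.2).elim
    · exact (Sum.inr_ne_inl f.2).elim
    · exact (Sum.inr_ne_inl g.2).elim
    · exact Y'.map_comp (X := ⟨Γ, x⟩) (Y := ⟨Δ, x'⟩) (Z := ⟨Θ, x''⟩)
        ⟨f.1, Sum.inr.inj f.2⟩ ⟨g.1, Sum.inr.inj g.2⟩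

/-- The coproduct of two families. -/
def PshFamily.sum (P Q : PshFamily.{w} C) : PshFamily.{w} C :=
  ⟨sumPresheaf P.base Q.base, sumDepPresheaf P.fib Q.fib⟩

/-- An isomorphism of families. -/
structure PshFamily.Iso (P Q : PshFamily.{w} C) where
  base : P.base ≅ Q.base
  fib : P.fib ≅ CategoryOfElements.map base.hom ⋙ Q.fib

end Presheaves

/-! ### Categories with families -/

/-- A (small) category with families: a category with a terminal object and a family `(Ty, Tm)`
with `Tm` locally representable, the representing objects being the context extensions
`p : Γ.A ⟶ Γ`. -/
structure CwF where
  Ob : Type u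
  [cat : SmallCategory Ob]
  empty : Ob
  isTerminalEmpty : IsTerminal empty
  Ty : Obᵒᵖ ⥤ Type u
  Tm : Ty.Elements ⥤ Type u
  ext {Γ : Ob} (A : Ty.obj (op Γ)) : Over Γ
  extRepr {Γ : Ob} (A : Ty.obj (op Γ)) : (restrictedPresheaf Tm A).RepresentableBy (ext A)

namespace CwF

attribute [instance] CwF.cat

section

variable (C : CwF.{u})

/-- The substitution of types. -/
abbrev tySub {Γ Δ : C.Ob} (A : C.Ty.obj (op Γ)) (σ : Δ ⟶ Γ) : C.Ty.obj (op Δ) :=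
  C.Ty.map σ.op A

/-- Terms of type `A` over `Γ`. -/
abbrev TmOf {Γ : C.Ob} (A : C.Ty.obj (op Γ)) : Type u :=
  C.Tm.obj ⟨op Γ, A⟩

/-- The substitution of terms. -/
abbrev tmSub {Γ Δ : C.Ob} {A : C.Ty.obj (op Γ)} {B : C.Ty.obj (op Δ)} (a : C.TmOf A)
    (σ : Δ ⟶ Γ) (h : C.tySub A σ = B) : C.TmOf B :=
  C.Tm.map (X := ⟨op Γ, A⟩) (Y := ⟨op Δ, B⟩) ⟨σ.op, h⟩ a

/-- The extended context `Γ.A`. -/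
abbrev extOb {Γ : C.Ob} (A : C.Ty.obj (op Γ)) : C.Ob := (C.ext A).left

/-- The projection `Γ.A ⟶ Γ`. -/
abbrev proj {Γ : C.Ob} (A : C.Ty.obj (op Γ)) : C.extOb A ⟶ Γ := (C.ext A).hom

/-- The variable term, of type `A[p]` over `Γ.A`. -/
def var {Γ : C.Ob} (A : C.Ty.obj (op Γ)) : C.TmOf (C.tySub A (C.proj A)) :=
  (C.extRepr A).homEquiv (𝟙 (C.ext A))

/-- The substitution `⟨σ, a⟩ : Δ ⟶ Γ.A`. -/
def pair {Γ Δ : C.Ob} (A : C.Ty.obj (op Γ)) (σ : Δ ⟶ Γ) (a : C.TmOf (C.tySub A σ)) :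
    Δ ⟶ C.extOb A :=
  ((C.extRepr A).homEquiv.symm (show (restrictedPresheaf C.Tm A).obj (op (Over.mk σ)) from a)).left

lemma pair_proj {Γ Δ : C.Ob} (A : C.Ty.obj (op Γ)) (σ : Δ ⟶ Γ) (a : C.TmOf (C.tySub A σ)) :
    C.pair A σ a ≫ C.proj A = σ :=
  Over.w ((C.extRepr A).homEquiv.symm
    (show (restrictedPresheaf C.Tm A).obj (op (Over.mk σ)) from a))

lemma tySub_comp {Γ Δ Θ : C.Ob} (A : C.Ty.obj (op Γ)) (σ : Δ ⟶ Γ) (τ : Θ ⟶ Δ) :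
    C.tySub A (τ ≫ σ) = C.tySub (C.tySub A σ) τ := by
  simp [tySub]

lemma tySub_id {Γ : C.Ob} (A : C.Ty.obj (op Γ)) : C.tySub A (𝟙 Γ) = A := by
  simp [tySub]

lemma tmSub_tmSub {Γ Δ Θ : C.Ob} {A : C.Ty.obj (op Γ)} {B : C.Ty.obj (op Δ)}
    {D : C.Ty.obj (op Θ)} (a : C.TmOf A) (σ : Δ ⟶ Γ) (h : C.tySub A σ = B) (τ : Θ ⟶ Δ)
    (h' : C.tySub B τ = D) :
    C.tmSub (C.tmSub a σ h) τ h' =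
      C.tmSub a (τ ≫ σ) (by rw [tySub_comp, h, h']) :=
  (Functor.map_comp_apply C.Tm (X := ⟨op Γ, A⟩) (Y := ⟨op Δ, B⟩) (Z := ⟨op Θ, D⟩)
    ⟨σ.op, h⟩ ⟨τ.op, h'⟩ a).symm

lemma var_pair {Γ Δ : C.Ob} (A : C.Ty.obj (op Γ)) (σ : Δ ⟶ Γ) (a : C.TmOf (C.tySub A σ)) :
    C.tmSub (C.var A) (C.pair A σ a) (by rw [← tySub_comp, pair_proj]) = a := by
  have h := (C.extRepr A).homEquiv_eq ((C.extRepr A).homEquiv.symm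
    (show (restrictedPresheaf C.Tm A).obj (op (Over.mk σ)) from a))
  rw [Equiv.apply_symm_apply] at h
  exact h.symm

lemma tmSub_congr {Γ Δ : C.Ob} {A : C.Ty.obj (op Γ)} {B : C.Ty.obj (op Δ)} (a : C.TmOf A)
    {σ τ : Δ ⟶ Γ} (e : σ = τ) (h : C.tySub A σ = B) :
    C.tmSub a σ h = C.tmSub a τ (e ▸ h) := by
  subst e; rfl

lemma ext_hom_ext {Γ Δ : C.Ob} {A : C.Ty.obj (op Γ)} (f g : Δ ⟶ C.extOb A)
    (h : f ≫ C.proj A = g ≫ C.proj A) {B : C.Ty.obj (op Δ)}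
    (hf : C.tySub (C.tySub A (C.proj A)) f = B) (hg : C.tySub (C.tySub A (C.proj A)) g = B)
    (h' : C.tmSub (C.var A) f hf = C.tmSub (C.var A) g hg) : f = g := by
  obtain rfl : B = C.tySub A (f ≫ C.proj A) := by rw [tySub_comp, hf]
  let f' : Over.mk (f ≫ C.proj A) ⟶ C.ext A := Over.homMk f rfl
  let g' : Over.mk (f ≫ C.proj A) ⟶ C.ext A := Over.homMk g h.symm
  have key : f' = g' := by
    apply (C.extRepr A).homEquiv.injective
    rw [(C.extRepr A).homEquiv_eq f', (C.extRepr A).homEquiv_eq g']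
    exact h'
  exact congrArg (fun k => k.left) key

/-- The substitution `σ⁺ : Δ.B ⟶ Γ.A`, for `σ : Δ ⟶ Γ` and `B = A[σ]`. -/
def lift {Γ Δ : C.Ob} (σ : Δ ⟶ Γ) (A : C.Ty.obj (op Γ)) (B : C.Ty.obj (op Δ))
    (h : C.tySub A σ = B) : C.extOb B ⟶ C.extOb A :=
  C.pair A (C.proj B ≫ σ) (C.tmSub (C.var B) (𝟙 _) (by rw [tySub_id, tySub_comp, h]))

lemma lift_proj {Γ Δ : C.Ob} (σ : Δ ⟶ Γ) (A : C.Ty.obj (op Γ)) (B : C.Ty.obj (op Δ))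
    (h : C.tySub A σ = B) : C.lift σ A B h ≫ C.proj A = C.proj B ≫ σ :=
  C.pair_proj _ _ _

lemma var_lift {Γ Δ : C.Ob} (σ : Δ ⟶ Γ) (A : C.Ty.obj (op Γ)) (B : C.Ty.obj (op Δ))
    (h : C.tySub A σ = B) :
    C.tmSub (C.var A) (C.lift σ A B h)
      (show _ = C.tySub B (C.proj B) by rw [← tySub_comp, lift_proj, tySub_comp, h]) =
      C.var B := by
  have e := C.var_pair A (C.proj B ≫ σ)
    (C.tmSub (C.var B) (𝟙 _) (by rw [tySub_id, tySub_comp, h]))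
  have e' := congrArg (fun t => C.tmSub t (𝟙 _)
    (show _ = C.tySub B (C.proj B) by rw [tySub_id, tySub_comp, h])) e
  rw [tmSub_tmSub, tmSub_tmSub] at e'
  have e'' : C.tmSub (C.var B) (𝟙 _) (C.tySub_id _) = C.var B :=
    Functor.map_id_apply C.Tm ⟨op (C.extOb B), C.tySub B (C.proj B)⟩ (C.var B)
  rw [tmSub_congr C _ (Category.id_comp _), tmSub_congr C _ (Category.id_comp _), e''] at e'
  exact e'

lemma lift_id {Γ : C.Ob} (A : C.Ty.obj (op Γ)) :
    C.lift (𝟙 Γ) A A (C.tySub_id A) = 𝟙 _ := by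
  refine C.ext_hom_ext _ _ (by rw [lift_proj]; simp)
    (show _ = C.tySub A (C.proj A) by rw [← tySub_comp, lift_proj, Category.comp_id])
    (C.tySub_id _) ?_
  rw [var_lift]
  exact (Functor.map_id_apply C.Tm ⟨op (C.extOb A), C.tySub A (C.proj A)⟩ (C.var A)).symm

lemma lift_comp {Γ Δ Θ : C.Ob} (σ : Δ ⟶ Γ) (τ : Θ ⟶ Δ) (A : C.Ty.obj (op Γ))
    (B : C.Ty.obj (op Δ)) (D : C.Ty.obj (op Θ)) (h : C.tySub A σ = B) (h' : C.tySub B τ = D)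
    (h'' : C.tySub A (τ ≫ σ) = D) :
    C.lift (τ ≫ σ) A D h'' = C.lift τ B D h' ≫ C.lift σ A B h := by
  refine C.ext_hom_ext _ _ ?_ (B := C.tySub D (C.proj D)) ?_ ?_ ?_
  · rw [lift_proj, Category.assoc, lift_proj, ← Category.assoc, ← Category.assoc, lift_proj]
  · rw [← tySub_comp, lift_proj, tySub_comp, h'']
  · rw [← tySub_comp, Category.assoc, lift_proj, ← Category.assoc, lift_proj, Category.assoc,
      tySub_comp, h'']
  · rw [var_lift, ← tmSub_tmSub (h := by rw [← tySub_comp, lift_proj, tySub_comp, h])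
      (h' := by rw [← tySub_comp, lift_proj, tySub_comp, h']), var_lift, var_lift]

end

/-! ### Telescopes -/

/-- `C.Telescope Γ Θ` is the type of telescopes `Δ` over `Γ` such that `Γ.Δ = Θ`: a telescope is
either empty, or of the form `Δ.A` where `A` is a type over `Γ.Δ`. -/
inductive Telescope (C : CwF.{u}) (Γ : C.Ob) : C.Ob → Type u
  | nil : Telescope C Γ Γ
  | snoc {Θ : C.Ob} (Δ : Telescope C Γ Θ) (A : C.Ty.obj (op Θ)) : Telescope C Γ (C.extOb A)

/-- Telescopes over `Γ`: the elements of `Ty*` over `Γ`. -/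
structure Tel (C : CwF.{u}) (Γ : C.Ob) where
  /-- The extended context `Γ.Δ`. -/
  ob : C.Ob
  tel : Telescope C Γ ob

/-- A telescope `Δ'` over `Γ'` together with a substitution `Γ'.Δ' ⟶ Θ`. -/
structure TelHom (C : CwF.{u}) (Γ' Θ : C.Ob) extends Tel C Γ' where
  lift : ob ⟶ Θ

/-- The extension of a telescope `Δ'` and `f : Γ'.Δ' ⟶ Θ` to `Δ'.A[f]` and
`f⁺ : Γ'.Δ'.A[f] ⟶ Θ.A`. -/
def TelHom.snoc {C : CwF.{u}} {Γ' Θ : C.Ob} (r : TelHom C Γ' Θ) (A : C.Ty.obj (op Θ)) :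
    TelHom C Γ' (C.extOb A) :=
  ⟨⟨_, .snoc r.tel (C.tySub A r.lift)⟩, C.lift r.lift A _ rfl⟩

/-- The telescope `Δ[σ]` together with the substitution `σ⁺ : Γ'.Δ[σ] ⟶ Γ.Δ`. -/
def Telescope.sub {C : CwF.{u}} {Γ Γ' : C.Ob} (σ : Γ' ⟶ Γ) :
    {Θ : C.Ob} → Telescope C Γ Θ → TelHom C Γ' Θ
  | _, .nil => ⟨⟨Γ', .nil⟩, σ⟩
  | _, .snoc Δ A => (Telescope.sub σ Δ).snoc A

lemma TelHom.snoc_eq {C : CwF.{u}} {Γ Θ : C.Ob} (r : TelHom C Γ Θ)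
    (A : C.Ty.obj (op Θ)) (B : C.Ty.obj (op r.ob)) (h : C.tySub A r.lift = B) :
    r.snoc A = ⟨⟨_, .snoc r.tel B⟩, C.lift r.lift A B h⟩ := by
  subst h; rfl

lemma TelHom.lift_eq {C : CwF.{u}} {Γ Θ : C.Ob} {r r' : TelHom C Γ Θ} (e : r = r') :
    r.lift = eqToHom (congrArg (fun r => r.ob) e) ≫ r'.lift := by
  subst e; simp

lemma Telescope.sub_id {C : CwF.{u}} {Γ Θ : C.Ob} (Δ : Telescope C Γ Θ) :
    Δ.sub (𝟙 Γ) = ⟨⟨Θ, Δ⟩, 𝟙 Θ⟩ := by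
  induction Δ with
  | nil => rfl
  | snoc Δ A ih =>
    rw [Telescope.sub, ih, TelHom.snoc_eq _ A A (C.tySub_id A), lift_id]

lemma Telescope.sub_comp {C : CwF.{u}} {Γ Γ' Γ'' Θ : C.Ob} (σ : Γ' ⟶ Γ) (τ : Γ'' ⟶ Γ')
    (Δ : Telescope C Γ Θ) :
    Δ.sub (τ ≫ σ) =
      ⟨((Δ.sub σ).tel.sub τ).toTel, ((Δ.sub σ).tel.sub τ).lift ≫ (Δ.sub σ).lift⟩ := by
  induction Δ with
  | nil => rfl
  | snoc Δ A ih =>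
    rw [Telescope.sub, ih, TelHom.snoc_eq _ A _ (C.tySub_comp _ _ _),
      lift_comp C _ _ _ _ _ rfl rfl]
    rfl

/-- The presheaf `Ty*` of telescopes. -/
def telPresheaf (C : CwF.{u}) : C.Obᵒᵖ ⥤ Type u where
  obj Γ := Tel C Γ.unop
  map σ := ↾fun Δ => (Δ.tel.sub σ.unop).toTel
  map_id Γ := by
    refine ConcreteCategory.hom_ext _ _ fun Δ => ?_
    exact congrArg TelHom.toTel (Telescope.sub_id Δ.tel)
  map_comp σ τ := by
    refine ConcreteCategory.hom_ext _ _ fun Δ => ?_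
    exact congrArg TelHom.toTel (Telescope.sub_comp σ.unop τ.unop Δ.tel)

/-- The substitution `σ⁺ : Γ'.Δ' ⟶ Γ.Δ`, for `σ : Γ' ⟶ Γ` and `Δ' = Δ[σ]`. -/
def Tel.lift {C : CwF.{u}} {Γ Γ' : C.Ob} (σ : Γ' ⟶ Γ) (Δ : Tel C Γ) (Δ' : Tel C Γ')
    (h : (Δ.tel.sub σ).toTel = Δ') : Δ'.ob ⟶ Δ.ob :=
  eqToHom (congrArg Tel.ob h.symm) ≫ (Δ.tel.sub σ).lift

lemma Tel.lift_id {C : CwF.{u}} {Γ : C.Ob} (Δ : Tel C Γ)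
    (h : (Δ.tel.sub (𝟙 Γ)).toTel = Δ) : Tel.lift (𝟙 Γ) Δ Δ h = 𝟙 _ := by
  rw [Tel.lift, TelHom.lift_eq (Telescope.sub_id Δ.tel)]
  simp

lemma Tel.lift_comp {C : CwF.{u}} {Γ Γ' Γ'' : C.Ob} (σ : Γ' ⟶ Γ) (τ : Γ'' ⟶ Γ')
    (Δ : Tel C Γ) (Δ' : Tel C Γ') (Δ'' : Tel C Γ'') (h : (Δ.tel.sub σ).toTel = Δ')
    (h' : (Δ'.tel.sub τ).toTel = Δ'') (h'' : (Δ.tel.sub (τ ≫ σ)).toTel = Δ'') :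
    Tel.lift (τ ≫ σ) Δ Δ'' h'' = Tel.lift τ Δ' Δ'' h' ≫ Tel.lift σ Δ Δ' h := by
  subst h h'
  rw [Tel.lift, TelHom.lift_eq (Telescope.sub_comp σ τ Δ.tel)]
  simp [Tel.lift]

/-- The functor sending a context `Γ` with a telescope `Δ` over it to the extended context `Γ.Δ`,
and a substitution `σ` to `σ⁺`. -/
def telExt (C : CwF.{u}) : C.telPresheaf.Elements ⥤ C.Obᵒᵖ where
  obj x := op x.2.ob
  map {x y} f := (Tel.lift f.1.unop x.2 y.2 f.2).op
  map_id x := congrArg Quiver.Hom.op (Tel.lift_id x.2 _)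
  map_comp {x y z} f g :=
    congrArg Quiver.Hom.op (Tel.lift_comp f.1.unop g.1.unop x.2 y.2 z.2 f.2 g.2 _)

/-! ### The families of the statement -/

/-- For a family `(X, Y)`, the family
`(Δ : Ty*) × (x : Tm*(Δ) → X) ↦ (δ : Tm*(Δ)) → Y(x(δ))`.
Since `Γ.Δ` represents `Tm*(Δ)` over `Γ`, maps `Tm*(Δ) → X` over `Γ` are elements of `X`
over `Γ.Δ`. -/
def telFamily (C : CwF.{u}) (P : PshFamily.{u} C.Ob) : PshFamily.{u} C.Ob where
  base := totalPresheaf (C.telExt ⋙ P.base)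
  fib := totalElements (C.telExt ⋙ P.base) ⋙ pullElements C.telExt P.base ⋙ P.fib

/-- The family `(Ξ : Ob) ↦ y(Ξ)` over the constant presheaf `Ob`. -/
def obFamily (C : CwF.{u}) : PshFamily.{u} C.Ob where
  base := (Functor.const _).obj C.Ob
  fib :=
    { obj := fun z => z.1.unop ⟶ (z.2 : C.Ob)
      map := fun {z z'} f => ↾fun ξ => f.1.unop ≫ ξ ≫ eqToHom f.2
      map_id := fun z => by
        refine ConcreteCategory.hom_ext _ _ fun ξ => ?_
        exact (Category.id_comp _).trans (Category.comp_id ξ)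
      map_comp := fun {z z' z''} f g => by
        refine ConcreteCategory.hom_ext _ _ fun ξ => ?_
        change (g.1.unop ≫ f.1.unop) ≫ ξ ≫ eqToHom _ =
          g.1.unop ≫ (f.1.unop ≫ ξ ≫ eqToHom _) ≫ eqToHom _
        simp only [Category.assoc]
        exact congrArg (fun k => g.1.unop ≫ f.1.unop ≫ ξ ≫ k) (eqToHom_trans _ _).symm }

/-- The family `(Ty, Tm)`. -/
def tyTmFamily (C : CwF.{u}) : PshFamily.{u} C.Ob := ⟨C.Ty, C.Tm⟩

/-- The family `(Δ : Ty*) × (Ξ : Ob) ↦ (Tm*(Δ) → y(Ξ))`. -/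
def substFamily (C : CwF.{u}) : PshFamily.{u} C.Ob := C.telFamily C.obFamily

/-- The family `(Δ : Ty*) ↦ (Tm*(Δ) → Ty)`. -/
def depTyFamily (C : CwF.{u}) : PshFamily.{u} C.Ob := ⟨C.telPresheaf, C.telExt ⋙ C.Ty⟩

/-- The family `(Δ : Ty*) × (A : Tm*(Δ) → Ty) ↦ (δ : Tm*(Δ)) → Tm(A(δ))`. -/
def depTmFamily (C : CwF.{u}) : PshFamily.{u} C.Ob := C.telFamily C.tyTmFamily

/-- The family of basic sorts: a basic sort is either `ty`, whose elements are the types,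
or `tm(A)` for a type `A`, whose elements are the terms of type `A`. -/
def basicSorts (C : CwF.{u}) : PshFamily.{u} C.Ob :=
  PshFamily.sum ⟨(Functor.const _).obj PUnit, CategoryOfElements.π _ ⋙ C.Ty⟩ C.tyTmFamily

/-- The family of monomial sorts: a monomial sort `[Δ ⊢ A]` is a telescope `Δ` with a dependent
basic sort `A` over it, and its elements are the dependent elements of `A`. -/
def monoSorts (C : CwF.{u}) : PshFamily.{u} C.Ob := C.telFamily C.basicSorts

/-! ### The category of CwFs -/

/-- A functor with an action on types. -/
structure PreHom (C D : CwF.{u}) where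
  functor : C.Ob ⥤ D.Ob
  ty : C.Ty ⟶ functor.op ⋙ D.Ty

/-- The action of a functor with an action on types on the types over `Γ`. -/
abbrev PreHom.mapTy {C D : CwF.{u}} (F : PreHom C D) {Γ : C.Ob} (A : C.Ty.obj (op Γ)) :
    D.Ty.obj (op (F.functor.obj Γ)) :=
  F.ty.app (op Γ) A

lemma PreHom.mapTy_sub {C D : CwF.{u}} (F : PreHom C D) {Γ Δ : C.Ob} (A : C.Ty.obj (op Γ))
    (σ : Δ ⟶ Γ) : F.mapTy (C.tySub A σ) = D.tySub (F.mapTy A) (F.functor.map σ) :=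
  NatTrans.naturality_apply F.ty σ.op A

/-- The induced functor on categories of elements of the presheaves of types. -/
def PreHom.tyElements {C D : CwF.{u}} (F : PreHom C D) : C.Ty.Elements ⥤ D.Ty.Elements :=
  CategoryOfElements.map F.ty ⋙ pullElements F.functor.op D.Ty

/-- A strict morphism of CwFs: a functor with natural actions on types and terms that preserves
the empty context, the context extensions, the projections and the variables strictly. -/
structure Hom (C D : CwF.{u}) extends PreHom C D where
  tm : C.Tm ⟶ toPreHom.tyElements ⋙ D.Tm
  map_empty : functor.obj C.empty = D.empty
  map_extOb {Γ : C.Ob} (A : C.Ty.obj (op Γ)) :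
    functor.obj (C.extOb A) = D.extOb (toPreHom.mapTy A)
  map_proj {Γ : C.Ob} (A : C.Ty.obj (op Γ)) :
    functor.map (C.proj A) = eqToHom (map_extOb A) ≫ D.proj (toPreHom.mapTy A)
  map_var {Γ : C.Ob} (A : C.Ty.obj (op Γ)) :
    (tm.app ⟨op (C.extOb A), C.tySub A (C.proj A)⟩ (C.var A) :
      D.TmOf (toPreHom.mapTy (C.tySub A (C.proj A)))) =
      D.tmSub (D.var (toPreHom.mapTy A)) (eqToHom (map_extOb A)) (by
        rw [← tySub_comp, ← map_proj]
        exact (toPreHom.mapTy_sub A (C.proj A)).symm)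

/-- The action of a morphism on the terms. -/
abbrev Hom.mapTm {C D : CwF.{u}} (F : Hom C D) {Γ : C.Ob} {A : C.Ty.obj (op Γ)} (a : C.TmOf A) :
    D.TmOf (F.mapTy A) :=
  F.tm.app ⟨op Γ, A⟩ a

lemma Hom.mapTm_sub {C D : CwF.{u}} (F : Hom C D) {Γ Δ : C.Ob} {A : C.Ty.obj (op Γ)}
    {B : C.Ty.obj (op Δ)} (a : C.TmOf A) (σ : Δ ⟶ Γ) (h : C.tySub A σ = B) :
    F.mapTm (C.tmSub a σ h) = D.tmSub (F.mapTm a) (F.functor.map σ)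
      (by rw [← PreHom.mapTy_sub, h]) :=
  NatTrans.naturality_apply F.tm (X := ⟨op Γ, A⟩) (Y := ⟨op Δ, B⟩) ⟨σ.op, h⟩ a

/-- The identity morphism. -/
def Hom.id (C : CwF.{u}) : Hom C C where
  functor := 𝟭 _
  ty := { app := fun Γ => 𝟙 (C.Ty.obj Γ) }
  tm := { app := fun x => 𝟙 (C.Tm.obj x) }
  map_empty := rfl
  map_extOb A := rfl
  map_proj A := by exact (Category.id_comp (C.proj A)).symm
  map_var A :=
    (Functor.map_id_apply C.Tm ⟨op (C.extOb A), C.tySub A (C.proj A)⟩ (C.var A)).symm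

/-- The composition of morphisms. -/
def Hom.comp {C D E : CwF.{u}} (F : Hom C D) (G : Hom D E) : Hom C E where
  functor := F.functor ⋙ G.functor
  ty := F.ty ≫ Functor.whiskerLeft F.functor.op G.ty
  tm := F.tm ≫ Functor.whiskerLeft F.tyElements G.tm
  map_empty := by
    simp only [Functor.comp_obj, F.map_empty, G.map_empty]
  map_extOb A := (congrArg G.functor.obj (F.map_extOb A)).trans (G.map_extOb (F.mapTy A))
  map_proj A := by
    change G.functor.map (F.functor.map (C.proj A)) =
      eqToHom _ ≫ E.proj (G.mapTy (F.mapTy A))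
    rw [F.map_proj, Functor.map_comp, eqToHom_map, G.map_proj, ← Category.assoc, eqToHom_trans]
  map_var A := by
    change G.mapTm (F.mapTm (C.var A)) = E.tmSub (E.var (G.mapTy (F.mapTy A))) (eqToHom _) _
    have e1 : F.mapTm (C.var A) = D.tmSub (D.var (F.mapTy A)) (eqToHom (F.map_extOb A)) _ :=
      F.map_var A
    have e2 : G.mapTm (D.var (F.mapTy A)) =
        E.tmSub (E.var (G.mapTy (F.mapTy A))) (eqToHom (G.map_extOb (F.mapTy A))) _ :=
      G.map_var (F.mapTy A)
    refine (congrArg (fun t => G.mapTm t) e1).trans ((G.mapTm_sub _ _ _).trans ?_)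
    rw [e2]
    refine (E.tmSub_tmSub _ _ _ _ _).trans ?_
    exact E.tmSub_congr _ (by rw [eqToHom_map, eqToHom_trans]) _

instance : Category CwF.{u} where
  Hom := Hom
  id := Hom.id
  comp := Hom.comp
  id_comp _ := rfl
  comp_id _ := rfl
  assoc _ _ _ := rfl

/-! ### Cellular CwFs -/

/-- The action of a morphism on objects. -/
def Hom.onOb {C D : CwF.{u}} (F : C ⟶ D) (Γ : C.Ob) : D.Ob :=
  (Hom.toPreHom F).functor.obj Γ

/-- The action of a morphism on pairs of an object `Γ` and a type over `Γ`. -/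
def Hom.onTy {C D : CwF.{u}} (F : C ⟶ D) (x : C.Ty.Elements) : D.Ty.Elements :=
  (Hom.toPreHom F).tyElements.obj x

/-- The action of a morphism on triples of an object `Γ`, a type `A` over `Γ` and a term of
type `A`. -/
def Hom.onTm {C D : CwF.{u}} (F : C ⟶ D) (t : C.Tm.Elements) : D.Tm.Elements :=
  ⟨Hom.onTy F t.1, (Hom.tm F).app t.1 t.2⟩

/-- `C` is freely generated by the object `Γ`. -/
def IsFreeOb (C : CwF.{u}) (Γ : C.Ob) : Prop :=
  ∀ D : CwF.{u}, Function.Bijective fun F : C ⟶ D => Hom.onOb F Γ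

/-- `C` is freely generated by an object and a type over it. -/
def IsFreeTy (C : CwF.{u}) (x : C.Ty.Elements) : Prop :=
  ∀ D : CwF.{u}, Function.Bijective fun F : C ⟶ D => Hom.onTy F x

/-- `C` is freely generated by an object, a type over it and a term of that type. -/
def IsFreeTm (C : CwF.{u}) (t : C.Tm.Elements) : Prop :=
  ∀ D : CwF.{u}, Function.Bijective fun F : C ⟶ D => Hom.onTm F t

/-- The generating maps, up to isomorphism:
`Free(Γ : Ob) → Free(A : y(Γ) → Ty)` and
`Free(A : y(Γ) → Ty) → Free(a : (γ : y(Γ)) → Tm(A(γ)))`. -/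
inductive GeneratingMaps : MorphismProperty CwF.{u}
  | ty {C D : CwF.{u}} (F : C ⟶ D) (Γ : C.Ob) (A : D.Ty.obj (op (Hom.onOb F Γ)))
      (hC : IsFreeOb C Γ) (hD : IsFreeTy D ⟨op (Hom.onOb F Γ), A⟩) :
      GeneratingMaps F
  | tm {C D : CwF.{u}} (F : C ⟶ D) (x : C.Ty.Elements) (a : D.Tm.obj (Hom.onTy F x))
      (hC : IsFreeTy C x) (hD : IsFreeTm D ⟨Hom.onTy F x, a⟩) :
      GeneratingMaps F

/-- Basic cellular maps: pushouts of coproducts of generating maps. -/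
def basicCellularMaps : MorphismProperty CwF.{u} :=
  (MorphismProperty.coproducts.{u} GeneratingMaps).pushouts

/-- Cellular maps: sequential compositions of basic cellular maps. -/
def cellularMaps : MorphismProperty CwF.{u} :=
  basicCellularMaps.transfiniteCompositionsOfShape ℕ

/-- `C` is cellular if the map from the initial CwF to `C` is cellular. -/
def IsCellular (C : CwF.{u}) : Prop :=
  ∃ (Z : CwF.{u}) (hZ : IsInitial Z), cellularMaps (hZ.to C)

end CwF

/-! A cellular CwF is the syntax of a dependently typed first-order signature without equations. A
type is a generating type symbol applied to a substitution; a term is a variable or a generating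
term symbol applied to a substitution; and these forms are unique. Both facts follow from the
universal property of the tower of cell attachments. Existence: the types and terms of this shape
form a sub-CwF containing the generators, so its inclusion has a section (`exists_section`,
`isGen_of_section`). Uniqueness: sending each generator to a symbol in the CwF of untyped terms
defines an erasure, and erasure is injective (`tm_injective`, `ty_injective`).

For representability it is enough that each element is a restriction of a generic one, that is, one
that is terminal in its component (`HasEnoughGeneric.familiallyRepresentable`). In a context over
`Γ` extended by an instance of `Δ`, the base variables are flexible, because maps of the slice
substitute for them, while the variables of `Δ` are rigid. The generic form of a term keeps its
symbols and rigid variables and replaces each maximal subterm free of rigid variables by a fresh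
base variable (`generalizesAt`).

The result must still be well typed. This imposes equations between types which have a solution,
namely the given term, and hence a most general one, by first-order unification (`unifiesAt`,
`hasMGU_ty`). The dependent ingredient is the elimination of a variable `x` by a term `t` in which
it does not occur: the context is rearranged so that `x` comes after everything that does not depend
on it (`exists_split`), and the unifier is then a pullback along the section given by `t`
(`exists_unifier_var`). -/

/-! ### A criterion for familial representability -/

section Generic

variable {C : Type u} [Category.{v} C]

/-- An element `y` is generic if every element that has a common restriction with `y` is a
restriction of `y` along a unique map. -/
def IsGeneric (X : Cᵒᵖ ⥤ Type w) {e : C} (y : X.obj (op e)) : Prop :=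
  ∀ ⦃d c : C⦄ (f : d ⟶ e) (g : d ⟶ c) (x : X.obj (op c)), X.map f.op y = X.map g.op x →
    ∃! h : c ⟶ e, X.map h.op y = x

/-- A presheaf has enough generic elements if every element is a restriction of a generic one. -/
def HasEnoughGeneric (X : Cᵒᵖ ⥤ Type w) : Prop :=
  ∀ ⦃d : C⦄ (x : X.obj (op d)), ∃ (e : C) (y : X.obj (op e)) (f : d ⟶ e),
    X.map f.op y = x ∧ IsGeneric X y

/-- Having a unique map to a generic element propagates along a zigzag: genericity is a condition on
spans, and an arrow in either direction extends a map to `Y` to a span. -/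
lemma HasEnoughGeneric.familiallyRepresentable {X : Cᵒᵖ ⥤ Type w} (hX : HasEnoughGeneric X) :
    FamiliallyRepresentable X := by
  intro c
  induction c using Quotient.inductionOn' with | h x => ?_
  obtain ⟨⟨d⟩, x⟩ := x
  obtain ⟨e, y, f, hf, hy⟩ := hX x
  let Y : X.Elementsᵒᵖ := op ⟨op e, y⟩
  have key : ∀ Z : X.Elementsᵒᵖ, Zigzag Y Z → Nonempty (Unique (Z ⟶ Y)) := by
    have of_map : ∀ Z Z' W : X.Elementsᵒᵖ, (W ⟶ Y) → (W ⟶ Z') → Nonempty (Unique (Z' ⟶ Y)) := by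
      intro _ Z' W a b
      obtain ⟨h, h1, h2⟩ := hy (c := Z'.unop.1.unop) a.unop.1.unop b.unop.1.unop Z'.unop.2
        (a.unop.2.trans b.unop.2.symm)
      exact ⟨⟨⟨Quiver.Hom.op ⟨h.op, h1⟩⟩, fun k =>
        Quiver.Hom.unop_inj (Subtype.ext (Quiver.Hom.unop_inj (h2 _ k.unop.2)))⟩⟩
    intro Z hZ
    induction hZ with
    | refl => exact of_map Y Y Y (𝟙 _) (𝟙 _)
    | tail _ hz ih =>
      obtain ⟨ih⟩ := ih
      obtain ⟨⟨a⟩⟩ | ⟨⟨a⟩⟩ := hz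
      · exact of_map Y _ _ ih.default a
      · exact of_map Y _ _ (a ≫ ih.default) (𝟙 _)
  have hYx : (Quotient.mk'' Y : ConnectedComponents X.Elementsᵒᵖ) =
      Quotient.mk'' (op ⟨op d, x⟩) :=
    Quotient.sound' (Zigzag.of_inv (Quiver.Hom.op ⟨f.op, hf⟩))
  refine IsTerminal.hasTerminal (X := ⟨Y, hYx⟩) ?_
  refine @IsTerminal.ofUnique _ _ _ fun Z => ?_
  have hz := key Z.obj (Quotient.exact' (hYx.trans Z.property.symm))
  exact
    { default := ObjectProperty.homMk hz.some.default
      uniq := fun k => InducedCategory.hom_ext (hz.some.uniq k.hom) }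

lemma HasEnoughGeneric.of_iso {X X' : Cᵒᵖ ⥤ Type w} (i : X ≅ X') (hX : HasEnoughGeneric X') :
    HasEnoughGeneric X := by
  have inj : ∀ {c : Cᵒᵖ} {a b : X.obj c}, i.hom.app c a = i.hom.app c b → a = b := by
    intro c a b h
    simpa using congrArg (fun z => i.inv.app c z) h
  have nat : ∀ {c c' : Cᵒᵖ} (f : c ⟶ c') (x : X.obj c),
      i.hom.app c' (X.map f x) = X'.map f (i.hom.app c x) :=
    fun f x => NatTrans.naturality_apply i.hom f x
  intro d x
  obtain ⟨e, y, f, hf, hy⟩ := hX (i.hom.app _ x)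
  have hiy : i.hom.app _ (i.inv.app _ y) = y := by simp
  refine ⟨e, i.inv.app _ y, f, inj ?_, ?_⟩
  · rw [nat, hiy, hf]
  · intro d c f g x h
    obtain ⟨k, hk, hk'⟩ := hy f g (i.hom.app _ x) (by rw [← nat, ← h, nat, hiy])
    refine ⟨k, inj (by rw [nat, hiy]; exact hk), fun k' h' => hk' k' ?_⟩
    show X'.map k'.op y = _
    rw [← h', nat, hiy]

end Generic

/-! ### First-order terms -/

namespace CwF

/-- Untyped first-order terms with variables in `V` and symbols in `G`; every application records
its number of arguments. -/
inductive Raw (G : Type u) (V : Type) : Type u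
  | var (i : V) : Raw G V
  | app (g : G) (n : ℕ) (args : Fin n → Raw G V) : Raw G V

namespace Raw

variable {G : Type u} {V W W' : Type}

/-- Substitution. -/
def bind : Raw G V → (V → Raw G W) → Raw G W
  | var i, s => s i
  | app g n args, s => app g n fun k => (args k).bind s

@[simp] lemma bind_var_left (i : V) (s : V → Raw G W) : (var i).bind s = s i := rfl

@[simp] lemma bind_app (g : G) (n : ℕ) (args : Fin n → Raw G V) (s : V → Raw G W) :
    (app g n args).bind s = app g n fun k => (args k).bind s := rfl

@[simp] lemma bind_var (t : Raw G V) : t.bind var = t := by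
  induction t with
  | var i => rfl
  | app g n args ih => simp [ih]

lemma bind_bind (t : Raw G V) (s : V → Raw G W) (s' : W → Raw G W') :
    (t.bind s).bind s' = t.bind fun i => (s i).bind s' := by
  induction t with
  | var i => rfl
  | app g n args ih => simp [ih]

/-- The variable `i` occurs in a term. -/
def Occurs (i : V) : Raw G V → Prop
  | var j => i = j
  | app _ _ args => ∃ k, (args k).Occurs i

@[simp] lemma occurs_var {i j : V} : (var j : Raw G V).Occurs i ↔ i = j := Iff.rfl

@[simp] lemma occurs_app {i : V} {g : G} {n : ℕ} {args : Fin n → Raw G V} :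
    (app g n args).Occurs i ↔ ∃ k, (args k).Occurs i := Iff.rfl

lemma occurs_bind {t : Raw G V} {s : V → Raw G W} {i : W} :
    (t.bind s).Occurs i ↔ ∃ j, t.Occurs j ∧ (s j).Occurs i := by
  induction t with
  | var i => simp
  | app g n args ih =>
    simp only [bind_app, occurs_app, ih]
    exact ⟨fun ⟨k, j, h, h'⟩ => ⟨j, ⟨k, h⟩, h'⟩, fun ⟨j, ⟨k, h⟩, h'⟩ => ⟨k, j, h, h'⟩⟩

lemma bind_congr {t : Raw G V} {s s' : V → Raw G W} (h : ∀ i, t.Occurs i → s i = s' i) :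
    t.bind s = t.bind s' := by
  induction t with
  | var i => exact h i rfl
  | app g n args ih =>
    simp only [bind_app]
    congr 1
    funext k
    exact ih k fun i hi => h i ⟨k, hi⟩

lemma bind_eq_self {t : Raw G V} {s : V → Raw G V} (h : ∀ i, t.Occurs i → s i = var i) :
    t.bind s = t :=
  (bind_congr h).trans t.bind_var

/-- Substitutions by renamings that are injective on the variables of two terms are injective. -/
lemma bind_injective {t t' : Raw G V} {s : V → Raw G W} {P : V → Prop}
    (r : V → W) (hs : ∀ i, P i → s i = var (r i)) (hr : ∀ i j, P i → P j → r i = r j → i = j)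
    (ht : ∀ i, t.Occurs i → P i) (ht' : ∀ i, t'.Occurs i → P i) (h : t.bind s = t'.bind s) :
    t = t' := by
  induction t generalizing t' with
  | var i =>
    cases t' with
    | var j =>
      simp only [bind_var_left, hs i (ht i rfl), hs j (ht' j rfl), var.injEq] at h
      rw [hr i j (ht i rfl) (ht' j rfl) h]
    | app g n args => simp [hs i (ht i rfl)] at h
  | app g n args ih =>
    cases t' with
    | var j => simp [hs j (ht' j rfl)] at h
    | app g' n' args' =>
      simp only [bind_app, app.injEq] at h
      obtain ⟨rfl, rfl, h⟩ := h
      congr 1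
      funext k
      exact ih k (fun i hi => ht i ⟨k, hi⟩) (fun i hi => ht' i ⟨k, hi⟩) (congrFun (eq_of_heq h) k)

/-- The number of symbols of a term. -/
def size : Raw G V → ℕ
  | var _ => 0
  | app _ _ args => (∑ k, (args k).size) + 1

/-- A symbol strictly increases the size, so this bound forbids cyclic solutions in unification. -/
lemma size_le_size_bind {t : Raw G V} {i : V} (h : t.Occurs i) (s : V → Raw G W) :
    (s i).size ≤ (t.bind s).size := by
  induction t with
  | var j => rw [occurs_var.1 h]; rfl
  | app g n args ih =>
    obtain ⟨k, hk⟩ := h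
    exact (ih k hk).trans ((Finset.single_le_sum (f := fun k => ((args k).bind s).size)
      (fun _ _ => Nat.zero_le _) (Finset.mem_univ k)).trans (Nat.le_succ _))

/-- The occurs check. -/
lemma not_occurs_of_bind_eq {g : G} {n : ℕ} {args : Fin n → Raw G V} {i : V} {s : V → Raw G W}
    (h : s i = (app g n args).bind s) : ¬ (app g n args).Occurs i := by
  rintro ⟨k, hk⟩
  have h1 := size_le_size_bind hk s
  have h2 := Finset.single_le_sum (f := fun k => ((args k).bind s).size)
      (fun _ _ => Nat.zero_le _) (Finset.mem_univ k)
  have h3 := congrArg size h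
  simp only [bind_app, size] at h3
  omega

end Raw

end CwF

namespace CwF

/-! ### Terms together with their types -/

section

variable (C : CwF.{u})

/-- Terms over `Γ` of arbitrary type. -/
def STm (Γ : C.Ob) : Type u := Σ A : C.Ty.obj (op Γ), C.TmOf A

variable {C}

/-- The substitution of terms of arbitrary type. -/
def STm.sub {Γ Δ : C.Ob} (s : C.STm Γ) (σ : Δ ⟶ Γ) : C.STm Δ :=
  ⟨C.tySub s.1 σ, C.tmSub s.2 σ rfl⟩

/-- Bundling a term with its type turns transports along equations of types into plain equalities;
this is the passage from `tmSub` to the bundled form. -/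
lemma STm.mk_tmSub {Γ Δ : C.Ob} {A : C.Ty.obj (op Γ)} (a : C.TmOf A) (σ : Δ ⟶ Γ)
    {B : C.Ty.obj (op Δ)} (h : C.tySub A σ = B) :
    (⟨B, C.tmSub a σ h⟩ : C.STm Δ) = STm.sub ⟨A, a⟩ σ := by
  subst h; rfl

lemma STm.sub_fst {Γ Δ : C.Ob} (s : C.STm Γ) (σ : Δ ⟶ Γ) : (s.sub σ).1 = C.tySub s.1 σ := rfl

lemma STm.sub_comp {Γ Δ Θ : C.Ob} (s : C.STm Γ) (σ : Δ ⟶ Γ) (τ : Θ ⟶ Δ) :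
    s.sub (τ ≫ σ) = (s.sub σ).sub τ := by
  obtain ⟨A, a⟩ := s
  have h := C.tmSub_tmSub a σ rfl τ (C.tySub_comp A σ τ).symm
  exact (congrArg (Sigma.mk (C.tySub A (τ ≫ σ))) h.symm).trans (STm.mk_tmSub _ _ _)

lemma STm.sub_id {Γ : C.Ob} (s : C.STm Γ) : s.sub (𝟙 Γ) = s := by
  obtain ⟨A, a⟩ := s
  exact (STm.mk_tmSub a (𝟙 Γ) (C.tySub_id A)).symm.trans
    (congrArg (Sigma.mk A) (Functor.map_id_apply C.Tm ⟨op Γ, A⟩ a))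

lemma STm.exists_of_fst_eq {Γ : C.Ob} (s : C.STm Γ) {A : C.Ty.obj (op Γ)} (h : s.1 = A) :
    ∃ a : C.TmOf A, s = ⟨A, a⟩ := by
  subst h; exact ⟨s.2, rfl⟩

/-- The variable term with its type. -/
def svar {Γ : C.Ob} (A : C.Ty.obj (op Γ)) : C.STm (C.extOb A) := ⟨C.tySub A (C.proj A), C.var A⟩

lemma svar_fst {Γ : C.Ob} (A : C.Ty.obj (op Γ)) : (svar A).1 = C.tySub A (C.proj A) := rfl

/-- The substitution `⟨σ, s⟩ : Δ ⟶ Γ.A`. -/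
def spair {Γ Δ : C.Ob} (A : C.Ty.obj (op Γ)) (σ : Δ ⟶ Γ) (s : C.STm Δ)
    (h : s.1 = C.tySub A σ) : Δ ⟶ C.extOb A :=
  C.pair A σ (h ▸ s.2)

@[simp]
lemma spair_proj {Γ Δ : C.Ob} (A : C.Ty.obj (op Γ)) (σ : Δ ⟶ Γ) (s : C.STm Δ)
    (h : s.1 = C.tySub A σ) : spair A σ s h ≫ C.proj A = σ :=
  C.pair_proj _ _ _

@[simp]
lemma spair_proj_assoc {Γ Δ : C.Ob} (A : C.Ty.obj (op Γ)) (σ : Δ ⟶ Γ) (s : C.STm Δ)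
    (h : s.1 = C.tySub A σ) {Z : C.Ob} (k : Γ ⟶ Z) :
    spair A σ s h ≫ C.proj A ≫ k = σ ≫ k := by
  rw [← Category.assoc, spair_proj]

@[simp]
lemma svar_sub_spair {Γ Δ : C.Ob} (A : C.Ty.obj (op Γ)) (σ : Δ ⟶ Γ) (s : C.STm Δ)
    (h : s.1 = C.tySub A σ) : (svar A).sub (spair A σ s h) = s := by
  obtain ⟨B, a⟩ := s
  obtain rfl : B = C.tySub A σ := h
  exact (STm.mk_tmSub (C.var A) (C.pair A σ a) _).symm.trans
    (congrArg (Sigma.mk _) (C.var_pair A σ a))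

lemma ext_hom_ext' {Γ Δ : C.Ob} {A : C.Ty.obj (op Γ)} {f g : Δ ⟶ C.extOb A}
    (h : f ≫ C.proj A = g ≫ C.proj A) (h' : (svar A).sub f = (svar A).sub g) : f = g := by
  refine C.ext_hom_ext f g h (B := C.tySub (C.tySub A (C.proj A)) f) rfl ?_ ?_
  · rw [← tySub_comp, ← tySub_comp, h]
  · exact eq_of_heq (Sigma.mk.inj (h'.trans (STm.mk_tmSub (C.var A) g
      (by rw [← tySub_comp, ← tySub_comp, h])).symm)).2

lemma svar_sub_lift {Γ Δ : C.Ob} (σ : Δ ⟶ Γ) (A : C.Ty.obj (op Γ)) (B : C.Ty.obj (op Δ))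
    (h : C.tySub A σ = B) : (svar A).sub (C.lift σ A B h) = svar B :=
  (STm.mk_tmSub (C.var A) _ _).symm.trans (congrArg (Sigma.mk _) (C.var_lift σ A B h))

end

/-! ### The universal property of a basic cellular map -/

/-- A presentation of `Y` as obtained from `X` by freely adjoining types and terms. -/
structure CellStep {X Y : CwF.{u}} (f : X ⟶ Y) where
  TyIx : Type u
  TmIx : Type u
  ctx : TyIx → X.Ob
  ty : ∀ j, Y.Ty.obj (op (Hom.onOb f (ctx j)))
  tmTy : TmIx → X.Ty.Elements
  tm : ∀ j, Y.Tm.obj (Hom.onTy f (tmTy j))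
  exists_desc : ∀ (D : CwF.{u}) (s : X ⟶ D) (B : ∀ j, D.Ty.obj (op (Hom.onOb s (ctx j))))
    (b : ∀ j, D.Tm.obj (Hom.onTy s (tmTy j))), ∃ s' : Y ⟶ D, f ≫ s' = s ∧
      (∀ j, Hom.onTy s' ⟨_, ty j⟩ = ⟨_, B j⟩) ∧ ∀ j, Hom.onTm s' ⟨_, tm j⟩ = ⟨_, b j⟩
  hom_ext : ∀ (D : CwF.{u}) (s s' : Y ⟶ D), f ≫ s = f ≫ s' →
    (∀ j, Hom.onTy s ⟨_, ty j⟩ = Hom.onTy s' ⟨_, ty j⟩) →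
    (∀ j, Hom.onTm s ⟨_, tm j⟩ = Hom.onTm s' ⟨_, tm j⟩) → s = s'

lemma exists_ty_of_fst_eq {C : CwF.{u}} {x : C.Ty.Elements} {Γ : C.Ob} (h : x.1.unop = Γ) :
    ∃ A : C.Ty.obj (op Γ), x = ⟨op Γ, A⟩ := by
  subst h; exact ⟨x.2, rfl⟩

lemma exists_tm_of_fst_eq {C : CwF.{u}} {t : C.Tm.Elements} {x : C.Ty.Elements} (h : t.1 = x) :
    ∃ a : C.Tm.obj x, t = ⟨x, a⟩ := by
  subst h; exact ⟨t.2, rfl⟩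

/-- Case analysis in existential form, applicable to maps whose source and target are not variables.
-/
lemma GeneratingMaps.cases' {C D : CwF.{u}} {F : C ⟶ D} (h : GeneratingMaps F) :
    (∃ (Γ : C.Ob) (A : D.Ty.obj (op (Hom.onOb F Γ))),
      IsFreeOb C Γ ∧ IsFreeTy D ⟨op (Hom.onOb F Γ), A⟩) ∨
    ∃ (x : C.Ty.Elements) (a : D.Tm.obj (Hom.onTy F x)),
      IsFreeTy C x ∧ IsFreeTm D ⟨Hom.onTy F x, a⟩ := by
  cases h with
  | ty _ Γ A hC hD => exact Or.inl ⟨Γ, A, hC, hD⟩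
  | tm _ x a hC hD => exact Or.inr ⟨x, a, hC, hD⟩

/-- A map out of a pushout of a coproduct is a map out of the base with a compatible map out of each
cell, and the latter is determined by the value at the free generator. -/
lemma basicCellularMaps.nonempty_cellStep {P Q : CwF.{u}} {f : P ⟶ Q}
    (hf : basicCellularMaps f) : Nonempty (CellStep f) := by
  obtain ⟨A, B, p, a, b, hp, sq⟩ := hf
  obtain ⟨J, hp⟩ := (MorphismProperty.coproducts_iff _ _).1 hp
  obtain ⟨X₁, X₂, c₁, c₂, h₁, h₂, g, hg⟩ := hp
  -- The generating maps are only known to be of one of the two kinds, so the index set is split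
  -- classically; a cell admitting both readings counts as a type cell.
  let IsTy (j : J) : Prop := ∃ (Γ : (X₁.obj ⟨j⟩).Ob)
    (A : (X₂.obj ⟨j⟩).Ty.obj (op (Hom.onOb (g.app ⟨j⟩) Γ))),
      IsFreeOb _ Γ ∧ IsFreeTy _ ⟨op (Hom.onOb (g.app ⟨j⟩) Γ), A⟩
  have hTm (j : J) (hj : ¬ IsTy j) := (GeneratingMaps.cases' (hg ⟨j⟩)).resolve_left hj
  let α (j : J) : X₁.obj ⟨j⟩ ⟶ P := c₁.ι.app ⟨j⟩ ≫ a
  let β (j : J) : X₂.obj ⟨j⟩ ⟶ Q := c₂.ι.app ⟨j⟩ ≫ b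
  have comm (j : J) : α j ≫ f = g.app ⟨j⟩ ≫ β j := by
    simp only [α, β, Category.assoc, sq.w]
    simp
  choose Γ T hΓ hT using fun j : {j // IsTy j} => j.2
  choose x t hx ht using fun j : {j // ¬ IsTy j} => hTm j.1 j.2
  -- The adjoined type lies over `β (g Γ)`, which equals `f (α Γ)` only propositionally; it is
  -- replaced by a type lying strictly over the latter.
  have eT (j : {j // IsTy j}) := exists_ty_of_fst_eq (x := Hom.onTy (β j.1) ⟨_, T j⟩)
    (Γ := Hom.onOb f (Hom.onOb (α j.1) (Γ j)))
    (congrArg (fun k => Hom.onOb k (Γ j)) (comm j.1).symm)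
  choose T' hT' using eT
  have et (j : {j // ¬ IsTy j}) := exists_tm_of_fst_eq (t := Hom.onTm (β j.1) ⟨_, t j⟩)
    (x := Hom.onTy f (Hom.onTy (α j.1) (x j)))
    (congrArg (fun k => Hom.onTy k (x j)) (comm j.1).symm)
  choose t' ht' using et
  refine ⟨{ TyIx := {j // IsTy j}, TmIx := {j // ¬ IsTy j},
            ctx := fun j => Hom.onOb (α j.1) (Γ j), ty := T'
            tmTy := fun j => Hom.onTy (α j.1) (x j), tm := t'
            exists_desc := ?_, hom_ext := ?_ }⟩
  · intro D s U u
    have ex (j : J) : ∃ k : X₂.obj ⟨j⟩ ⟶ D, g.app ⟨j⟩ ≫ k = α j ≫ s ∧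
        (∀ h : IsTy j, Hom.onTy k ⟨_, T ⟨j, h⟩⟩ = ⟨_, U ⟨j, h⟩⟩) ∧
        ∀ h : ¬ IsTy j, Hom.onTm k ⟨_, t ⟨j, h⟩⟩ = ⟨_, u ⟨j, h⟩⟩ := by
      by_cases h : IsTy j
      · obtain ⟨k, hk⟩ := (hT ⟨j, h⟩ D).2 ⟨_, U ⟨j, h⟩⟩
        -- Both sides are maps out of a CwF free on an object, so it suffices to compare the images
        -- of that object.
        refine ⟨k, (hΓ ⟨j, h⟩ D).1 ?_, fun _ => hk, fun h' => (h' h).elim⟩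
        exact congrArg (fun z => z.1.unop) hk
      · obtain ⟨k, hk⟩ := (ht ⟨j, h⟩ D).2 ⟨_, u ⟨j, h⟩⟩
        refine ⟨k, (hx ⟨j, h⟩ D).1 ?_, fun h' => (h h').elim, fun _ => hk⟩
        exact congrArg (fun z => z.1) hk
    choose k hk hk₁ hk₂ using ex
    let q : c₂.pt ⟶ D := h₂.desc (Cocone.mk D (Discrete.natTrans fun j => k j.as))
    have hq (j : J) : c₂.ι.app ⟨j⟩ ≫ q = k j := h₂.fac _ _
    have hcomm : a ≫ s = h₁.desc (Cocone.mk _ (g ≫ c₂.ι)) ≫ q := by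
      refine h₁.hom_ext fun ⟨j⟩ => ?_
      rw [← Category.assoc, h₁.fac_assoc]
      exact (hk j).symm.trans ((congrArg (fun z => g.app ⟨j⟩ ≫ z) (hq j).symm).trans
        (Category.assoc _ _ _).symm)
    have hb (j : J) : β j ≫ sq.desc s q hcomm = k j := by
      rw [Category.assoc, sq.inr_desc, hq]
    refine ⟨sq.desc s q hcomm, sq.inl_desc _ _ _, fun j => ?_, fun j => ?_⟩
    · rw [← hT' j]
      exact (congrArg (fun z => Hom.onTy z ⟨_, T j⟩) (hb j.1)).trans (hk₁ j.1 j.2)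
    · rw [← ht' j]
      exact (congrArg (fun z => Hom.onTm z ⟨_, t j⟩) (hb j.1)).trans (hk₂ j.1 j.2)
  · intro D s s' h₀ hty htm
    refine sq.hom_ext h₀ (h₂.hom_ext fun ⟨j⟩ => ?_)
    rw [← Category.assoc, ← Category.assoc]
    by_cases h : IsTy j
    · refine (hT ⟨j, h⟩ D).1 ?_
      have := hty ⟨j, h⟩
      rw [← hT' ⟨j, h⟩] at this
      exact this
    · refine (ht ⟨j, h⟩ D).1 ?_
      have := htm ⟨j, h⟩
      rw [← ht' ⟨j, h⟩] at this
      exact this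

end CwF

namespace CwF

/-! ### The universal property of a cellular CwF -/

/-- A presentation of `C` as the colimit of a sequence of free extensions by types and terms,
starting from an initial CwF. -/
structure CellTower (C : CwF.{u}) where
  stage : ℕ ⥤ CwF.{u}
  incl : stage ⟶ (Functor.const ℕ).obj C
  isColimit : IsColimit (Cocone.mk C incl)
  isInitial : IsInitial (stage.obj 0)
  step (n : ℕ) : CellStep (stage.map (homOfLE (Nat.le_succ n)))

lemma IsCellular.nonempty_cellTower {C : CwF.{u}} (hC : C.IsCellular) :
    Nonempty (CellTower C) := by
  obtain ⟨Z, hZ, ⟨h⟩⟩ := hC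
  exact ⟨{ stage := h.F, incl := h.incl, isColimit := h.isColimit
           isInitial := hZ.ofIso h.isoBot.symm
           step := fun n => (basicCellularMaps.nonempty_cellStep
            (h.map_mem n (not_isMax n))).some }⟩

namespace CellTower

variable {C : CwF.{u}} (T : CellTower C)

/-- The map from a stage to the colimit. -/
def ι (n : ℕ) : T.stage.obj n ⟶ C := T.incl.app n

/-- The map from a stage to the next one. -/
def next (n : ℕ) : T.stage.obj n ⟶ T.stage.obj (n + 1) := T.stage.map (homOfLE (Nat.le_succ n))

lemma next_ι (n : ℕ) : T.next n ≫ T.ι (n + 1) = T.ι n :=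
  (T.incl.naturality (homOfLE (Nat.le_succ n))).trans (Category.comp_id _)

/-- The generating types. -/
def TySym : Type u := Σ n, (T.step n).TyIx

/-- The generating terms. -/
def TmSym : Type u := Σ n, (T.step n).TmIx

/-- The context of a generating type, and the generating type. -/
def tyGen (S : T.TySym) : C.Ty.Elements :=
  Hom.onTy (T.ι (S.1 + 1)) ⟨_, (T.step S.1).ty S.2⟩

/-- The context and the type of a generating term, and the generating term. -/
def tmGen (f : T.TmSym) : C.Tm.Elements :=
  Hom.onTm (T.ι (f.1 + 1)) ⟨_, (T.step f.1).tm f.2⟩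

lemma hom_ext {D : CwF.{u}} {s s' : C ⟶ D} (h : ∀ n, T.ι n ≫ s = T.ι n ≫ s') : s = s' :=
  T.isColimit.hom_ext h

/-- Recursion along the tower carrying an invariant `Q`: the extension to the next stage may use
what was established at the previous one. -/
lemma exists_of_stages {D : CwF.{u}} (Q : ∀ n, (T.stage.obj n ⟶ D) → Prop) (h₀ : ∀ s, Q 0 s)
    (hs : ∀ n s, Q n s → ∃ s', T.next n ≫ s' = s ∧ Q (n + 1) s') :
    ∃ s : C ⟶ D, ∀ n, Q n (T.ι n ≫ s) := by
  choose nx hnx hQ using hs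
  let q : ∀ n, {s : T.stage.obj n ⟶ D // Q n s} := fun n =>
    Nat.rec ⟨T.isInitial.to D, h₀ _⟩ (fun n s => ⟨nx n s.1 s.2, hQ n s.1 s.2⟩) n
  have hq (n : ℕ) : T.next n ≫ (q (n + 1)).1 = (q n).1 := hnx n (q n).1 (q n).2
  let c : Cocone T.stage := Cocone.mk D (NatTrans.ofSequence (fun n => (q n).1)
    fun n => (hq n).trans (Category.comp_id _).symm)
  refine ⟨T.isColimit.desc c, fun n => ?_⟩
  have e : T.ι n ≫ T.isColimit.desc c = (q n).1 := T.isColimit.fac c n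
  rw [e]
  exact (q n).2

lemma snd_eq_of_eq {D : CwF.{u}} (c : ∀ Γ : D.Ob, D.Ty.obj (op Γ)) {x : D.Ty.Elements} {Γ : D.Ob}
    (h : x = ⟨op Γ, c Γ⟩) : x.2 = c x.1.unop := by
  subst h; rfl

lemma snd_eq_of_eq' {D : CwF.{u}} (c : ∀ x : D.Ty.Elements, D.Tm.obj x) {t : D.Tm.Elements}
    {x : D.Ty.Elements} (h : t = ⟨x, c x⟩) : t.2 = c t.1 := by
  subst h; rfl

/-- The prescribed values are given over every context of `D`, because the image of the context of a
generator is known only once the map is built. -/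
lemma exists_hom (D : CwF.{u}) (cTy : T.TySym → ∀ Γ : D.Ob, D.Ty.obj (op Γ))
    (cTm : T.TmSym → ∀ x : D.Ty.Elements, D.Tm.obj x) :
    ∃ E : C ⟶ D, (∀ S, (Hom.onTy E (T.tyGen S)).2 = cTy S (Hom.onTy E (T.tyGen S)).1.unop) ∧
      ∀ f, (Hom.onTm E (T.tmGen f)).2 = cTm f (Hom.onTm E (T.tmGen f)).1 := by
  obtain ⟨E, hE⟩ := T.exists_of_stages (D := D)
    (fun n => match n with
      | 0 => fun _ => True
      | n + 1 => fun s => (∀ j, (Hom.onTy s ⟨_, (T.step n).ty j⟩).2 = cTy ⟨n, j⟩ _) ∧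
          ∀ j, (Hom.onTm s ⟨_, (T.step n).tm j⟩).2 = cTm ⟨n, j⟩ _)
    (fun _ => trivial) (fun n s _ => by
      obtain ⟨s', h, h₁, h₂⟩ := (T.step n).exists_desc D s (fun j => cTy ⟨n, j⟩ _)
        (fun j => cTm ⟨n, j⟩ _)
      exact ⟨s', h, fun j => snd_eq_of_eq _ (h₁ j), fun j => snd_eq_of_eq' _ (h₂ j)⟩)
  exact ⟨E, fun S => (hE (S.1 + 1)).1 S.2, fun f => (hE (f.1 + 1)).2 f.2⟩

/-- This is the left lifting property against `π`, applied to the identity of `C`. Generators must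
lift over every object above their context, since the lift of the context has been fixed at an
earlier stage. -/
lemma exists_section {D : CwF.{u}} (π : D ⟶ C)
    (hTy : ∀ (S : T.TySym) (Γ : D.Ob), Hom.onOb π Γ = (T.tyGen S).1.unop →
      ∃ B, Hom.onTy π ⟨op Γ, B⟩ = T.tyGen S)
    (hTm : ∀ (f : T.TmSym) (x : D.Ty.Elements), Hom.onTy π x = (T.tmGen f).1 →
      ∃ b, Hom.onTm π ⟨x, b⟩ = T.tmGen f) :
    ∃ s : C ⟶ D, s ≫ π = 𝟙 C := by
  obtain ⟨s, hs⟩ := T.exists_of_stages (D := D) (fun n s => s ≫ π = T.ι n)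
    (fun _ => T.isInitial.hom_ext _ _) (fun n s hs => by
      have hn : s ≫ π = T.next n ≫ T.ι (n + 1) := hs.trans (T.next_ι n).symm
      choose B hB using fun j => hTy ⟨n, j⟩ (Hom.onOb s ((T.step n).ctx j))
        (congrArg (fun k => Hom.onOb k ((T.step n).ctx j)) hn)
      choose b hb using fun j => hTm ⟨n, j⟩ (Hom.onTy s ((T.step n).tmTy j))
        (congrArg (fun k => Hom.onTy k ((T.step n).tmTy j)) hn)
      obtain ⟨s', h, h₁, h₂⟩ := (T.step n).exists_desc D s B b
      refine ⟨s', h, (T.step n).hom_ext C _ _ ?_ (fun j => ?_) fun j => ?_⟩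
      · rw [← Category.assoc, h]
        exact hn
      · exact (congrArg (Hom.onTy π) (h₁ j)).trans (hB j)
      · exact (congrArg (Hom.onTm π) (h₂ j)).trans (hb j))
  refine ⟨s, T.hom_ext fun n => ?_⟩
  rw [← Category.assoc, hs, Category.comp_id]

end CellTower

end CwF

namespace CwF

/-! ### The CwF of untyped first-order terms -/

/-- The contexts of the CwF of untyped terms. -/
structure RawCtx (G : Type u) : Type u where
  len : ℕ

instance (G : Type u) : SmallCategory (RawCtx G) where
  Hom m n := Fin n.len → Raw G (Fin m.len)
  id _ := Raw.var
  comp f g := fun i => (g i).bind f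
  id_comp _ := funext fun _ => Raw.bind_var _
  comp_id _ := rfl
  assoc _ _ _ := funext fun _ => (Raw.bind_bind _ _ _).symm

lemma RawCtx.comp_apply {G : Type u} {m n k : RawCtx G} (f : m ⟶ n) (g : n ⟶ k)
    (i : Fin k.len) : (f ≫ g) i = (g i).bind f := rfl

/-- The presheaf of untyped terms. -/
def rawPresheaf (G : Type u) : (RawCtx G)ᵒᵖ ⥤ Type u where
  obj m := Raw G (Fin m.unop.len)
  map f := ↾fun t => t.bind f.unop
  map_id _ := ConcreteCategory.hom_ext _ _ fun t => Raw.bind_var t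
  map_comp f g := ConcreteCategory.hom_ext _ _ fun t => (Raw.bind_bind t f.unop g.unop).symm

/-- The projection of the extended context. -/
def RawCtx.proj {G : Type u} (m : RawCtx G) : (⟨m.len + 1⟩ : RawCtx G) ⟶ m :=
  fun i => .var i.castSucc

/-- The CwF in which both types and terms are untyped terms. -/
def rawCwF (G : Type u) : CwF.{u} where
  Ob := RawCtx G
  empty := ⟨0⟩
  isTerminalEmpty := @IsTerminal.ofUnique _ _ _ fun _ =>
    { default := Fin.elim0, uniq := fun _ => funext fun i => i.elim0 }
  Ty := rawPresheaf G
  Tm := CategoryOfElements.π _ ⋙ rawPresheaf G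
  ext {m} _ := Over.mk m.proj
  extRepr {m} A :=
    { homEquiv := fun {X} =>
        { toFun := fun f => (show Raw G (Fin X.left.len) from f.left (Fin.last m.len))
          invFun := fun t => Over.homMk (V := Over.mk m.proj)
            (Fin.snoc (α := fun _ => Raw G (Fin X.left.len)) X.hom t :
              Fin (m.len + 1) → Raw G (Fin X.left.len))
            (funext fun i => Fin.snoc_castSucc (α := fun _ => Raw G (Fin X.left.len)) _ _ _)
          left_inv := fun f => by
            refine Over.OverMorphism.ext (funext fun i => ?_)
            refine Fin.lastCases ?_ (fun i => ?_) i
            · exact Fin.snoc_last (α := fun _ => Raw G (Fin X.left.len)) _ _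
            · refine (Fin.snoc_castSucc (α := fun _ => Raw G (Fin X.left.len)) _ _ _).trans ?_
              exact (congrFun (Over.w f) i).symm
          right_inv := fun t => Fin.snoc_last (α := fun _ => Raw G (Fin X.left.len)) _ _ }
      homEquiv_comp := fun _ _ => rfl }

/-! ### Erasure of types -/

/-- An assignment of untyped terms, with natural numbers as variables, to the types, the terms and
the substitutions of a CwF. The variables of a context `Γ` are numbered from `0` to
`len Γ - 1`. -/
structure Erasure (C : CwF.{u}) (G : Type u) where
  len : C.Ob → ℕ
  ty {Γ : C.Ob} : C.Ty.obj (op Γ) → Raw G ℕ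
  tm {Γ : C.Ob} : C.STm Γ → Raw G ℕ
  hom {Γ Δ : C.Ob} : (Δ ⟶ Γ) → ℕ → Raw G ℕ
  len_empty : len C.empty = 0
  len_ext {Γ : C.Ob} (A : C.Ty.obj (op Γ)) : len (C.extOb A) = len Γ + 1
  ty_lt {Γ : C.Ob} {A : C.Ty.obj (op Γ)} {i : ℕ} : (ty A).Occurs i → i < len Γ
  tm_lt {Γ : C.Ob} {s : C.STm Γ} {i : ℕ} : (tm s).Occurs i → i < len Γ
  hom_lt {Γ Δ : C.Ob} {σ : Δ ⟶ Γ} {i j : ℕ} : i < len Γ → (hom σ i).Occurs j → j < len Δ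
  ty_sub {Γ Δ : C.Ob} (A : C.Ty.obj (op Γ)) (σ : Δ ⟶ Γ) : ty (C.tySub A σ) = (ty A).bind (hom σ)
  tm_sub {Γ Δ : C.Ob} (s : C.STm Γ) (σ : Δ ⟶ Γ) : tm (s.sub σ) = (tm s).bind (hom σ)
  hom_comp {Γ Δ Θ : C.Ob} (σ : Δ ⟶ Γ) (τ : Θ ⟶ Δ) {i : ℕ} : i < len Γ →
    hom (τ ≫ σ) i = (hom σ i).bind (hom τ)
  hom_id {Γ : C.Ob} {i : ℕ} : i < len Γ → hom (𝟙 Γ) i = .var i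
  hom_proj {Γ : C.Ob} (A : C.Ty.obj (op Γ)) {i : ℕ} : i < len Γ → hom (C.proj A) i = .var i
  tm_svar {Γ : C.Ob} (A : C.Ty.obj (op Γ)) : tm (svar A) = .var (len Γ)

/-- The substitution of natural numbers for the variables in `Fin n`. -/
def Raw.toNat {G : Type u} {n : ℕ} (t : Raw G (Fin n)) : Raw G ℕ := t.bind fun i => .var i

lemma Raw.toNat_lt {G : Type u} {n : ℕ} {t : Raw G (Fin n)} {i : ℕ} (h : t.toNat.Occurs i) :
    i < n := by
  obtain ⟨j, -, h⟩ := Raw.occurs_bind.1 h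
  rw [Raw.occurs_var.1 h]
  exact j.2

/-- The extension of a substitution to all natural numbers. -/
def RawCtx.homToNat {G : Type u} {m n : RawCtx G} (f : m ⟶ n) (i : ℕ) : Raw G ℕ :=
  -- The default value is never relevant: the variables of an erased type or term are below the
  -- length of its context, and the laws for `hom` assume the same bound.
  if h : i < n.len then (f ⟨i, h⟩).toNat else .var i

lemma RawCtx.homToNat_of_lt {G : Type u} {m n : RawCtx G} (f : m ⟶ n) {i : ℕ} (h : i < n.len) :
    RawCtx.homToNat f i = (f ⟨i, h⟩).toNat :=
  dif_pos h

lemma Raw.toNat_bind {G : Type u} {m n : RawCtx G} (f : m ⟶ n) (t : Raw G (Fin n.len)) :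
    (t.bind f).toNat = t.toNat.bind (RawCtx.homToNat f) := by
  rw [Raw.toNat, Raw.toNat, Raw.bind_bind, Raw.bind_bind]
  congr 1
  funext i
  exact (RawCtx.homToNat_of_lt f i.2).symm

lemma RawCtx.homToNat_comp {G : Type u} {m n k : RawCtx G} (f : m ⟶ n) (g : n ⟶ k) {i : ℕ}
    (h : i < k.len) :
    RawCtx.homToNat (f ≫ g) i = (RawCtx.homToNat g i).bind (RawCtx.homToNat f) := by
  rw [homToNat_of_lt _ h, homToNat_of_lt _ h, RawCtx.comp_apply, Raw.toNat_bind]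

lemma RawCtx.homToNat_eqToHom {G : Type u} {m n : RawCtx G} (e : m = n) {i : ℕ} (h : i < n.len) :
    RawCtx.homToNat (eqToHom e) i = .var i := by
  subst e
  exact homToNat_of_lt _ h

/-- The erasure given by a morphism to the CwF of untyped terms. -/
def Erasure.ofHom {C : CwF.{u}} {G : Type u} (E : C ⟶ rawCwF G) : Erasure C G where
  len Γ := RawCtx.len (G := G) (Hom.onOb E Γ)
  ty {Γ} A := Raw.toNat (n := RawCtx.len (G := G) (Hom.onOb E Γ))
    ((Hom.toPreHom E).mapTy A)
  tm {Γ} s := Raw.toNat (n := RawCtx.len (G := G) (Hom.onOb E Γ)) (Hom.mapTm E s.2)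
  hom σ := RawCtx.homToNat (G := G) (E.functor.map σ)
  len_empty := congrArg (RawCtx.len (G := G)) (Hom.map_empty E)
  len_ext A := congrArg (RawCtx.len (G := G)) (Hom.map_extOb E A)
  ty_lt := Raw.toNat_lt
  tm_lt := Raw.toNat_lt
  hom_lt {_ _ σ _ _} h h' := by
    rw [RawCtx.homToNat_of_lt (G := G) (E.functor.map σ) h] at h'
    exact Raw.toNat_lt h'
  ty_sub A σ := (congrArg Raw.toNat ((Hom.toPreHom E).mapTy_sub A σ)).trans
    (Raw.toNat_bind (G := G) (E.functor.map σ) _)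
  tm_sub s σ := (congrArg Raw.toNat (Hom.mapTm_sub E s.2 σ rfl)).trans
    (Raw.toNat_bind (G := G) (E.functor.map σ) _)
  hom_comp σ τ i h := by
    rw [E.functor.map_comp]
    exact RawCtx.homToNat_comp (G := G) _ _ h
  hom_id h := by
    rw [E.functor.map_id]
    exact RawCtx.homToNat_of_lt (G := G) _ h
  hom_proj {Γ} A i h := by
    rw [Hom.map_proj E]
    refine (RawCtx.homToNat_comp (G := G) _ _ h).trans ?_
    have h1 := RawCtx.homToNat_of_lt (G := G) (RawCtx.proj (Hom.onOb E Γ)) h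
    refine (congrArg (fun z => Raw.bind z _) h1).trans ?_
    exact RawCtx.homToNat_eqToHom _ (Nat.lt_succ_of_lt h)
  tm_svar {Γ} A := by
    refine (congrArg Raw.toNat (Hom.map_var E A)).trans ?_
    refine (Raw.toNat_bind (G := G) (eqToHom (Hom.map_extOb E A)) (.var (Fin.last _))).trans ?_
    exact RawCtx.homToNat_eqToHom _ (Nat.lt_succ_self _)

end CwF

namespace CwF

/-! ### The sub-CwF generated by types and terms -/

/-- The number of types of a telescope. -/
def Telescope.length {C : CwF.{u}} {Γ : C.Ob} : {Θ : C.Ob} → Telescope C Γ Θ → ℕ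
  | _, .nil => 0
  | _, .snoc Δ _ => Δ.length + 1

/-- The variables of a telescope. -/
def Telescope.var {C : CwF.{u}} {Γ : C.Ob} : {Θ : C.Ob} → Telescope C Γ Θ → ℕ → Option (C.STm Θ)
  | _, .nil, _ => none
  | _, .snoc Δ A, i =>
    if i = Δ.length then some (svar A) else (Δ.var i).map fun s => s.sub (C.proj A)

lemma Telescope.var_lt {C : CwF.{u}} {Γ Θ : C.Ob} (Δ : Telescope C Γ Θ) {i : ℕ} {s : C.STm Θ}
    (h : Δ.var i = some s) : i < Δ.length := by
  induction Δ with
  | nil => simp [Telescope.var] at h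
  | snoc Δ A ih =>
    simp only [Telescope.var, Telescope.length] at h ⊢
    split at h
    · omega
    · obtain ⟨s', h, -⟩ := Option.map_eq_some_iff.1 h
      have := ih h
      omega

/-- Families of types and of terms of a CwF. -/
structure Gens (C : CwF.{u}) where
  TySym : Type u
  TmSym : Type u
  tyGen : TySym → C.Ty.Elements
  tmGen : TmSym → C.Tm.Elements

namespace Gens

variable {C : CwF.{u}} (g : Gens C)

/-- The context of a generating type. -/
def tyCtx (S : g.TySym) : C.Ob := (g.tyGen S).1.unop

/-- A generating type. -/
def genTy (S : g.TySym) : C.Ty.obj (op (g.tyCtx S)) := (g.tyGen S).2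

/-- The context of a generating term. -/
def tmCtx (f : g.TmSym) : C.Ob := (g.tmGen f).1.1.unop

/-- A generating term. -/
def genTm (f : g.TmSym) : C.STm (g.tmCtx f) := ⟨(g.tmGen f).1.2, (g.tmGen f).2⟩

/-- A type is generated if it is a substitution of a generating type. -/
def IsGenTy {Γ : C.Ob} (A : C.Ty.obj (op Γ)) : Prop :=
  ∃ (S : g.TySym) (σ : Γ ⟶ g.tyCtx S), A = C.tySub (g.genTy S) σ

/-- A term is generated if it is a variable or a substitution of a generating term. -/
def IsGenTm {Γ : C.Ob} (Δ : Telescope C C.empty Γ) (s : C.STm Γ) : Prop :=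
  (∃ i, Δ.var i = some s) ∨ ∃ (f : g.TmSym) (σ : Γ ⟶ g.tmCtx f), s = (g.genTm f).sub σ

/-- A substitution is generated if it sends the variables to generated terms. -/
def IsGenHom {Γ Γ' : C.Ob} (Δ : Telescope C C.empty Γ) (Δ' : Telescope C C.empty Γ')
    (σ : Γ' ⟶ Γ) : Prop :=
  ∀ i s, Δ.var i = some s → g.IsGenTm Δ' (s.sub σ)

variable {g}

/-- Only the outermost symbol is constrained and `σ` is an arbitrary map of `C`, so closure under
substitution is just composition. -/
lemma IsGenTy.sub {Γ Γ' : C.Ob} {A : C.Ty.obj (op Γ)} (h : g.IsGenTy A) (σ : Γ' ⟶ Γ) :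
    g.IsGenTy (C.tySub A σ) := by
  obtain ⟨S, τ, rfl⟩ := h
  exact ⟨S, σ ≫ τ, (C.tySub_comp _ _ _).symm⟩

lemma IsGenTm.sub {Γ Γ' : C.Ob} {Δ : Telescope C C.empty Γ} {Δ' : Telescope C C.empty Γ'}
    {s : C.STm Γ} (h : g.IsGenTm Δ s) {σ : Γ' ⟶ Γ} (hσ : g.IsGenHom Δ Δ' σ) :
    g.IsGenTm Δ' (s.sub σ) := by
  obtain ⟨i, h⟩ | ⟨f, τ, rfl⟩ := h
  · exact hσ i s h
  · exact Or.inr ⟨f, σ ≫ τ, (STm.sub_comp _ _ _).symm⟩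

lemma isGenHom_id {Γ : C.Ob} (Δ : Telescope C C.empty Γ) : g.IsGenHom Δ Δ (𝟙 Γ) :=
  fun i s h => Or.inl ⟨i, by rw [STm.sub_id, h]⟩

lemma IsGenHom.comp {Γ Γ' Γ'' : C.Ob} {Δ : Telescope C C.empty Γ} {Δ' : Telescope C C.empty Γ'}
    {Δ'' : Telescope C C.empty Γ''} {σ : Γ' ⟶ Γ} {τ : Γ'' ⟶ Γ'} (hσ : g.IsGenHom Δ Δ' σ)
    (hτ : g.IsGenHom Δ' Δ'' τ) : g.IsGenHom Δ Δ'' (τ ≫ σ) := fun i s h => by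
  rw [STm.sub_comp]
  exact (hσ i s h).sub hτ

lemma isGenHom_proj {Γ : C.Ob} (Δ : Telescope C C.empty Γ) (A : C.Ty.obj (op Γ)) :
    g.IsGenHom Δ (.snoc Δ A) (C.proj A) := fun i s h => Or.inl ⟨i, by
  -- Variables are counted from the left end of the telescope, so weakening keeps their index.
  rw [Telescope.var, if_neg (Δ.var_lt h).ne, h]; rfl⟩

lemma isGenTm_svar {Γ : C.Ob} (Δ : Telescope C C.empty Γ) (A : C.Ty.obj (op Γ)) :
    g.IsGenTm (.snoc Δ A) (svar A) :=
  Or.inl ⟨Δ.length, by rw [Telescope.var, if_pos rfl]⟩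

lemma isGenHom_of_proj {Γ Γ' : C.Ob} {Δ : Telescope C C.empty Γ} {A : C.Ty.obj (op Γ)}
    {Δ' : Telescope C C.empty Γ'} {σ : Γ' ⟶ C.extOb A} (h : g.IsGenHom Δ Δ' (σ ≫ C.proj A))
    (h' : g.IsGenTm Δ' ((svar A).sub σ)) : g.IsGenHom (.snoc Δ A) Δ' σ := by
  intro i s hs
  rw [Telescope.var] at hs
  split at hs
  · obtain rfl := Option.some.inj hs
    exact h'
  · obtain ⟨s', hs', rfl⟩ := Option.map_eq_some_iff.1 hs
    rw [← STm.sub_comp]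
    exact h i s' hs'

variable (g)

/-- Contexts of the generated sub-CwF. -/
structure Ctx (g : Gens C) : Type u where
  ob : C.Ob
  tel : Telescope C C.empty ob

instance : SmallCategory g.Ctx where
  Hom Γ' Γ := {σ : Γ'.ob ⟶ Γ.ob // g.IsGenHom Γ.tel Γ'.tel σ}
  id Γ := ⟨𝟙 Γ.ob, isGenHom_id _⟩
  comp σ τ := ⟨σ.1 ≫ τ.1, τ.2.comp σ.2⟩
  id_comp σ := Subtype.ext (Category.id_comp σ.1)
  comp_id σ := Subtype.ext (Category.comp_id σ.1)
  assoc σ τ υ := Subtype.ext (Category.assoc σ.1 τ.1 υ.1)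

/-- The presheaf of generated types. -/
def subTy : g.Ctxᵒᵖ ⥤ Type u where
  obj Γ := {A : C.Ty.obj (op Γ.unop.ob) // g.IsGenTy A}
  map σ := ↾fun A => ⟨C.tySub A.1 σ.unop.1, A.2.sub _⟩
  map_id _ := ConcreteCategory.hom_ext _ _ fun A => Subtype.ext (C.tySub_id A.1)
  map_comp _ _ := ConcreteCategory.hom_ext _ _ fun A => Subtype.ext (C.tySub_comp A.1 _ _)

lemma isGenTm_tmSub {Γ Γ' : g.Ctx} {A : C.Ty.obj (op Γ.ob)} {B : C.Ty.obj (op Γ'.ob)}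
    (σ : Γ' ⟶ Γ) (h : C.tySub A σ.1 = B) (a : {a : C.TmOf A // g.IsGenTm Γ.tel ⟨A, a⟩}) :
    g.IsGenTm Γ'.tel ⟨B, C.tmSub a.1 σ.1 h⟩ := by
  rw [STm.mk_tmSub]
  exact a.2.sub σ.2

/-- The dependent presheaf of generated terms. -/
def subTm : g.subTy.Elements ⥤ Type u where
  obj x := {a : C.TmOf x.2.1 // g.IsGenTm x.1.unop.tel ⟨x.2.1, a⟩}
  map σ := ↾fun a => ⟨C.tmSub a.1 σ.1.unop.1 (congrArg Subtype.val σ.2),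
    g.isGenTm_tmSub σ.1.unop (congrArg Subtype.val σ.2) a⟩
  map_id x := ConcreteCategory.hom_ext _ _ fun a =>
    Subtype.ext (Functor.map_id_apply C.Tm ⟨op x.1.unop.ob, x.2.1⟩ a.1)
  map_comp σ τ := ConcreteCategory.hom_ext _ _ fun a =>
    Subtype.ext (C.tmSub_tmSub a.1 σ.1.unop.1 (congrArg Subtype.val σ.2) τ.1.unop.1
      (congrArg Subtype.val τ.2)).symm

/-- The extension of a generated context. -/
def subExt {Γ : g.Ctx} (A : g.subTy.obj (op Γ)) : Over Γ :=
  Over.mk (Y := (⟨C.extOb A.1, .snoc Γ.tel A.1⟩ : g.Ctx))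
    (⟨C.proj A.1, isGenHom_proj _ _⟩ :
      {k : C.extOb A.1 ⟶ Γ.ob // g.IsGenHom Γ.tel (.snoc Γ.tel A.1) k})

/-- The universal property of the extension of a generated context. -/
def subExtRepr {Γ : g.Ctx} (A : g.subTy.obj (op Γ)) :
    (restrictedPresheaf g.subTm A).RepresentableBy (g.subExt A) where
  homEquiv {X} :=
    { toFun := fun f => ⟨C.tmSub (C.var A.1) f.left.1
          ((C.tySub_comp A.1 (C.proj A.1) f.left.1).symm.trans
            (congrArg (fun k => C.tySub A.1 k.1) (Over.w f))), by
          refine (congrArg (g.IsGenTm X.left.tel) (STm.mk_tmSub (C.var A.1) f.left.1 _)).mpr ?_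
          exact (isGenTm_svar _ _).sub f.left.2⟩
      invFun := fun a => Over.homMk (V := g.subExt A)
        (⟨C.pair A.1 X.hom.1 a.1, isGenHom_of_proj
            ((congrArg (g.IsGenHom Γ.tel X.left.tel) (C.pair_proj A.1 X.hom.1 a.1)).mpr X.hom.2)
            ((congrArg (g.IsGenTm X.left.tel)
              (svar_sub_spair A.1 X.hom.1 ⟨_, a.1⟩ rfl)).mpr a.2)⟩ :
          {σ : X.left.ob ⟶ C.extOb A.1 // g.IsGenHom (.snoc Γ.tel A.1) X.left.tel σ})
        (Subtype.ext (C.pair_proj _ _ _))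
      left_inv := fun f => by
        refine Over.OverMorphism.ext (Subtype.ext ?_)
        refine C.ext_hom_ext _ _ ((C.pair_proj _ _ _).trans
          (congrArg Subtype.val (Over.w f)).symm) (B := C.tySub A.1 X.hom.1)
          ((C.tySub_comp _ _ _).symm.trans (congrArg (C.tySub A.1) (C.pair_proj _ _ _))) ?_
          (C.var_pair _ _ _)
        exact (C.tySub_comp A.1 (C.proj A.1) f.left.1).symm.trans
          (congrArg (fun k => C.tySub A.1 k.1) (Over.w f))
      right_inv := fun a => Subtype.ext (C.var_pair _ _ _) }
  homEquiv_comp f k := Subtype.ext (C.tmSub_tmSub _ _ _ _ _).symm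

/-- The sub-CwF of generated contexts, types and terms. -/
def subCwF : CwF.{u} where
  Ob := g.Ctx
  empty := ⟨C.empty, .nil⟩
  isTerminalEmpty := @IsTerminal.ofUnique _ _ _ fun Γ =>
    { default := (⟨C.isTerminalEmpty.from Γ.ob, fun i s h => by simp [Telescope.var] at h⟩ :
        {σ : Γ.ob ⟶ C.empty // g.IsGenHom .nil Γ.tel σ})
      uniq := fun σ => Subtype.ext (C.isTerminalEmpty.hom_ext _ _) }
  Ty := g.subTy
  Tm := g.subTm
  ext := g.subExt
  extRepr := g.subExtRepr

/-- The inclusion of the generated sub-CwF. -/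
def subIncl : g.subCwF ⟶ C :=
  show Hom g.subCwF C from
  { functor :=
      { obj := fun Γ => Ctx.ob Γ
        map := fun σ => σ.1 }
    ty := { app := fun _ => ↾fun A => A.1 }
    tm := { app := fun _ => ↾fun a => a.1 }
    map_empty := rfl
    map_extOb := fun _ => rfl
    map_proj := fun A => (Category.id_comp _).symm
    map_var := fun A => rfl }

end Gens

end CwF

namespace CwF

/-! ### Normal forms in cellular CwFs -/

/-- Normal forms for a CwF: every context is a telescope over the empty context, every type is a
substitution of a generating type, every term is a variable or a substitution of a generating
term, and the generators are sent to distinct symbols by an erasure. -/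
structure Presentation (C : CwF.{u}) where
  gens : Gens C
  er : Erasure C (gens.TySym ⊕ gens.TmSym)
  er_genTy (S : gens.TySym) :
    er.ty (gens.genTy S) = .app (.inl S) (er.len (gens.tyCtx S)) fun i => .var i
  er_genTm (f : gens.TmSym) :
    er.tm (gens.genTm f) = .app (.inr f) (er.len (gens.tmCtx f)) fun i => .var i
  tel (Γ : C.Ob) : Telescope C C.empty Γ
  isGenTy {Γ : C.Ob} (A : C.Ty.obj (op Γ)) : gens.IsGenTy A
  isGenTm {Γ : C.Ob} (s : C.STm Γ) : gens.IsGenTm (tel Γ) s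

/-- The lifting condition of `exists_section`: a generator is its own instance along the identity.
-/
lemma Gens.exists_subIncl_ty {C : CwF.{u}} (g : Gens C) (S : g.TySym) (Γ : g.subCwF.Ob)
    (h : Hom.onOb g.subIncl Γ = (g.tyGen S).1.unop) :
    ∃ B, Hom.onTy g.subIncl ⟨op Γ, B⟩ = g.tyGen S := by
  have hS : g.IsGenTy (g.tyGen S).2 := ⟨S, 𝟙 _, (C.tySub_id _).symm⟩
  revert h hS
  generalize g.tyGen S = y
  obtain ⟨⟨Γ'⟩, A⟩ := y
  rintro rfl hA
  exact ⟨⟨A, hA⟩, rfl⟩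

lemma Gens.exists_subIncl_tm {C : CwF.{u}} (g : Gens C) (f : g.TmSym)
    (x : g.subCwF.Ty.Elements) (h : Hom.onTy g.subIncl x = (g.tmGen f).1) :
    ∃ b, Hom.onTm g.subIncl ⟨x, b⟩ = g.tmGen f := by
  have hf : ∀ Δ, g.IsGenTm Δ ⟨(g.tmGen f).1.2, (g.tmGen f).2⟩ :=
    fun Δ => Or.inr ⟨f, 𝟙 _, (STm.sub_id _).symm⟩
  revert h hf
  generalize g.tmGen f = y
  obtain ⟨y, a⟩ := y
  rintro rfl ha
  exact ⟨⟨a, ha _⟩, rfl⟩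

/-- The generating types and terms of a cellular CwF. -/
def CellTower.gens {C : CwF.{u}} (T : CellTower C) : Gens C := ⟨T.TySym, T.TmSym, T.tyGen, T.tmGen⟩

/-- Everything in `C` is the image under the inclusion of its image under `s`, hence generated. The
intermediate `transport` replaces `s ≫ g.subIncl` by a variable `k`, so that the equation with the
identity can be eliminated despite the dependency of types on contexts. -/
lemma Gens.isGen_of_section {C : CwF.{u}} (g : Gens C) (s : C ⟶ g.subCwF)
    (hs : s ≫ g.subIncl = 𝟙 C) :
    (∀ (Γ : C.Ob) (A : C.Ty.obj (op Γ)), g.IsGenTy A) ∧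
      ∀ Γ : C.Ob, ∃ Δ : Telescope C C.empty Γ, ∀ t : C.STm Γ, g.IsGenTm Δ t := by
  have transport : ∀ k : C ⟶ C, k = 𝟙 C →
      ((∀ (Γ : C.Ob) (A : C.Ty.obj (op Γ)), g.IsGenTy ((Hom.toPreHom k).mapTy A)) ∧
        ∀ Γ : C.Ob, ∃ Δ : Telescope C C.empty (Hom.onOb k Γ), ∀ t : C.STm Γ,
          g.IsGenTm Δ ⟨(Hom.toPreHom k).mapTy t.1, Hom.mapTm k t.2⟩) →
      (∀ (Γ : C.Ob) (A : C.Ty.obj (op Γ)), g.IsGenTy A) ∧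
        ∀ Γ : C.Ob, ∃ Δ : Telescope C C.empty Γ, ∀ t : C.STm Γ, g.IsGenTm Δ t := by
    rintro k rfl h
    exact h
  exact transport _ hs ⟨fun Γ A => ((Hom.toPreHom s).mapTy A).2,
    fun Γ => ⟨(Hom.onOb s Γ).tel, fun t => (Hom.mapTm s t.2).2⟩⟩

lemma CellTower.nonempty_presentation {C : CwF.{u}} (T : CellTower C) :
    Nonempty (Presentation C) := by
  obtain ⟨s, hs⟩ := T.exists_section T.gens.subIncl T.gens.exists_subIncl_ty
    T.gens.exists_subIncl_tm
  obtain ⟨h₁, h₂⟩ := T.gens.isGen_of_section s hs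
  choose tel htel using h₂
  -- Each generator goes to its own symbol applied to all the variables of its context.
  obtain ⟨E, hE₁, hE₂⟩ := T.exists_hom (rawCwF (T.TySym ⊕ T.TmSym))
    (fun S (Γ : RawCtx _) => .app (.inl S) Γ.len .var)
    (fun f x => .app (.inr f) (RawCtx.len (G := T.TySym ⊕ T.TmSym) x.1.unop) .var)
  exact ⟨{ gens := T.gens
           er := Erasure.ofHom E
           er_genTy := fun S => congrArg Raw.toNat (hE₁ S)
           er_genTm := fun f => congrArg Raw.toNat (hE₂ f)
           tel := tel
           isGenTy := h₁ _
           isGenTm := htel _ }⟩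

end CwF

/-! ### Injectivity of erasure -/

namespace CwF

namespace Erasure

variable {C : CwF.{u}} {G : Type u} (e : Erasure C G)

lemma hom_comp_proj {Γ Δ : C.Ob} {A : C.Ty.obj (op Γ)} (σ : Δ ⟶ C.extOb A) {i : ℕ}
    (h : i < e.len Γ) : e.hom (σ ≫ C.proj A) i = e.hom σ i := by
  rw [e.hom_comp _ _ h, e.hom_proj A h, Raw.bind_var_left]

lemma tm_svar_sub {Γ Δ : C.Ob} {A : C.Ty.obj (op Γ)} (σ : Δ ⟶ C.extOb A) :
    e.tm ((svar A).sub σ) = e.hom σ (e.len Γ) := by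
  rw [e.tm_sub, e.tm_svar, Raw.bind_var_left]

/-- Variables are numbered from the start of the context, so weakening does not renumber them. -/
lemma ty_sub_proj {Γ : C.Ob} (A B : C.Ty.obj (op Γ)) : e.ty (C.tySub B (C.proj A)) = e.ty B := by
  rw [e.ty_sub]
  exact Raw.bind_eq_self fun i hi => e.hom_proj A (e.ty_lt hi)

lemma tm_sub_proj {Γ : C.Ob} (A : C.Ty.obj (op Γ)) (s : C.STm Γ) :
    e.tm (s.sub (C.proj A)) = e.tm s := by
  rw [e.tm_sub]
  exact Raw.bind_eq_self fun i hi => e.hom_proj A (e.tm_lt hi)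

lemma len_telescope {Θ : C.Ob} (Δ : Telescope C C.empty Θ) : e.len Θ = Δ.length := by
  induction Δ with
  | nil => exact e.len_empty
  | snoc Δ A ih => rw [e.len_ext, ih, Telescope.length]

lemma tm_telescope_var {Θ : C.Ob} (Δ : Telescope C C.empty Θ) {i : ℕ} {s : C.STm Θ}
    (h : Δ.var i = some s) : e.tm s = .var i := by
  induction Δ with
  | nil => simp [Telescope.var] at h
  | snoc Δ A ih =>
    rw [Telescope.var] at h
    split at h
    · obtain rfl := Option.some.inj h
      rw [e.tm_svar, e.len_telescope Δ]
      congr 1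
      omega
    · obtain ⟨s, h', rfl⟩ := Option.map_eq_some_iff.1 h
      rw [e.tm_sub_proj, ih h']

/-- A substitution that is an injective renaming of variables. -/
structure IsRenaming {Γ E : C.Ob} (w : Γ ⟶ E) (r : ℕ → ℕ) : Prop where
  hom_eq {i : ℕ} : i < e.len E → e.hom w i = .var (r i)
  inj {i j : ℕ} : i < e.len E → j < e.len E → r i = r j → i = j

lemma isRenaming_proj {Γ : C.Ob} (A : C.Ty.obj (op Γ)) : e.IsRenaming (C.proj A) id :=
  ⟨fun h => e.hom_proj A h, fun _ _ h => h⟩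

end Erasure

namespace Presentation

variable {C : CwF.{u}} (P : Presentation C)

/-- Every context is a telescope over the empty one. Maps into `Ξ` are thus treated by induction on
`Ξ`, one component at a time. -/
lemma ob_induction (P : Presentation C) {motive : C.Ob → Prop} (empty : motive C.empty)
    (ext : ∀ (Γ : C.Ob) (A : C.Ty.obj (op Γ)), motive Γ → motive (C.extOb A)) (Γ : C.Ob) :
    motive Γ := by
  induction P.tel Γ with
  | nil => exact empty
  | snoc Δ A ih => exact ext _ A ih

lemma ty_genTy_sub {Γ : C.Ob} (S : P.gens.TySym) (σ : Γ ⟶ P.gens.tyCtx S) :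
    P.er.ty (C.tySub (P.gens.genTy S) σ) =
      .app (.inl S) (P.er.len (P.gens.tyCtx S)) fun i => P.er.hom σ i := by
  rw [P.er.ty_sub, P.er_genTy]; rfl

lemma tm_genTm_sub {Γ : C.Ob} (f : P.gens.TmSym) (σ : Γ ⟶ P.gens.tmCtx f) :
    P.er.tm ((P.gens.genTm f).sub σ) =
      .app (.inr f) (P.er.len (P.gens.tmCtx f)) fun i => P.er.hom σ i := by
  rw [P.er.tm_sub, P.er_genTm]; rfl

lemma tm_cases {Γ : C.Ob} (s : C.STm Γ) :
    (∃ i, (P.tel Γ).var i = some s ∧ P.er.tm s = .var i) ∨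
      ∃ (f : P.gens.TmSym) (σ : Γ ⟶ P.gens.tmCtx f), s = (P.gens.genTm f).sub σ := by
  obtain ⟨i, h⟩ | h := P.isGenTm s
  · exact Or.inl ⟨i, h, P.er.tm_telescope_var _ h⟩
  · exact Or.inr h

lemma eq_genTm_sub_of_tm_eq {Γ : C.Ob} {s : C.STm Γ} {g n args} (h : P.er.tm s = .app g n args) :
    ∃ (f : P.gens.TmSym) (σ : Γ ⟶ P.gens.tmCtx f), s = (P.gens.genTm f).sub σ := by
  obtain ⟨i, -, hi⟩ | h' := P.tm_cases s
  · rw [hi] at h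
    cases h
  · exact h'

lemma exists_tm_eq_var {Γ : C.Ob} {i : ℕ} (h : i < P.er.len Γ) :
    ∃ s : C.STm Γ, P.er.tm s = .var i := by
  induction Γ using P.ob_induction with
  | empty => rw [P.er.len_empty] at h; omega
  | ext Γ A ih =>
    rw [P.er.len_ext] at h
    obtain h | rfl := Nat.lt_succ_iff_lt_or_eq.1 h
    · obtain ⟨s, hs⟩ := ih h
      exact ⟨s.sub (C.proj A), by rw [P.er.tm_sub_proj, hs]⟩
    · exact ⟨svar A, P.er.tm_svar A⟩

lemma exists_tm_eq_hom {Γ Δ : C.Ob} (σ : Δ ⟶ Γ) {i : ℕ} (h : i < P.er.len Γ) :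
    ∃ s : C.STm Γ, P.er.tm s = .var i ∧ P.er.tm (s.sub σ) = P.er.hom σ i := by
  obtain ⟨s, hs⟩ := P.exists_tm_eq_var h
  exact ⟨s, hs, by rw [P.er.tm_sub, hs, Raw.bind_var_left]⟩

/-- Injectivity on terms is assumed only for terms erasing to a component of `σ`, so that this can
be used inside the structural induction proving `tm_injective`. The other lemmas ending in `_of_tm`
have this form for the same reason. -/
lemma hom_ext_of_tm {Γ Ξ : C.Ob} {σ σ' : Γ ⟶ Ξ}
    (h : ∀ i < P.er.len Ξ, P.er.hom σ i = P.er.hom σ' i)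
    (H : ∀ i < P.er.len Ξ, ∀ s s' : C.STm Γ, P.er.tm s = P.er.hom σ i →
      P.er.tm s' = P.er.hom σ i → s = s') : σ = σ' := by
  induction Ξ using P.ob_induction with
  | empty => exact C.isTerminalEmpty.hom_ext _ _
  | ext Ξ A ih =>
    have hl := P.er.len_ext A
    refine ext_hom_ext' (ih (fun i hi => ?_) fun i hi => ?_) ?_
    · rw [P.er.hom_comp_proj _ hi, P.er.hom_comp_proj _ hi, h i (by omega)]
    · rw [P.er.hom_comp_proj _ hi]
      exact H i (by omega)
    · exact H (P.er.len Ξ) (by omega) _ _ (P.er.tm_svar_sub σ)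
        ((P.er.tm_svar_sub σ').trans (h _ (by omega)).symm)

/-- Erasure is injective on terms, including their types. -/
lemma tm_injective {Γ : C.Ob} {s s' : C.STm Γ} (h : P.er.tm s = P.er.tm s') : s = s' := by
  suffices ∀ (r : Raw (P.gens.TySym ⊕ P.gens.TmSym) ℕ) (s s' : C.STm Γ), P.er.tm s = r →
    P.er.tm s' = r → s = s' from this _ s s' rfl h.symm
  intro r
  induction r with
  | var i =>
    -- A symbol application never erases to a variable, and the fixed telescope `P.tel Γ` has at
    -- most one variable, with its type, at each index.
    have key : ∀ s : C.STm Γ, P.er.tm s = .var i → (P.tel Γ).var i = some s := by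
      intro s hs
      obtain ⟨j, hj, hj'⟩ | ⟨f, σ, rfl⟩ := P.tm_cases s
      · rw [hs] at hj'
        rw [Raw.var.inj hj', hj]
      · rw [P.tm_genTm_sub] at hs
        cases hs
    intro s s' hs hs'
    exact Option.some.inj ((key s hs).symm.trans (key s' hs'))
  | app g n args ih =>
    intro s s' hs hs'
    obtain ⟨f, σ, rfl⟩ := P.eq_genTm_sub_of_tm_eq hs
    obtain ⟨f', σ', rfl⟩ := P.eq_genTm_sub_of_tm_eq hs'
    rw [P.tm_genTm_sub] at hs hs'
    cases hs
    obtain ⟨h₁, -, h₂⟩ := Raw.app.inj hs'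
    obtain rfl := Sum.inr.inj h₁
    have h₃ := congrFun (eq_of_heq h₂)
    obtain rfl : σ = σ' := P.hom_ext_of_tm (fun i hi => (h₃ ⟨i, hi⟩).symm)
      fun i hi => ih ⟨i, hi⟩
    rfl

lemma hom_injective {Γ Ξ : C.Ob} {σ σ' : Γ ⟶ Ξ}
    (h : ∀ i < P.er.len Ξ, P.er.hom σ i = P.er.hom σ' i) : σ = σ' :=
  P.hom_ext_of_tm h fun _ _ _ _ hs hs' => P.tm_injective (hs.trans hs'.symm)

/-- Erasure records the head symbol and the components of the substitution, so both can be read off.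
-/
lemma genTm_sub_injective {Γ Γ' : C.Ob} {f f' : P.gens.TmSym} {σ : Γ ⟶ P.gens.tmCtx f}
    {σ' : Γ' ⟶ P.gens.tmCtx f'}
    {a : ℕ → Raw _ ℕ} {a' : ℕ → Raw _ ℕ}
    (h : (P.er.tm ((P.gens.genTm f).sub σ)).bind a =
      (P.er.tm ((P.gens.genTm f').sub σ')).bind a') :
    ∃ e : f = f', ∀ i < P.er.len (P.gens.tmCtx f), (P.er.hom σ i).bind a =
      (P.er.hom (e ▸ σ' : Γ' ⟶ P.gens.tmCtx f) i).bind a' := by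
  rw [P.tm_genTm_sub, P.tm_genTm_sub] at h
  obtain ⟨h₁, -, h₂⟩ := Raw.app.inj h
  obtain rfl := Sum.inr.inj h₁
  exact ⟨rfl, fun i hi => congrFun (eq_of_heq h₂) ⟨i, hi⟩⟩

lemma genTy_sub_injective {Γ Γ' : C.Ob} {S S' : P.gens.TySym} {σ : Γ ⟶ P.gens.tyCtx S}
    {σ' : Γ' ⟶ P.gens.tyCtx S'}
    {a : ℕ → Raw _ ℕ} {a' : ℕ → Raw _ ℕ}
    (h : (P.er.ty (C.tySub (P.gens.genTy S) σ)).bind a =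
      (P.er.ty (C.tySub (P.gens.genTy S') σ')).bind a') :
    ∃ e : S = S', ∀ i < P.er.len (P.gens.tyCtx S), (P.er.hom σ i).bind a =
      (P.er.hom (e ▸ σ' : Γ' ⟶ P.gens.tyCtx S) i).bind a' := by
  rw [P.ty_genTy_sub, P.ty_genTy_sub] at h
  obtain ⟨h₁, -, h₂⟩ := Raw.app.inj h
  obtain rfl := Sum.inl.inj h₁
  exact ⟨rfl, fun i hi => congrFun (eq_of_heq h₂) ⟨i, hi⟩⟩

lemma ty_injective {Γ : C.Ob} {A B : C.Ty.obj (op Γ)} (h : P.er.ty A = P.er.ty B) : A = B := by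
  obtain ⟨S, σ, rfl⟩ := P.isGenTy A
  obtain ⟨S', σ', rfl⟩ := P.isGenTy B
  obtain ⟨e, h⟩ := P.genTy_sub_injective (congrArg (fun t => t.bind Raw.var) h)
  subst e
  rw [P.hom_injective (σ := σ) (σ' := σ') (by simpa using h)]

/-! ### Strengthening -/

section Renaming

variable {P} {Γ E : C.Ob} {w : Γ ⟶ E} {r : ℕ → ℕ}

lemma tySub_renaming_injective (hw : P.er.IsRenaming w r) {A B : C.Ty.obj (op E)} (h : C.tySub A w = C.tySub B w) :
    A = B := by
  apply P.ty_injective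
  have h' := congrArg P.er.ty h
  rw [P.er.ty_sub, P.er.ty_sub] at h'
  exact Raw.bind_injective (P := fun i => i < P.er.len E) r (fun _ hi => hw.hom_eq hi)
    (fun _ _ hi hj => hw.inj hi hj) (fun _ hi => P.er.ty_lt hi) (fun _ hi => P.er.ty_lt hi) h'

lemma sub_renaming_injective (hw : P.er.IsRenaming w r) {s s' : C.STm E} (h : s.sub w = s'.sub w) : s = s' := by
  apply P.tm_injective
  have h' := congrArg P.er.tm h
  rw [P.er.tm_sub, P.er.tm_sub] at h'
  exact Raw.bind_injective (P := fun i => i < P.er.len E) r (fun _ hi => hw.hom_eq hi)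
    (fun _ _ hi hj => hw.inj hi hj) (fun _ hi => P.er.tm_lt hi) (fun _ hi => P.er.tm_lt hi) h'

/-- A map descends along a renaming as soon as its components do; their types follow. -/
lemma exists_hom_strengthening_of_tm (hw : P.er.IsRenaming w r) {Ξ : C.Ob} (σ : Γ ⟶ Ξ)
    (H : ∀ i < P.er.len Ξ, ∀ s : C.STm Γ, P.er.tm s = P.er.hom σ i →
      ∃ s₀ : C.STm E, s = s₀.sub w) : ∃ σ₀ : E ⟶ Ξ, σ = w ≫ σ₀ := by
  induction Ξ using P.ob_induction with
  | empty => exact ⟨C.isTerminalEmpty.from _, C.isTerminalEmpty.hom_ext _ _⟩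
  | ext Ξ A ih =>
    have hl := P.er.len_ext A
    obtain ⟨σ₀, h₀⟩ := ih (σ ≫ C.proj A) fun i hi => by
      rw [P.er.hom_comp_proj _ hi]
      exact H i (by omega)
    obtain ⟨s₀, hs₀⟩ := H (P.er.len Ξ) (by omega) _ (P.er.tm_svar_sub σ)
    -- The two types agree after substitution along `w`, which is injective on types.
    have hty : s₀.1 = C.tySub A σ₀ := by
      apply tySub_renaming_injective hw
      rw [← STm.sub_fst, ← hs₀, ← tySub_comp, ← h₀, STm.sub_fst, svar_fst, tySub_comp]
    refine ⟨spair A σ₀ s₀ hty, ext_hom_ext' ?_ ?_⟩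
    · rw [Category.assoc, spair_proj, h₀]
    · rw [STm.sub_comp, svar_sub_spair, hs₀]

/-- No condition on the type of `s` is needed: `E` is itself a context, so the variables it contains
already have their types there. -/
lemma exists_tm_strengthening (hw : P.er.IsRenaming w r) (s : C.STm Γ)
    (h : ∀ i, (P.er.tm s).Occurs i → ∃ j < P.er.len E, r j = i) :
    ∃ s₀ : C.STm E, s = s₀.sub w := by
  suffices ∀ (t : Raw (P.gens.TySym ⊕ P.gens.TmSym) ℕ), (∀ i, t.Occurs i →
      ∃ j < P.er.len E, r j = i) → ∀ (s : C.STm Γ), P.er.tm s = t → ∃ s₀ : C.STm E, s = s₀.sub w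
      from this _ h s rfl
  intro t
  induction t with
  | var i =>
    intro h s hs
    obtain ⟨j, hj, rfl⟩ := h i rfl
    obtain ⟨s₀, -, hs₀⟩ := P.exists_tm_eq_hom w hj
    exact ⟨s₀, P.tm_injective (by rw [hs, hs₀, hw.hom_eq hj])⟩
  | app g n args ih =>
    intro h s hs
    obtain ⟨f, σ, rfl⟩ := P.eq_genTm_sub_of_tm_eq hs
    rw [P.tm_genTm_sub] at hs
    cases hs
    obtain ⟨σ₀, rfl⟩ := exists_hom_strengthening_of_tm hw σ fun i hi =>
      ih ⟨i, hi⟩ fun j hj => h j ⟨⟨i, hi⟩, hj⟩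
    exact ⟨(P.gens.genTm f).sub σ₀, STm.sub_comp _ _ _⟩

lemma exists_ty_strengthening (hw : P.er.IsRenaming w r) (A : C.Ty.obj (op Γ))
    (h : ∀ i, (P.er.ty A).Occurs i → ∃ j < P.er.len E, r j = i) :
    ∃ A₀ : C.Ty.obj (op E), A = C.tySub A₀ w := by
  obtain ⟨S, σ, rfl⟩ := P.isGenTy A
  rw [P.ty_genTy_sub] at h
  obtain ⟨σ₀, rfl⟩ := exists_hom_strengthening_of_tm hw σ fun i hi s hs =>
    exists_tm_strengthening hw s fun j hj => h j ⟨⟨i, hi⟩, by rwa [hs] at hj⟩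
  exact ⟨C.tySub (P.gens.genTy S) σ₀, C.tySub_comp _ _ _⟩

end Renaming

end Presentation

end CwF

/-! ### Pullbacks -/

/-- A morphism is carrable if all its pullbacks exist. -/
def Carrable {C : Type u} [Category.{v} C] {X Y : C} (g : X ⟶ Y) : Prop :=
  ∀ ⦃Z : C⦄ (s : Z ⟶ Y), ∃ (P : C) (a : P ⟶ X) (b : P ⟶ Z), IsPullback a b g s

namespace Carrable

variable {C : Type u} [Category.{v} C]

lemma id (X : C) : Carrable (𝟙 X) := fun Z s =>
  ⟨Z, s, 𝟙 Z, IsPullback.of_vert_isIso ⟨by simp⟩⟩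

lemma comp {X Y W : C} {g : X ⟶ Y} {g' : Y ⟶ W} (hg : Carrable g) (hg' : Carrable g') :
    Carrable (g ≫ g') := fun Z s => by
  obtain ⟨P₁, a₁, b₁, h₁⟩ := hg' s
  obtain ⟨P₂, a₂, b₂, h₂⟩ := hg a₁
  exact ⟨P₂, a₂, b₂ ≫ b₁, h₂.paste_vert h₁⟩

lemma of_isPullback {P X Y Z : C} {a : P ⟶ X} {b : P ⟶ Z} {g : X ⟶ Y} {s : Z ⟶ Y}
    (h : IsPullback a b g s) (hg : Carrable g) : Carrable b := fun Z' s' => by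
  obtain ⟨P', a', b', h'⟩ := hg (s' ≫ s)
  have hw : a' ≫ g = (b' ≫ s') ≫ s := by rw [h'.w, Category.assoc]
  refine ⟨P', h.lift a' (b' ≫ s') hw, b', IsPullback.of_right (h₁₂ := a) (v₁₃ := g) (h₂₂ := s)
    ?_ (h.lift_snd _ _ _) h⟩
  rw [h.lift_fst]
  exact h'

end Carrable

namespace CwF

lemma isPullback_lift {C : CwF.{u}} {Γ Δ : C.Ob} (σ : Δ ⟶ Γ) (A : C.Ty.obj (op Γ))
    (B : C.Ty.obj (op Δ)) (h : C.tySub A σ = B) :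
    IsPullback (C.lift σ A B h) (C.proj B) (C.proj A) σ := by
  have hty {Z : C.Ob} (a : Z ⟶ C.extOb A) (b : Z ⟶ Δ) (hab : a ≫ C.proj A = b ≫ σ) :
      ((svar A).sub a).1 = C.tySub B b := by
    rw [STm.sub_fst, svar_fst, ← tySub_comp, hab, tySub_comp, h]
  refine ⟨⟨C.lift_proj σ A B h⟩, ⟨PullbackCone.IsLimit.mk _
    (fun s => spair B s.snd ((svar A).sub s.fst) (hty _ _ s.condition)) (fun s => ?_)
    (fun s => spair_proj _ _ _ _) (fun s m h₁ h₂ => ?_)⟩⟩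
  · refine ext_hom_ext' ?_ ?_
    · rw [Category.assoc, C.lift_proj, spair_proj_assoc, s.condition]
    · rw [STm.sub_comp, svar_sub_lift, svar_sub_spair]
  · refine ext_hom_ext' (by rw [h₂, spair_proj]) ?_
    rw [svar_sub_spair, ← h₁, STm.sub_comp, svar_sub_lift]

lemma carrable_proj {C : CwF.{u}} {Γ : C.Ob} (A : C.Ty.obj (op Γ)) : Carrable (C.proj A) :=
  fun _ s => ⟨_, _, _, isPullback_lift s A _ rfl⟩

namespace Presentation

variable {C : CwF.{u}} (P : Presentation C)

/-! ### Solving for a variable -/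

/-- If `i` occurs only in the type of the last component, it still occurs in an earlier component,
because this type is an instance of `A` along the earlier components. -/
lemma occurs_hom_of_tm {Γ Ξ : C.Ob} (σ : Γ ⟶ Ξ) {i j : ℕ}
    (H : ∀ k < P.er.len Ξ, ∀ s : C.STm Γ, P.er.tm s = P.er.hom σ k → (P.er.tm s).Occurs j →
      (P.er.tm s).Occurs i ∨ (P.er.ty s.1).Occurs i)
    (hj : ∃ k < P.er.len Ξ, (P.er.hom σ k).Occurs j) :
    ∃ k < P.er.len Ξ, (P.er.hom σ k).Occurs i := by
  induction Ξ using P.ob_induction with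
  | empty =>
    obtain ⟨k, hk, -⟩ := hj
    rw [P.er.len_empty] at hk
    omega
  | ext Ξ A ih =>
    have hl := P.er.len_ext A
    obtain ⟨k, hk, hj⟩ := hj
    have key : (∃ k < P.er.len Ξ, (P.er.hom (σ ≫ C.proj A) k).Occurs i) →
        ∃ k < P.er.len (C.extOb A), (P.er.hom σ k).Occurs i := by
      rintro ⟨k, hk, h⟩
      rw [P.er.hom_comp_proj _ hk] at h
      exact ⟨k, by omega, h⟩
    rw [hl] at hk
    obtain hk | rfl := Nat.lt_succ_iff_lt_or_eq.1 hk
    · refine key (ih (σ ≫ C.proj A) (fun k hk => ?_) ⟨k, hk, ?_⟩)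
      · rw [P.er.hom_comp_proj _ hk]
        exact H k (by omega)
      · rwa [P.er.hom_comp_proj _ hk]
    · have hs := P.er.tm_svar_sub σ
      obtain h | h := H (P.er.len Ξ) (by omega) _ hs (by rwa [hs])
      · exact ⟨P.er.len Ξ, by omega, by rwa [hs] at h⟩
      · rw [STm.sub_fst, svar_fst, ← tySub_comp, P.er.ty_sub] at h
        obtain ⟨k, hk, hk'⟩ := Raw.occurs_bind.1 h
        exact key ⟨k, P.er.ty_lt hk, hk'⟩

/-- The variables of the type of a variable that occurs in a term occur in the term or in its
type. -/
lemma occurs_tm_or_ty {Γ : C.Ob} {s x : C.STm Γ} {i j : ℕ} (hs : (P.er.tm s).Occurs j)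
    (hx : P.er.tm x = .var j) (hi : (P.er.ty x.1).Occurs i) :
    (P.er.tm s).Occurs i ∨ (P.er.ty s.1).Occurs i := by
  suffices ∀ (t : Raw (P.gens.TySym ⊕ P.gens.TmSym) ℕ) (s : C.STm Γ), P.er.tm s = t →
      (P.er.tm s).Occurs j → (P.er.tm s).Occurs i ∨ (P.er.ty s.1).Occurs i
      from this _ s rfl hs
  intro t
  induction t with
  | var k =>
    intro s hs h
    rw [hs] at h
    obtain rfl : j = k := h
    obtain rfl := P.tm_injective (hs.trans hx.symm)
    exact Or.inr hi
  | app g n args ih =>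
    intro s hs h
    obtain ⟨f, σ, rfl⟩ := P.eq_genTm_sub_of_tm_eq hs
    rw [P.tm_genTm_sub] at hs h ⊢
    cases hs
    obtain ⟨k, hk⟩ := h
    obtain ⟨k, hk, hk'⟩ := P.occurs_hom_of_tm σ (i := i) (j := j)
      (fun k hk s hs => ih ⟨k, hk⟩ s hs) ⟨k, k.2, hk⟩
    exact Or.inl ⟨⟨k, hk⟩, hk'⟩

lemma occurs_ty {Γ : C.Ob} {A : C.Ty.obj (op Γ)} {x : C.STm Γ} {i j : ℕ}
    (hA : (P.er.ty A).Occurs j) (hx : P.er.tm x = .var j) (hi : (P.er.ty x.1).Occurs i) :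
    (P.er.ty A).Occurs i := by
  obtain ⟨S, σ, rfl⟩ := P.isGenTy A
  rw [P.ty_genTy_sub] at hA ⊢
  obtain ⟨k, hk⟩ := hA
  obtain ⟨k, hk, hk'⟩ := P.occurs_hom_of_tm σ (i := i) (j := j)
    (fun k hk s _ h => P.occurs_tm_or_ty h hx hi) ⟨k, k.2, hk⟩
  exact ⟨⟨k, hk⟩, hk'⟩

/-- A variable of an extended context is either the last one or a variable of the context. -/
lemma tm_eq_var_ext {Γ : C.Ob} {A : C.Ty.obj (op Γ)} {x : C.STm (C.extOb A)} {i : ℕ}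
    (hx : P.er.tm x = .var i) :
    (i = P.er.len Γ ∧ x = svar A) ∨
      i < P.er.len Γ ∧ ∃ x₀ : C.STm Γ, P.er.tm x₀ = .var i ∧ x = x₀.sub (C.proj A) := by
  have hi : i < P.er.len (C.extOb A) := P.er.tm_lt (s := x) (by rw [hx]; rfl)
  rw [P.er.len_ext] at hi
  obtain hi | rfl := Nat.lt_succ_iff_lt_or_eq.1 hi
  · obtain ⟨x₀, h₀⟩ := P.exists_tm_eq_var hi
    exact Or.inr ⟨hi, x₀, h₀, P.tm_injective (by rw [P.er.tm_sub_proj, hx, h₀])⟩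
  · exact Or.inl ⟨rfl, P.tm_injective (by rw [P.er.tm_svar, hx])⟩

lemma lt_of_occurs_ty_var {Γ : C.Ob} {x : C.STm Γ} {i j : ℕ} (hx : P.er.tm x = .var i)
    (hj : (P.er.ty x.1).Occurs j) : j < i := by
  induction Γ using P.ob_induction with
  | empty =>
    have hi : i < P.er.len C.empty := P.er.tm_lt (s := x) (by rw [hx]; rfl)
    rw [P.er.len_empty] at hi
    omega
  | ext Γ A ih =>
    obtain ⟨rfl, rfl⟩ | ⟨-, x₀, h₀, rfl⟩ := P.tm_eq_var_ext hx
    · rw [svar_fst, P.er.ty_sub_proj] at hj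
      exact P.er.ty_lt hj
    · rw [STm.sub_fst, P.er.ty_sub_proj] at hj
      exact ih h₀ hj

/-- Every variable `x` of a context `Γ` can be moved to the right of the variables that do not
depend on it. -/
lemma exists_split {Γ : C.Ob} {x : C.STm Γ} {i : ℕ} (hx : P.er.tm x = .var i) :
    ∃ (E : C.Ob) (w : Γ ⟶ E) (B : C.Ty.obj (op E)) (r : ℕ → ℕ) (hB : x.1 = C.tySub B w),
      P.er.IsRenaming w r ∧ Carrable (spair B w x hB) ∧
      ∀ (y : C.STm Γ) (j : ℕ), P.er.tm y = .var j → j ≠ i → ¬ (P.er.ty y.1).Occurs i →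
        ∃ k < P.er.len E, r k = j := by
  induction Γ using P.ob_induction with
  | empty =>
    have hi : i < P.er.len C.empty := P.er.tm_lt (s := x) (by rw [hx]; rfl)
    rw [P.er.len_empty] at hi
    omega
  | ext Γ D ih =>
    have hl := P.er.len_ext D
    obtain ⟨rfl, rfl⟩ | ⟨hi, x₀, h₀, rfl⟩ := P.tm_eq_var_ext hx
    · refine ⟨Γ, C.proj D, D, id, svar_fst D, P.er.isRenaming_proj D, ?_, fun y j hy hj _ => ?_⟩
      · have : spair D (C.proj D) (svar D) (svar_fst D) = 𝟙 _ :=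
          ext_hom_ext' (by simp) (by rw [svar_sub_spair, STm.sub_id])
        rw [this]
        exact Carrable.id _
      · have := P.er.tm_lt (s := y) (i := j) (by rw [hy]; rfl)
        exact ⟨j, by omega, rfl⟩
    · obtain ⟨E, w, B, r, hB, hw, hc, hdep⟩ := ih h₀
      have hr {k : ℕ} (hk : k < P.er.len E) : r k < P.er.len Γ :=
        P.er.hom_lt (σ := w) hk (by rw [hw.hom_eq hk]; rfl)
      have hpw {k : ℕ} (hk : k < P.er.len E) : P.er.hom (C.proj D ≫ w) k = .var (r k) := by
        rw [P.er.hom_comp _ _ hk, hw.hom_eq hk, Raw.bind_var_left, P.er.hom_proj D (hr hk)]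
      -- If `D` depends on `x`, its variable stays to the right of `x` and `E` is unchanged;
      -- otherwise `D` descends to `E` and is placed before `x`.
      by_cases hD : (P.er.ty D).Occurs i
      · refine ⟨E, C.proj D ≫ w, B, r, ?_, ⟨hpw, hw.inj⟩, ?_, fun y j hy hj hyi => ?_⟩
        · rw [STm.sub_fst, hB, tySub_comp]
        · have : spair B (C.proj D ≫ w) (x₀.sub (C.proj D)) (by
              rw [STm.sub_fst, hB, tySub_comp]) = C.proj D ≫ spair B w x₀ hB :=
            ext_hom_ext' (by simp) (by rw [svar_sub_spair, STm.sub_comp, svar_sub_spair])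
          rw [this]
          exact (carrable_proj D).comp hc
        · obtain ⟨rfl, rfl⟩ | ⟨-, y₀, hy₀, rfl⟩ := P.tm_eq_var_ext hy
          · rw [svar_fst, P.er.ty_sub_proj] at hyi
            exact (hyi hD).elim
          · rw [STm.sub_fst, P.er.ty_sub_proj] at hyi
            exact hdep y₀ j hy₀ hj hyi
      -- If the type of a variable of `D` mentioned `x`, then so would `D`; hence all variables of
      -- `D` come from `E`.
      · obtain ⟨D₀, rfl⟩ := exists_ty_strengthening hw D fun j hj => by
          obtain ⟨y, hy⟩ := P.exists_tm_eq_var (P.er.ty_lt hj)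
          exact hdep y j hy (fun e => hD (e ▸ hj)) fun h => hD (P.occurs_ty hj hy h)
        have hl₀ := P.er.len_ext D₀
        have hB' : (x₀.sub (C.proj (C.tySub D₀ w))).1 =
            C.tySub (C.tySub B (C.proj D₀)) (C.lift w D₀ _ rfl) := by
          rw [STm.sub_fst, hB, ← tySub_comp, ← tySub_comp, C.lift_proj]
        refine ⟨C.extOb D₀, C.lift w D₀ _ rfl, C.tySub B (C.proj D₀),
          -- Only `k = P.er.len E` matters in the second case: the new variable of `E.D₀` goes to
          -- the last variable of the extended context.
          fun k => if k < P.er.len E then r k else P.er.len Γ, hB', ⟨fun {k} hk => ?_, ?_⟩,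
          ?_, fun y j hy hj hyi => ?_⟩
        · split_ifs with h
          · rw [← P.er.hom_comp_proj _ h, C.lift_proj, hpw h]
          · obtain rfl : k = P.er.len E := by omega
            rw [← P.er.tm_svar_sub, svar_sub_lift, P.er.tm_svar]
        · intro k k' hk hk' h
          split_ifs at h with h₁ h₂ h₂
          · exact hw.inj h₁ h₂ h
          · have := hr h₁
            omega
          · have := hr h₂
            omega
          · omega
        -- The new map is a pullback of `spair B w x₀ hB`: stacked on the pullback square over
        -- `C.proj D₀`, the square in question gives the pullback square of `C.lift w D₀` and `w`.
        · refine Carrable.of_isPullback (IsPullback.of_bot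
            (h₁₁ := C.proj (C.tySub D₀ w)) (h₂₁ := C.lift (C.proj D₀) B _ rfl)
            (v₁₂ := spair B w x₀ hB) ?_ ?_ (isPullback_lift (C.proj D₀) B _ rfl)) hc
          · rw [spair_proj, spair_proj]
            exact (isPullback_lift w D₀ _ rfl).flip
          · refine ext_hom_ext' ?_ ?_
            · simp only [Category.assoc, spair_proj, C.lift_proj, spair_proj_assoc]
            · rw [STm.sub_comp, svar_sub_spair, STm.sub_comp, svar_sub_lift, svar_sub_spair]
        · obtain ⟨rfl, rfl⟩ | ⟨-, y₀, hy₀, rfl⟩ := P.tm_eq_var_ext hy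
          · exact ⟨P.er.len E, by omega, if_neg (lt_irrefl _)⟩
          · rw [STm.sub_fst, P.er.ty_sub_proj] at hyi
            obtain ⟨k, hk, h⟩ := hdep y₀ j hy₀ hj hyi
            exact ⟨k, by omega, (if_pos hk).trans h⟩

/-- A variable and a term of the same type in which it does not occur have a most general
unifier. -/
lemma exists_unifier_var {Γ : C.Ob} {x t : C.STm Γ} (h : x.1 = t.1) {i : ℕ}
    (hx : P.er.tm x = .var i) (ht : ¬ (P.er.tm t).Occurs i) :
    ∃ (E : C.Ob) (e : E ⟶ Γ), Mono e ∧ x.sub e = t.sub e ∧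
      ∀ (Z : C.Ob) (τ : Z ⟶ Γ), x.sub τ = t.sub τ → ∃ k, k ≫ e = τ := by
  obtain ⟨E, w, B, r, hB, hw, hc, hdep⟩ := P.exists_split hx
  -- If a variable of `t` depended on `x`, then `x` would occur in `t` or in its type. The latter is
  -- the type of `x`, which mentions only earlier variables.
  obtain ⟨t₀, rfl⟩ := exists_tm_strengthening hw t fun j hj => by
    obtain ⟨y, hy⟩ := P.exists_tm_eq_var (P.er.tm_lt hj)
    refine hdep y j hy (fun e => ht (e ▸ hj)) fun hi => ?_
    obtain hi | hi := P.occurs_tm_or_ty hj hy hi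
    · exact ht hi
    · rw [← h] at hi
      exact lt_irrefl _ (P.lt_of_occurs_ty_var hx hi)
  have ht₀ : t₀.1 = C.tySub B (𝟙 E) := by
    rw [tySub_id]
    exact tySub_renaming_injective hw (by rw [← hB, h, STm.sub_fst])
  -- Solving `x = t` means pulling back `(w, x) : Γ ⟶ E.B` along the section `(1, t₀) : E ⟶ E.B`.
  obtain ⟨Q, a, b, hab⟩ := hc (spair B (𝟙 E) t₀ ht₀)
  have hb : b = a ≫ w := by
    have := congrArg (fun k => k ≫ C.proj B) hab.w
    simpa using this.symm
  subst hb
  refine ⟨Q, a, ⟨fun f g hfg => hab.hom_ext hfg ?_⟩, ?_, fun Z τ hτ => ?_⟩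
  · rw [← Category.assoc, hfg, Category.assoc]
  · have := congrArg (fun k => (svar B).sub k) hab.w
    simpa only [STm.sub_comp, svar_sub_spair] using this
  · refine ⟨hab.lift τ (τ ≫ w) (ext_hom_ext' (by simp) ?_), hab.lift_fst _ _ _⟩
    simp only [STm.sub_comp, svar_sub_spair]
    exact hτ

end Presentation

end CwF

/-! ### Extended contexts: flexible base variables and rigid extension variables -/

namespace CwF

namespace Presentation

variable {C : CwF.{u}}

/-- A functorial extension of the contexts over `Γ` by `size` variables. -/
structure Display (P : Presentation C) (Γ : C.Ob) where
  ext : Over Γ ⥤ C.Ob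
  proj (ρ : Over Γ) : ext.obj ρ ⟶ ρ.left
  map_proj {ρ ρ' : Over Γ} (f : ρ ⟶ ρ') : ext.map f ≫ proj ρ' = proj ρ ≫ f.left
  size : ℕ
  len_ext (ρ : Over Γ) : P.er.len (ext.obj ρ) = P.er.len ρ.left + size
  hom_proj {ρ : Over Γ} {i : ℕ} : i < P.er.len ρ.left → P.er.hom (proj ρ) i = .var i
  hom_map_add {ρ ρ' : Over Γ} (f : ρ ⟶ ρ') {j : ℕ} : j < size →
    P.er.hom (ext.map f) (P.er.len ρ'.left + j) = .var (P.er.len ρ.left + j)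

namespace Display

variable {P : Presentation C} {Γ : C.Ob} (D : P.Display Γ)

lemma isRenaming_proj (ρ : Over Γ) : P.er.IsRenaming (D.proj ρ) id :=
  ⟨fun h => D.hom_proj h, fun _ _ h => h⟩

lemma tm_sub_proj {ρ : Over Γ} (s : C.STm ρ.left) : P.er.tm (s.sub (D.proj ρ)) = P.er.tm s := by
  rw [P.er.tm_sub]
  exact Raw.bind_eq_self fun i hi => D.hom_proj (P.er.tm_lt hi)

lemma hom_map_of_lt {ρ ρ' : Over Γ} (f : ρ ⟶ ρ') {i : ℕ} (h : i < P.er.len ρ'.left) :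
    P.er.hom (D.ext.map f) i = P.er.hom f.left i := by
  have e := congrArg (fun k => P.er.hom k i) (D.map_proj f)
  rw [P.er.hom_comp _ _ h, P.er.hom_comp _ _ h, D.hom_proj h, Raw.bind_var_left] at e
  rw [e]
  exact Raw.bind_eq_self fun j hj => D.hom_proj (P.er.hom_lt h hj)

/-- The variables of `t` are variables of the base. -/
def Free (_ : P.Display Γ) (ρ : Over Γ) (t : Raw (P.gens.TySym ⊕ P.gens.TmSym) ℕ) : Prop :=
  ∀ i, t.Occurs i → i < P.er.len ρ.left

/-- Maps of the slice fix the extension variables and send base variables to base terms, so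
dependence on the extension is both preserved and reflected. -/
lemma free_bind_iff {ρ ρ' : Over Γ} (f : ρ ⟶ ρ') {t : Raw (P.gens.TySym ⊕ P.gens.TmSym) ℕ}
    (ht : ∀ i, t.Occurs i → i < P.er.len (D.ext.obj ρ')) :
    D.Free ρ (t.bind (P.er.hom (D.ext.map f))) ↔ D.Free ρ' t := by
  refine ⟨fun h i hi => ?_, fun h i hi => ?_⟩
  · by_contra hlt
    obtain ⟨j, rfl⟩ := Nat.exists_eq_add_of_le (not_lt.1 hlt)
    have hj := ht _ hi
    rw [D.len_ext] at hj
    have := h (P.er.len ρ.left + j) (Raw.occurs_bind.2 ⟨_, hi, by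
      rw [D.hom_map_add f (by omega)]; rfl⟩)
    omega
  · obtain ⟨j, hj, hi⟩ := Raw.occurs_bind.1 hi
    rw [D.hom_map_of_lt f (h j hj)] at hi
    exact P.er.hom_lt (h j hj) hi

lemma free_tm_sub_iff {ρ ρ' : Over Γ} (f : ρ ⟶ ρ') (s : C.STm (D.ext.obj ρ')) :
    D.Free ρ (P.er.tm (s.sub (D.ext.map f))) ↔ D.Free ρ' (P.er.tm s) := by
  rw [P.er.tm_sub]
  exact D.free_bind_iff f fun _ => P.er.tm_lt

lemma free_ty_sub_iff {ρ ρ' : Over Γ} (f : ρ ⟶ ρ') (A : C.Ty.obj (op (D.ext.obj ρ'))) :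
    D.Free ρ (P.er.ty (C.tySub A (D.ext.map f))) ↔ D.Free ρ' (P.er.ty A) := by
  rw [P.er.ty_sub]
  exact D.free_bind_iff f fun _ => P.er.ty_lt

lemma exists_tm_of_free {ρ : Over Γ} {s : C.STm (D.ext.obj ρ)} (h : D.Free ρ (P.er.tm s)) :
    ∃ s₀ : C.STm ρ.left, s = s₀.sub (D.proj ρ) :=
  exists_tm_strengthening (D.isRenaming_proj ρ) s fun i hi => ⟨i, h i hi, rfl⟩

lemma exists_ty_of_free {ρ : Over Γ} {A : C.Ty.obj (op (D.ext.obj ρ))}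
    (h : D.Free ρ (P.er.ty A)) : ∃ A₀ : C.Ty.obj (op ρ.left), A = C.tySub A₀ (D.proj ρ) :=
  exists_ty_strengthening (D.isRenaming_proj ρ) A fun i hi => ⟨i, h i hi, rfl⟩

lemma free_tm_sub_proj {ρ : Over Γ} (s : C.STm ρ.left) :
    D.Free ρ (P.er.tm (s.sub (D.proj ρ))) := by
  rw [D.tm_sub_proj]
  exact fun _ => P.er.tm_lt

lemma free_ty_sub_proj {ρ : Over Γ} (A : C.Ty.obj (op ρ.left)) :
    D.Free ρ (P.er.ty (C.tySub A (D.proj ρ))) := by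
  intro i hi
  rw [P.er.ty_sub] at hi
  obtain ⟨j, hj, hi⟩ := Raw.occurs_bind.1 hi
  have := P.er.ty_lt hj
  rw [D.hom_proj this] at hi
  obtain rfl := Raw.occurs_var.1 hi
  exact this

/-- The term `t` restricts to a variable of the extension only if it is this variable. -/
lemma tm_eq_of_sub_eq_var {ρ ρ' : Over Γ} (f : ρ ⟶ ρ') {t : C.STm (D.ext.obj ρ')} {j : ℕ}
    (h : P.er.tm (t.sub (D.ext.map f)) = .var (P.er.len ρ.left + j)) :
    P.er.tm t = .var (P.er.len ρ'.left + j) := by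
  have hfree : ¬ D.Free ρ' (P.er.tm t) := by
    rw [← D.free_tm_sub_iff f, h]
    intro h'
    have := h' _ rfl
    omega
  rw [P.er.tm_sub] at h
  cases ht : P.er.tm t with
  | app g n args => rw [ht] at h; cases h
  | var i =>
    have hi := P.er.tm_lt (s := t) (i := i) (by rw [ht]; rfl)
    rw [D.len_ext] at hi
    rw [ht] at h hfree
    obtain ⟨j', rfl⟩ := Nat.exists_eq_add_of_le (not_lt.1 fun h' => hfree (by
      rintro _ rfl; exact h'))
    rw [Raw.bind_var_left, D.hom_map_add f (by omega)] at h
    have := Raw.var.inj h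
    congr 1
    omega

/-! ### Most general unifiers -/

/-- The maps that satisfy `S` are those that factor through a monomorphism which satisfies `S`. -/
def HasMGU {ρ₁ : Over Γ} (S : ∀ ⦃ρ : Over Γ⦄, (ρ ⟶ ρ₁) → Prop) : Prop :=
  ∃ (ρ₂ : Over Γ) (e : ρ₂ ⟶ ρ₁), Mono e ∧ S e ∧ ∀ ⦃ρ : Over Γ⦄ (f : ρ ⟶ ρ₁), S f → ∃ k, k ≫ e = f

lemma hasMGU_of_forall {ρ₁ : Over Γ} {S : ∀ ⦃ρ : Over Γ⦄, (ρ ⟶ ρ₁) → Prop}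
    (h : ∀ ⦃ρ⦄ (f : ρ ⟶ ρ₁), S f) : HasMGU S :=
  ⟨ρ₁, 𝟙 ρ₁, inferInstance, h _, fun _ f _ => ⟨f, Category.comp_id f⟩⟩

lemma HasMGU.congr {ρ₁ : Over Γ} {S S' : ∀ ⦃ρ : Over Γ⦄, (ρ ⟶ ρ₁) → Prop} (hS : HasMGU S)
    (h : ∀ ⦃ρ⦄ (f : ρ ⟶ ρ₁), S f ↔ S' f) : HasMGU S' := by
  obtain ⟨ρ₂, e, he, heS, hf⟩ := hS
  exact ⟨ρ₂, e, he, (h e).1 heS, fun ρ f hf' => hf f ((h f).2 hf')⟩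

/-- Two terms of the same type that are unified by `f` have a most general unifier, if the erasure
of their common instance is `r`. -/
def UnifiesAt (r : Raw (P.gens.TySym ⊕ P.gens.TmSym) ℕ) : Prop :=
  ∀ ⦃ρ₁ : Over Γ⦄ (s t : C.STm (D.ext.obj ρ₁)), s.1 = t.1 → ∀ ⦃ρ : Over Γ⦄ (f : ρ ⟶ ρ₁),
    P.er.tm (s.sub (D.ext.map f)) = r → P.er.tm (t.sub (D.ext.map f)) = r →
    HasMGU fun ρ (f : ρ ⟶ ρ₁) => s.sub (D.ext.map f) = t.sub (D.ext.map f)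

/-- The components are unified one after the other, and the unifiers composed. The given solution
`f` factors through each of them, so the common instances of the remaining components do not change.
-/
lemma hasMGU_hom_of_tm {Ξ : C.Ob} {ρ₁ : Over Γ} (σ τ : D.ext.obj ρ₁ ⟶ Ξ) {ρ : Over Γ}
    (f : ρ ⟶ ρ₁) (hf : D.ext.map f ≫ σ = D.ext.map f ≫ τ)
    (H : ∀ i < P.er.len Ξ, D.UnifiesAt (P.er.hom (D.ext.map f ≫ σ) i)) :
    HasMGU fun ρ (f : ρ ⟶ ρ₁) => D.ext.map f ≫ σ = D.ext.map f ≫ τ := by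
  induction Ξ using P.ob_induction with
  | empty => exact hasMGU_of_forall fun _ _ => C.isTerminalEmpty.hom_ext _ _
  | ext Ξ A ih =>
    have hl := P.er.len_ext A
    have hproj {ρ : Over Γ} (f : ρ ⟶ ρ₁) (hf : D.ext.map f ≫ σ = D.ext.map f ≫ τ) :
        D.ext.map f ≫ σ ≫ C.proj A = D.ext.map f ≫ τ ≫ C.proj A := by
      rw [← Category.assoc, hf, Category.assoc]
    obtain ⟨ρ₂, e, he, heS, hfac⟩ := ih (σ ≫ C.proj A) (τ ≫ C.proj A) (hproj f hf) fun i hi => by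
        rw [← Category.assoc, P.er.hom_comp_proj _ hi]
        exact H i (by omega)
    -- Once the earlier components are unified, the last ones have the same type.
    have hty : ((svar A).sub (D.ext.map e ≫ σ)).1 = ((svar A).sub (D.ext.map e ≫ τ)).1 := by
      rw [STm.sub_fst, STm.sub_fst, svar_fst, ← tySub_comp, ← tySub_comp, Category.assoc, heS,
        Category.assoc]
    obtain ⟨k, rfl⟩ := hfac f (hproj f hf)
    have hcomp {ρ : Over Γ} (k : ρ ⟶ ρ₂) (σ : D.ext.obj ρ₁ ⟶ C.extOb A) :
        ((svar A).sub (D.ext.map e ≫ σ)).sub (D.ext.map k) =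
          (svar A).sub (D.ext.map (k ≫ e) ≫ σ) := by
      rw [← STm.sub_comp, D.ext.map_comp, Category.assoc]
    obtain ⟨ρ₃, e', he', heS', hfac'⟩ := H (P.er.len Ξ) (by omega) _ _ hty k
      (by rw [hcomp, P.er.tm_svar_sub]) (by rw [hcomp, P.er.tm_svar_sub, hf])
    refine ⟨ρ₃, e' ≫ e, mono_comp _ _, ?_, fun ρ f hf => ?_⟩
    · refine ext_hom_ext' ?_ ?_
      · simp only [D.ext.map_comp, Category.assoc, heS]
      · rw [← hcomp, ← hcomp, heS']
    · obtain ⟨k, rfl⟩ := hfac f (hproj f hf)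
      obtain ⟨k', rfl⟩ := hfac' k (by beta_reduce; rw [hcomp, hcomp, hf])
      exact ⟨k', (Category.assoc _ _ _).symm⟩

/-- A rigid variable is unifiable only with itself. If the variable is flexible, the whole problem
descends to the base. -/
lemma hasMGU_of_var {ρ₁ : Over Γ} {s t : C.STm (D.ext.obj ρ₁)} (hty : s.1 = t.1) {i : ℕ}
    (hs : P.er.tm s = .var i) {ρ : Over Γ} (f : ρ ⟶ ρ₁)
    (hf : s.sub (D.ext.map f) = t.sub (D.ext.map f)) :
    HasMGU fun ρ (f : ρ ⟶ ρ₁) => s.sub (D.ext.map f) = t.sub (D.ext.map f) := by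
  by_cases hst : s = t
  · subst hst
    exact hasMGU_of_forall fun _ _ => rfl
  have hi := P.er.tm_lt (s := s) (i := i) (by rw [hs]; rfl)
  rw [D.len_ext] at hi
  have hlt : i < P.er.len ρ₁.left := by
    by_contra hlt
    obtain ⟨j, rfl⟩ := Nat.exists_eq_add_of_le (not_lt.1 hlt)
    refine hst (P.tm_injective (hs.trans (D.tm_eq_of_sub_eq_var f ?_).symm))
    rw [← hf, P.er.tm_sub, hs, Raw.bind_var_left, D.hom_map_add f (by omega)]
  have hsfree : D.Free ρ₁ (P.er.tm s) := by
    rw [hs]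
    rintro _ rfl
    exact hlt
  -- Freeness passes from `s` to `t` through their common instance.
  have htfree : D.Free ρ₁ (P.er.tm t) := by
    rwa [← D.free_tm_sub_iff f, ← hf, D.free_tm_sub_iff f]
  have hocc : ¬ (P.er.tm t).Occurs i := by
    have h := congrArg P.er.tm hf
    rw [P.er.tm_sub, P.er.tm_sub, hs] at h
    have hne : P.er.tm t ≠ .var i := fun h => hst (P.tm_injective (hs.trans h.symm))
    cases ht : P.er.tm t with
    | var j =>
      rintro rfl
      exact hne ht
    | app g n args =>
      rw [ht] at h
      exact Raw.not_occurs_of_bind_eq h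
  obtain ⟨s, rfl⟩ := D.exists_tm_of_free hsfree
  obtain ⟨t, rfl⟩ := D.exists_tm_of_free htfree
  rw [D.tm_sub_proj] at hs hocc
  have hty' : s.1 = t.1 := tySub_renaming_injective (D.isRenaming_proj ρ₁) hty
  have hiff {ρ : Over Γ} (f : ρ ⟶ ρ₁) : (s.sub (D.proj ρ₁)).sub (D.ext.map f) =
      (t.sub (D.proj ρ₁)).sub (D.ext.map f) ↔ s.sub f.left = t.sub f.left := by
    rw [← STm.sub_comp, ← STm.sub_comp, D.map_proj, STm.sub_comp, STm.sub_comp]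
    exact ⟨fun h => sub_renaming_injective (D.isRenaming_proj ρ) h, fun h => by rw [h]⟩
  obtain ⟨E, e, he, heS, hfac⟩ := P.exists_unifier_var hty' hs hocc
  refine ⟨Over.mk (e ≫ ρ₁.hom), Over.homMk e, ⟨fun k k' hk => ?_⟩, (hiff _).2 heS,
    fun ρ f hf => ?_⟩
  · exact Over.OverMorphism.ext ((cancel_mono e).1 (congrArg (fun z => z.left) hk))
  · obtain ⟨k, hk⟩ := hfac _ f.left ((hiff f).1 hf)
    exact ⟨Over.homMk k (by rw [← Over.w f, ← hk]; exact (Category.assoc _ _ _).symm),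
      Over.OverMorphism.ext hk⟩

/-- Robinson's algorithm, with recursion on the common instance: partial unifiers may enlarge the
terms to be unified, but the instance stays fixed. -/
lemma unifiesAt (r : Raw (P.gens.TySym ⊕ P.gens.TmSym) ℕ) : D.UnifiesAt r := by
  induction r with
  | var i =>
    intro ρ₁ s t hty ρ f hs ht
    obtain ⟨j, -, hj⟩ | ⟨φ, σ, rfl⟩ := P.tm_cases s
    · exact D.hasMGU_of_var hty hj f (P.tm_injective (hs.trans ht.symm))
    · rw [P.er.tm_sub, P.tm_genTm_sub] at hs
      cases hs
  | app g n args ih =>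
    intro ρ₁ s t hty ρ f hs ht
    have hst := P.tm_injective (hs.trans ht.symm)
    obtain ⟨j, -, hj⟩ | ⟨φ, σ, rfl⟩ := P.tm_cases s
    · exact D.hasMGU_of_var hty hj f hst
    obtain ⟨j, -, hj⟩ | ⟨ψ, τ, rfl⟩ := P.tm_cases t
    · exact (D.hasMGU_of_var hty.symm hj f hst.symm).congr fun _ _ => eq_comm
    have hinj {ρ : Over Γ} (f : ρ ⟶ ρ₁) {ψ : P.gens.TmSym} {σ : D.ext.obj ρ₁ ⟶ P.gens.tmCtx φ}
        {τ : D.ext.obj ρ₁ ⟶ P.gens.tmCtx ψ}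
        (h : ((P.gens.genTm φ).sub σ).sub (D.ext.map f) =
          ((P.gens.genTm ψ).sub τ).sub (D.ext.map f)) :
        ∃ e : φ = ψ, D.ext.map f ≫ σ =
          D.ext.map f ≫ (e ▸ τ : D.ext.obj ρ₁ ⟶ P.gens.tmCtx φ) := by
      have h' := congrArg (fun s => (P.er.tm s).bind Raw.var) h
      rw [← STm.sub_comp, ← STm.sub_comp] at h'
      obtain ⟨e, h'⟩ := P.genTm_sub_injective h'
      subst e
      exact ⟨rfl, P.hom_injective (by simpa using h')⟩
    obtain ⟨e, hστ⟩ := hinj f hst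
    subst e
    rw [← STm.sub_comp, P.tm_genTm_sub] at hs
    cases hs
    refine (D.hasMGU_hom_of_tm σ τ f hστ fun i hi => ih ⟨i, hi⟩).congr fun ρ f => ?_
    refine ⟨fun h => ?_, fun h => ?_⟩
    · rw [← STm.sub_comp, ← STm.sub_comp, h]
    · obtain ⟨_, h⟩ := hinj f h
      exact h

/-- There are no type variables, so a solvable equation has equal head symbols and reduces to one
between their arguments. -/
lemma hasMGU_ty {ρ₁ : Over Γ} {A B : C.Ty.obj (op (D.ext.obj ρ₁))} {ρ : Over Γ} (f : ρ ⟶ ρ₁)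
    (hf : C.tySub A (D.ext.map f) = C.tySub B (D.ext.map f)) :
    HasMGU fun ρ (f : ρ ⟶ ρ₁) => C.tySub A (D.ext.map f) = C.tySub B (D.ext.map f) := by
  obtain ⟨S, σ, rfl⟩ := P.isGenTy A
  obtain ⟨S', τ, rfl⟩ := P.isGenTy B
  have hinj {ρ : Over Γ} (f : ρ ⟶ ρ₁) {S' : P.gens.TySym} {σ : D.ext.obj ρ₁ ⟶ P.gens.tyCtx S}
      {τ : D.ext.obj ρ₁ ⟶ P.gens.tyCtx S'}
      (h : C.tySub (C.tySub (P.gens.genTy S) σ) (D.ext.map f) =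
        C.tySub (C.tySub (P.gens.genTy S') τ) (D.ext.map f)) :
      ∃ e : S = S', D.ext.map f ≫ σ =
        D.ext.map f ≫ (e ▸ τ : D.ext.obj ρ₁ ⟶ P.gens.tyCtx S) := by
    have h' := congrArg (fun A => (P.er.ty A).bind Raw.var) h
    rw [← tySub_comp, ← tySub_comp] at h'
    obtain ⟨e, h'⟩ := P.genTy_sub_injective h'
    subst e
    exact ⟨rfl, P.hom_injective (by simpa using h')⟩
  obtain ⟨e, hστ⟩ := hinj f hf
  subst e
  refine (D.hasMGU_hom_of_tm σ τ f hστ fun i _ => D.unifiesAt _).congr fun ρ f => ?_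
  refine ⟨fun h => ?_, fun h => ?_⟩
  · rw [← tySub_comp, ← tySub_comp, h]
  · obtain ⟨_, h⟩ := hinj f h
    exact h

end Display

end Presentation

end CwF

namespace CwF

namespace Presentation

namespace Display

variable {C : CwF.{u}} {P : Presentation C} {Γ : C.Ob} (D : P.Display Γ)

/-! ### Generic substitutions, terms and types -/

/-- A generic substitution, among those over contexts over `ρ₁`. -/
def GenericHom {Ξ : C.Ob} {ρ₁ ρ₂ : Over Γ} (f₂ : ρ₂ ⟶ ρ₁) (σ₂ : D.ext.obj ρ₂ ⟶ Ξ) : Prop :=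
  ∀ ⦃ρ ζ : Over Γ⦄ (f : ρ ⟶ ρ₁) (σ : D.ext.obj ρ ⟶ Ξ) (u : ζ ⟶ ρ₂) (v : ζ ⟶ ρ),
    u ≫ f₂ = v ≫ f → D.ext.map u ≫ σ₂ = D.ext.map v ≫ σ →
    ∃! h : ρ ⟶ ρ₂, h ≫ f₂ = f ∧ D.ext.map h ≫ σ₂ = σ

/-- A generic term, among the instances of the type `A` over contexts over `ρ₁`. -/
def GenericTm {ρ₁ : Over Γ} (A : C.Ty.obj (op (D.ext.obj ρ₁))) {ρ₂ : Over Γ} (f₂ : ρ₂ ⟶ ρ₁)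
    (t₂ : C.STm (D.ext.obj ρ₂)) : Prop :=
  ∀ ⦃ρ ζ : Over Γ⦄ (f : ρ ⟶ ρ₁) (t : C.STm (D.ext.obj ρ)) (u : ζ ⟶ ρ₂) (v : ζ ⟶ ρ),
    t.1 = C.tySub A (D.ext.map f) → u ≫ f₂ = v ≫ f →
    t₂.sub (D.ext.map u) = t.sub (D.ext.map v) →
    ∃! h : ρ ⟶ ρ₂, h ≫ f₂ = f ∧ t₂.sub (D.ext.map h) = t

/-- The terms with erasure `r` are instances of generic terms. -/
def GeneralizesAt (r : Raw (P.gens.TySym ⊕ P.gens.TmSym) ℕ) : Prop :=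
  ∀ ⦃ρ₁ : Over Γ⦄ (A : C.Ty.obj (op (D.ext.obj ρ₁))) ⦃ρ : Over Γ⦄ (f : ρ ⟶ ρ₁)
    (t : C.STm (D.ext.obj ρ)), t.1 = C.tySub A (D.ext.map f) → P.er.tm t = r →
    ∃ (ρ₂ : Over Γ) (f₂ : ρ₂ ⟶ ρ₁) (t₂ : C.STm (D.ext.obj ρ₂)) (g : ρ ⟶ ρ₂),
      t₂.1 = C.tySub A (D.ext.map f₂) ∧ g ≫ f₂ = f ∧ t₂.sub (D.ext.map g) = t ∧
      D.GenericTm A f₂ t₂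

/-- The last component is taken generic among the instances of `A` along the generic earlier
components, relative to `ρ₂`; this is why genericity is defined relative to an object of the slice.
-/
lemma exists_genericHom_of_tm {Ξ : C.Ob} {ρ₁ ρ : Over Γ} (f : ρ ⟶ ρ₁) (σ : D.ext.obj ρ ⟶ Ξ)
    (H : ∀ i < P.er.len Ξ, D.GeneralizesAt (P.er.hom σ i)) :
    ∃ (ρ₂ : Over Γ) (f₂ : ρ₂ ⟶ ρ₁) (σ₂ : D.ext.obj ρ₂ ⟶ Ξ) (g : ρ ⟶ ρ₂), g ≫ f₂ = f ∧
      D.ext.map g ≫ σ₂ = σ ∧ D.GenericHom f₂ σ₂ := by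
  induction Ξ using P.ob_induction with
  | empty =>
    refine ⟨ρ₁, 𝟙 ρ₁, C.isTerminalEmpty.from _, f, Category.comp_id _,
      C.isTerminalEmpty.hom_ext _ _, fun ρ ζ f σ u v _ _ => ⟨f, ⟨Category.comp_id _,
      C.isTerminalEmpty.hom_ext _ _⟩, fun h hh => ?_⟩⟩
    rw [← hh.1, Category.comp_id]
  | ext Ξ A ih =>
    have hl := P.er.len_ext A
    obtain ⟨ρ₂, f₂, σ₂, g, hg, hσ, hgen⟩ := ih (σ ≫ C.proj A) fun i hi => by
      rw [P.er.hom_comp_proj _ hi]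
      exact H i (by omega)
    have hty {ρ : Over Γ} {σ : D.ext.obj ρ ⟶ C.extOb A} {h : ρ ⟶ ρ₂}
        (e : D.ext.map h ≫ σ₂ = σ ≫ C.proj A) :
        ((svar A).sub σ).1 = C.tySub (C.tySub A σ₂) (D.ext.map h) := by
      rw [STm.sub_fst, svar_fst, ← tySub_comp, ← tySub_comp, e]
    obtain ⟨ρ₃, f₃, t₃, g₃, ht₃, hg₃, hσ₃, hgen₃⟩ := H (P.er.len Ξ) (by omega) (C.tySub A σ₂) g
      ((svar A).sub σ) (hty hσ) (P.er.tm_svar_sub σ)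
    have ht₃' : t₃.1 = C.tySub A (D.ext.map f₃ ≫ σ₂) := by rw [ht₃, tySub_comp]
    refine ⟨ρ₃, f₃ ≫ f₂, spair A (D.ext.map f₃ ≫ σ₂) t₃ ht₃', g₃, ?_, ?_, ?_⟩
    · rw [← Category.assoc, hg₃, hg]
    · refine ext_hom_ext' ?_ ?_
      · rw [Category.assoc, spair_proj, ← Category.assoc, ← D.ext.map_comp, hg₃, hσ]
      · rw [STm.sub_comp, svar_sub_spair, hσ₃]
    · intro ρ ζ f σ u v huv h
      have h₁ : D.ext.map (u ≫ f₃) ≫ σ₂ = D.ext.map v ≫ σ ≫ C.proj A := by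
        have := congrArg (fun k => k ≫ C.proj A) h
        simpa using this
      have h₂ : t₃.sub (D.ext.map u) = ((svar A).sub σ).sub (D.ext.map v) := by
        have := congrArg (fun k => (svar A).sub k) h
        simpa [STm.sub_comp] using this
      obtain ⟨k, ⟨hk₁, hk₂⟩, hk⟩ := hgen f (σ ≫ C.proj A) (u ≫ f₃) v (by simpa using huv) h₁
      -- Both maps solve the same problem for the generic `σ₂` over `ζ`, with the identity as second
      -- leg, so uniqueness applies.
      have huk : u ≫ f₃ = v ≫ k := by
        refine (hgen (v ≫ f) (D.ext.map v ≫ σ ≫ C.proj A) (u ≫ f₃) (𝟙 ζ)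
          (by simpa using huv) (by simpa using h₁)).unique ⟨by simpa using huv, h₁⟩
          ⟨by rw [Category.assoc, hk₁], by rw [D.ext.map_comp, Category.assoc, hk₂]⟩
      obtain ⟨l, ⟨hl₁, hl₂⟩, hl⟩ := hgen₃ k ((svar A).sub σ) u v (hty hk₂) huk h₂
      refine ⟨l, ⟨by rw [← Category.assoc, hl₁, hk₁], ext_hom_ext' ?_ ?_⟩, ?_⟩
      · rw [Category.assoc, spair_proj, ← Category.assoc, ← D.ext.map_comp, hl₁, hk₂]
      · rw [STm.sub_comp, svar_sub_spair, hl₂]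
      · rintro l' ⟨hl₁', rfl⟩
        refine hl l' ⟨hk _ ⟨by rw [Category.assoc, hl₁'], ?_⟩, ?_⟩
        · rw [D.ext.map_comp, Category.assoc, Category.assoc, spair_proj]
        · rw [STm.sub_comp, svar_sub_spair]

/-- The terms that do not depend on the extension are the instances of a variable of the base. -/
lemma exists_generic_of_free {ρ₁ ρ : Over Γ} (A : C.Ty.obj (op (D.ext.obj ρ₁))) (f : ρ ⟶ ρ₁)
    (t : C.STm (D.ext.obj ρ)) (ht : t.1 = C.tySub A (D.ext.map f)) (hfree : D.Free ρ (P.er.tm t)) :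
    ∃ (ρ₂ : Over Γ) (f₂ : ρ₂ ⟶ ρ₁) (t₂ : C.STm (D.ext.obj ρ₂)) (g : ρ ⟶ ρ₂),
      t₂.1 = C.tySub A (D.ext.map f₂) ∧ g ≫ f₂ = f ∧ t₂.sub (D.ext.map g) = t ∧
      D.GenericTm A f₂ t₂ := by
  -- The type of a term coming from the base comes from the base, and freeness is reflected along
  -- `f`.
  have hA : D.Free ρ₁ (P.er.ty A) := by
    obtain ⟨t, rfl⟩ := D.exists_tm_of_free hfree
    rw [← D.free_ty_sub_iff f, ← ht, STm.sub_fst]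
    exact D.free_ty_sub_proj _
  obtain ⟨B, rfl⟩ := D.exists_ty_of_free hA
  let ρ₂ : Over Γ := Over.mk (C.proj B ≫ ρ₁.hom)
  let f₂ : ρ₂ ⟶ ρ₁ := Over.homMk (C.proj B)
  let t₂ : C.STm (D.ext.obj ρ₂) := (svar B).sub (D.proj ρ₂)
  have hmap {ρ : Over Γ} (h : ρ ⟶ ρ₂) :
      t₂.sub (D.ext.map h) = ((svar B).sub h.left).sub (D.proj ρ) := by
    rw [← STm.sub_comp, ← STm.sub_comp, D.map_proj]
  have key : ∀ ⦃ρ : Over Γ⦄ (f : ρ ⟶ ρ₁) (t : C.STm (D.ext.obj ρ)),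
      t.1 = C.tySub (C.tySub B (D.proj ρ₁)) (D.ext.map f) → D.Free ρ (P.er.tm t) →
      ∃! h : ρ ⟶ ρ₂, h ≫ f₂ = f ∧ t₂.sub (D.ext.map h) = t := by
    intro ρ f t ht hfree
    obtain ⟨t, rfl⟩ := D.exists_tm_of_free hfree
    have ht' : t.1 = C.tySub B f.left := by
      apply tySub_renaming_injective (D.isRenaming_proj ρ)
      rw [← tySub_comp, ← D.map_proj, tySub_comp, ← ht, STm.sub_fst]
    refine ⟨Over.homMk (spair B f.left t ht') ?_, ⟨Over.OverMorphism.ext ?_, ?_⟩, ?_⟩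
    · exact (spair_proj_assoc B f.left t ht' ρ₁.hom).trans (Over.w f)
    · exact spair_proj _ _ _ _
    · rw [hmap]
      exact congrArg (fun z => STm.sub z (D.proj ρ)) (svar_sub_spair _ _ _ _)
    · rintro h ⟨rfl, h₂⟩
      rw [hmap] at h₂
      refine Over.OverMorphism.ext (ext_hom_ext' (A := B) (f := h.left)
        (g := spair B (h ≫ f₂).left t ht') ?_ ?_)
      · exact (spair_proj _ _ _ _).symm
      · exact (sub_renaming_injective (D.isRenaming_proj ρ) h₂).trans
          (svar_sub_spair _ _ _ _).symm
  obtain ⟨g, ⟨hg₁, hg₂⟩, -⟩ := key f t ht hfree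
  refine ⟨ρ₂, f₂, t₂, g, ?_, hg₁, hg₂, fun ρ ζ f t u v ht _ h => key f t ht ?_⟩
  · rw [← tySub_comp, D.map_proj, tySub_comp]
    rfl
  -- Every term sharing a restriction with `t₂` is free too, so `key` covers all competitors.
  · rw [← D.free_tm_sub_iff v, ← h, D.free_tm_sub_iff u]
    exact D.free_tm_sub_proj _

/-- A rigid variable exists over every object of the slice, so the only constraint is on its type.
-/
lemma exists_generic_of_var {ρ₁ ρ : Over Γ} (A : C.Ty.obj (op (D.ext.obj ρ₁))) (f : ρ ⟶ ρ₁)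
    (t : C.STm (D.ext.obj ρ)) (ht : t.1 = C.tySub A (D.ext.map f)) {j : ℕ}
    (htj : P.er.tm t = .var (P.er.len ρ.left + j)) :
    ∃ (ρ₂ : Over Γ) (f₂ : ρ₂ ⟶ ρ₁) (t₂ : C.STm (D.ext.obj ρ₂)) (g : ρ ⟶ ρ₂),
      t₂.1 = C.tySub A (D.ext.map f₂) ∧ g ≫ f₂ = f ∧ t₂.sub (D.ext.map g) = t ∧
      D.GenericTm A f₂ t₂ := by
  have hj : j < D.size := by
    have := P.er.tm_lt (s := t) (i := P.er.len ρ.left + j) (by rw [htj]; rfl)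
    rw [D.len_ext] at this
    omega
  obtain ⟨x, hx⟩ := P.exists_tm_eq_var (Γ := D.ext.obj ρ₁) (i := P.er.len ρ₁.left + j)
    (by rw [D.len_ext]; omega)
  have hxmap {ρ : Over Γ} (f : ρ ⟶ ρ₁) :
      P.er.tm (x.sub (D.ext.map f)) = .var (P.er.len ρ.left + j) := by
    rw [P.er.tm_sub, hx, Raw.bind_var_left, D.hom_map_add f hj]
  have key {ρ : Over Γ} (f : ρ ⟶ ρ₁) {t : C.STm (D.ext.obj ρ)}
      (ht : P.er.tm t = .var (P.er.len ρ.left + j)) : x.sub (D.ext.map f) = t :=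
    P.tm_injective ((hxmap f).trans ht.symm)
  have hty {ρ : Over Γ} (f : ρ ⟶ ρ₁) {t : C.STm (D.ext.obj ρ)}
      (ht : P.er.tm t = .var (P.er.len ρ.left + j)) (htA : t.1 = C.tySub A (D.ext.map f)) :
      C.tySub x.1 (D.ext.map f) = C.tySub A (D.ext.map f) := by
    rw [← htA, ← key f ht, STm.sub_fst]
  -- Over `ρ₁` the variable need not have type `A`, but `f` unifies the two types; the generic
  -- instance lives over their most general unifier.
  obtain ⟨ρ₂, e, he, heS, hfac⟩ := D.hasMGU_ty f (hty f htj ht)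
  obtain ⟨g, rfl⟩ := hfac f (hty f htj ht)
  refine ⟨ρ₂, e, x.sub (D.ext.map e), g, heS, rfl, ?_, fun ρ ζ f t u v ht _ h => ?_⟩
  · rw [← STm.sub_comp, ← D.ext.map_comp, key _ htj]
  · have htj' : P.er.tm t = .var (P.er.len ρ.left + j) := by
      refine D.tm_eq_of_sub_eq_var v ?_
      rw [← h, ← STm.sub_comp, ← D.ext.map_comp, hxmap]
    obtain ⟨k, rfl⟩ := hfac f (hty f htj' ht)
    refine ⟨k, ⟨rfl, ?_⟩, fun k' hk' => (cancel_mono e).1 hk'.1⟩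
    rw [← STm.sub_comp, ← D.ext.map_comp, key _ htj']

/-- Freeness is tested before the head symbol: a free application becomes a single fresh variable,
and only non-free ones keep their symbol and are generalized argument by argument. -/
lemma generalizesAt (r : Raw (P.gens.TySym ⊕ P.gens.TmSym) ℕ) : D.GeneralizesAt r := by
  induction r with
  | var i =>
    intro ρ₁ A ρ f t ht hti
    by_cases hi : i < P.er.len ρ.left
    · refine D.exists_generic_of_free A f t ht ?_
      rw [hti]
      rintro _ rfl
      exact hi
    · obtain ⟨j, rfl⟩ := Nat.exists_eq_add_of_le (not_lt.1 hi)
      exact D.exists_generic_of_var A f t ht hti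
  | app s n args ih =>
    intro ρ₁ A ρ f t ht hta
    by_cases hfree : D.Free ρ (P.er.tm t)
    · exact D.exists_generic_of_free A f t ht hfree
    obtain ⟨φ, σ, rfl⟩ := P.eq_genTm_sub_of_tm_eq hta
    rw [P.tm_genTm_sub] at hta
    cases hta
    obtain ⟨ρ₂, f₂, σ₂, g, rfl, rfl, hgen⟩ := D.exists_genericHom_of_tm f σ fun i hi => ih ⟨i, hi⟩
    have hty {ρ : Over Γ} (h : ρ ⟶ ρ₂)
        (e : ((P.gens.genTm φ).sub (D.ext.map h ≫ σ₂)).1 = C.tySub A (D.ext.map (h ≫ f₂))) :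
        C.tySub ((P.gens.genTm φ).sub σ₂).1 (D.ext.map h) =
          C.tySub (C.tySub A (D.ext.map f₂)) (D.ext.map h) := by
      rw [← tySub_comp, ← D.ext.map_comp, ← e, STm.sub_fst, STm.sub_fst, tySub_comp]
    -- Generalizing the arguments forgets that the term has type `A`; unifying its type with `A`
    -- restores this in the most general way.
    obtain ⟨ρ₃, e, he, heS, hfac⟩ := D.hasMGU_ty g (hty g ht)
    obtain ⟨k, rfl⟩ := hfac g (hty g ht)
    have hsub {ρ : Over Γ} (k : ρ ⟶ ρ₃) :
        ((P.gens.genTm φ).sub (D.ext.map e ≫ σ₂)).sub (D.ext.map k) =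
          (P.gens.genTm φ).sub (D.ext.map (k ≫ e) ≫ σ₂) := by
      rw [← STm.sub_comp, D.ext.map_comp, Category.assoc]
    refine ⟨ρ₃, e ≫ f₂, (P.gens.genTm φ).sub (D.ext.map e ≫ σ₂), k, ?_,
      (Category.assoc _ _ _).symm, hsub k, fun ρ ζ f t u v ht huv h => ?_⟩
    · rw [D.ext.map_comp, tySub_comp, ← heS, STm.sub_fst, STm.sub_fst, tySub_comp]
    -- A competitor is not free, so it is not a base variable. It is not a rigid variable either,
    -- since those restrict to variables; hence it has head symbol `φ`.
    · have hnfree : ¬ D.Free ρ (P.er.tm t) := by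
        rwa [← D.free_tm_sub_iff v, ← h, D.free_tm_sub_iff u, ← D.free_tm_sub_iff k, hsub]
      have hinj {ρ ζ : Over Γ} {u : ζ ⟶ ρ₃} {v : ζ ⟶ ρ} {ψ : P.gens.TmSym}
          {τ : D.ext.obj ρ ⟶ P.gens.tmCtx ψ}
          (h : ((P.gens.genTm φ).sub (D.ext.map e ≫ σ₂)).sub (D.ext.map u) =
            ((P.gens.genTm ψ).sub τ).sub (D.ext.map v)) :
          ∃ e' : φ = ψ, D.ext.map (u ≫ e) ≫ σ₂ =
            D.ext.map v ≫ (e' ▸ τ : D.ext.obj ρ ⟶ P.gens.tmCtx φ) := by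
        rw [hsub, ← STm.sub_comp] at h
        obtain ⟨e', h'⟩ := P.genTm_sub_injective
          (congrArg (fun s => (P.er.tm s).bind Raw.var) h)
        subst e'
        exact ⟨rfl, P.hom_injective (by simpa using h')⟩
      obtain ⟨i, -, hi⟩ | ⟨ψ, τ, rfl⟩ := P.tm_cases t
      · exfalso
        have hi' : ¬ i < P.er.len ρ.left := fun hi' => hnfree (by
          rw [hi]
          rintro _ rfl
          exact hi')
        obtain ⟨j, rfl⟩ := Nat.exists_eq_add_of_le (not_lt.1 hi')
        have hj := P.er.tm_lt (s := t) (i := P.er.len ρ.left + j) (by rw [hi]; rfl)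
        rw [D.len_ext] at hj
        have h' := congrArg P.er.tm h
        rw [hsub, P.tm_genTm_sub, P.er.tm_sub, hi, Raw.bind_var_left,
          D.hom_map_add v (by omega)] at h'
        cases h'
      · obtain ⟨e', hτ⟩ := hinj h
        subst e'
        obtain ⟨l, ⟨rfl, rfl⟩, hl⟩ := hgen f τ (u ≫ e) v (by simpa using huv) hτ
        obtain ⟨l, rfl⟩ := hfac l (hty l ht)
        refine ⟨l, ⟨(Category.assoc _ _ _).symm, hsub l⟩, fun l' hl' => (cancel_mono e).1 ?_⟩
        -- Equal terms have equal arguments, to which the uniqueness for `σ₂` applies.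
        obtain ⟨_, h'⟩ := hinj (v := 𝟙 ρ) (by rw [D.ext.map_id, STm.sub_id]; exact hl'.2)
        exact hl _ ⟨by rw [Category.assoc, hl'.1], by simpa using h'⟩

lemma exists_genericHom {Ξ : C.Ob} {ρ₁ ρ : Over Γ} (f : ρ ⟶ ρ₁) (σ : D.ext.obj ρ ⟶ Ξ) :
    ∃ (ρ₂ : Over Γ) (f₂ : ρ₂ ⟶ ρ₁) (σ₂ : D.ext.obj ρ₂ ⟶ Ξ) (g : ρ ⟶ ρ₂), g ≫ f₂ = f ∧
      D.ext.map g ≫ σ₂ = σ ∧ D.GenericHom f₂ σ₂ :=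
  D.exists_genericHom_of_tm f σ fun _ _ => D.generalizesAt _

end Display

end Presentation

end CwF

namespace CwF

/-! ### Telescopes as displays -/

section Telescopes

variable {C : CwF.{u}}

/-- The projection `Γ.Δ ⟶ Γ`. -/
def Telescope.proj {Γ : C.Ob} : {Θ : C.Ob} → Telescope C Γ Θ → (Θ ⟶ Γ)
  | _, .nil => 𝟙 Γ
  | _, .snoc Δ A => C.proj A ≫ Δ.proj

lemma Telescope.sub_lift_proj {Γ Γ' Θ : C.Ob} (σ : Γ' ⟶ Γ) (Δ : Telescope C Γ Θ) :
    (Δ.sub σ).lift ≫ Δ.proj = (Δ.sub σ).tel.proj ≫ σ := by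
  induction Δ with
  | nil => exact (Category.comp_id σ).trans (Category.id_comp σ).symm
  | snoc Δ A ih =>
    change C.lift (Δ.sub σ).lift A _ rfl ≫ C.proj A ≫ Δ.proj =
      (C.proj (C.tySub A (Δ.sub σ).lift) ≫ (Δ.sub σ).tel.proj) ≫ σ
    rw [← Category.assoc, C.lift_proj, Category.assoc, ih, Category.assoc]

lemma Telescope.length_sub {Γ Γ' Θ : C.Ob} (σ : Γ' ⟶ Γ) (Δ : Telescope C Γ Θ) :
    (Δ.sub σ).tel.length = Δ.length := by
  induction Δ with
  | nil => rfl
  | snoc Δ A ih => exact congrArg (· + 1) ih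

lemma Tel.lift_proj {Γ Γ' : C.Ob} (σ : Γ' ⟶ Γ) (Δ : Tel C Γ) (Δ' : Tel C Γ')
    (h : (Δ.tel.sub σ).toTel = Δ') :
    Tel.lift σ Δ Δ' h ≫ Δ.tel.proj = Δ'.tel.proj ≫ σ := by
  subst h
  rw [Tel.lift, eqToHom_refl, Category.id_comp, Telescope.sub_lift_proj]

namespace Erasure

variable {G : Type u} (e : Erasure C G)

lemma len_telescope_add {Γ Θ : C.Ob} (Δ : Telescope C Γ Θ) :
    e.len Θ = e.len Γ + Δ.length := by
  induction Δ with
  | nil => rfl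
  | snoc Δ A ih => rw [e.len_ext, ih, Telescope.length, Nat.add_assoc]

lemma hom_telescope_proj {Γ Θ : C.Ob} (Δ : Telescope C Γ Θ) {i : ℕ} (h : i < e.len Γ) :
    e.hom Δ.proj i = .var i := by
  induction Δ with
  | nil => exact e.hom_id h
  | snoc Δ A ih =>
    rw [Telescope.proj, e.hom_comp _ _ h, ih, Raw.bind_var_left, e.hom_proj]
    have := e.len_telescope_add Δ
    omega

lemma hom_telescope_lift {Γ Γ' Θ : C.Ob} (σ : Γ' ⟶ Γ) (Δ : Telescope C Γ Θ) {j : ℕ}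
    (h : j < Δ.length) : e.hom (Δ.sub σ).lift (e.len Γ + j) = .var (e.len Γ' + j) := by
  induction Δ with
  | nil => exact absurd h (Nat.not_lt_zero j)
  | snoc Δ A ih =>
    change e.hom (C.lift (Δ.sub σ).lift A _ rfl) _ = _
    have hl := e.len_telescope_add Δ
    have hl' := e.len_telescope_add (Δ.sub σ).tel
    rw [Telescope.length_sub] at hl'
    obtain h | rfl := Nat.lt_succ_iff_lt_or_eq.1 h
    · have hj : e.len Γ + j < e.len _ := hl ▸ Nat.add_lt_add_left h _
      rw [← e.hom_comp_proj _ hj, C.lift_proj, e.hom_comp _ _ hj, ih h, Raw.bind_var_left,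
        e.hom_proj]
      omega
    · rw [← hl, ← e.tm_svar_sub, svar_sub_lift, e.tm_svar, hl']

end Erasure

/-- The functor sending `ρ` to the context extended by `Δ[ρ]`. -/
def Tel.extFunctor {Γ : C.Ob} (Δ : Tel C Γ) : Over Γ ⥤ C.Ob :=
  (restrictElements C.telPresheaf Δ ⋙ C.telExt).unop

/-- The display given by a telescope. -/
def Tel.display (P : Presentation C) {Γ : C.Ob} (Δ : Tel C Γ) : P.Display Γ where
  ext := Δ.extFunctor
  proj ρ := (Δ.tel.sub ρ.hom).tel.proj
  map_proj f := Tel.lift_proj f.left _ _ ((restrictElements C.telPresheaf Δ).map f.op).2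
  size := Δ.tel.length
  len_ext ρ := by
    rw [← Telescope.length_sub ρ.hom Δ.tel]
    exact P.er.len_telescope_add (Δ.tel.sub ρ.hom).tel
  hom_proj h := P.er.hom_telescope_proj _ h
  hom_map_add {ρ ρ'} f j hj := by
    -- With the telescopes generalized, the equation between them becomes `rfl` and the `eqToHom` in
    -- `Tel.lift` disappears.
    have key : ∀ (Δ' : Tel C ρ'.left) (Δ'' : Tel C ρ.left)
        (h : (Δ'.tel.sub f.left).toTel = Δ''), j < Δ'.tel.length →
        P.er.hom (Tel.lift f.left Δ' Δ'' h) (P.er.len ρ'.left + j) =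
          .var (P.er.len ρ.left + j) := by
      rintro Δ' _ rfl hj
      rw [Tel.lift, eqToHom_refl, Category.id_comp]
      exact P.er.hom_telescope_lift f.left Δ'.tel hj
    exact key _ _ ((restrictElements C.telPresheaf Δ).map f.op).2 ((Telescope.length_sub ρ'.hom Δ.tel).symm ▸ hj)

end Telescopes

/-! ### The families of telescopes, types and terms -/

namespace Presentation

variable {C : CwF.{u}}

/-- The map to the terminal object of the slice. -/
noncomputable def toTop {Γ : C.Ob} (ρ : Over Γ) : ρ ⟶ Over.mk (𝟙 Γ) := Over.mkIdTerminal.from ρ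

lemma toTop_ext {Γ : C.Ob} {ρ : Over Γ} (f g : ρ ⟶ Over.mk (𝟙 Γ)) : f = g :=
  Over.mkIdTerminal.hom_ext f g

/-- Genericity relative to the terminal object of the slice is absolute, because compatibility over
it is automatic. -/
lemma hasEnoughGeneric_subst (P : Presentation C) {Γ : C.Ob} (x : C.substFamily.base.obj (op Γ)) :
    HasEnoughGeneric (restrictedPresheaf C.substFamily.fib x) := by
  obtain ⟨Δ, (Ξ : C.Ob)⟩ := x
  let D := Tel.display P Δ
  have hmap {ρ ρ' : Over Γ} (f : ρ ⟶ ρ') (σ : D.ext.obj ρ' ⟶ Ξ) :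
      (restrictedPresheaf C.substFamily.fib ⟨Δ, Ξ⟩).map f.op σ = D.ext.map f ≫ σ :=
    congrArg (fun k => D.ext.map f ≫ k) (Category.comp_id σ)
  intro ρ (σ : D.ext.obj ρ ⟶ Ξ)
  obtain ⟨ρ₂, f₂, σ₂, g, -, hσ, hgen⟩ := D.exists_genericHom (toTop ρ) σ
  refine ⟨ρ₂, σ₂, g, (hmap g σ₂).trans hσ, fun ζ ρ u v (σ : D.ext.obj ρ ⟶ Ξ) h => ?_⟩
  obtain ⟨k, ⟨-, hk⟩, huniq⟩ := hgen (toTop ρ) σ u v (toTop_ext _ _)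
    ((hmap u σ₂).symm.trans (h.trans (hmap v σ)))
  exact ⟨k, (hmap k σ₂).trans hk,
    fun k' hk' => huniq k' ⟨toTop_ext _ _, (hmap k' σ₂).symm.trans hk'⟩⟩

/-- A type is a symbol applied to a substitution, and nothing constrains it further, so a generic
substitution gives a generic type. -/
lemma hasEnoughGeneric_depTy (P : Presentation C) {Γ : C.Ob} (Δ : C.depTyFamily.base.obj (op Γ)) :
    HasEnoughGeneric (restrictedPresheaf C.depTyFamily.fib Δ) := by
  let D := Tel.display P Δ
  have hmap {ρ ρ' : Over Γ} (f : ρ ⟶ ρ') (A : C.Ty.obj (op (D.ext.obj ρ'))) :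
      (restrictedPresheaf C.depTyFamily.fib Δ).map f.op A = C.tySub A (D.ext.map f) := rfl
  intro ρ (A : C.Ty.obj (op (D.ext.obj ρ)))
  obtain ⟨S, σ, rfl⟩ := P.isGenTy A
  obtain ⟨ρ₂, f₂, σ₂, g, -, rfl, hgen⟩ := D.exists_genericHom (toTop ρ) σ
  have hinj {ρ ζ : Over Γ} {u : ζ ⟶ ρ₂} {v : ζ ⟶ ρ} {S' : P.gens.TySym}
      {τ : D.ext.obj ρ ⟶ P.gens.tyCtx S'}
      (h : C.tySub (C.tySub (P.gens.genTy S) σ₂) (D.ext.map u) =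
        C.tySub (C.tySub (P.gens.genTy S') τ) (D.ext.map v)) :
      ∃ e : S = S', D.ext.map u ≫ σ₂ =
        D.ext.map v ≫ (e ▸ τ : D.ext.obj ρ ⟶ P.gens.tyCtx S) := by
    rw [← tySub_comp, ← tySub_comp] at h
    obtain ⟨e, h'⟩ := P.genTy_sub_injective (congrArg (fun A => (P.er.ty A).bind Raw.var) h)
    subst e
    exact ⟨rfl, P.hom_injective (by simpa using h')⟩
  refine ⟨ρ₂, C.tySub (P.gens.genTy S) σ₂, g, (hmap g _).trans (C.tySub_comp _ _ _).symm,
    fun ζ ρ u v (A : C.Ty.obj (op (D.ext.obj ρ))) h => ?_⟩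
  obtain ⟨S', τ, rfl⟩ := P.isGenTy A
  obtain ⟨e, hτ⟩ := hinj h
  subst e
  obtain ⟨k, ⟨-, rfl⟩, huniq⟩ := hgen (toTop ρ) τ u v (toTop_ext _ _) hτ
  refine ⟨k, (hmap k _).trans (C.tySub_comp _ _ _).symm, fun k' hk' => ?_⟩
  obtain ⟨_, h'⟩ := hinj (v := 𝟙 ρ) (by rw [D.ext.map_id, tySub_id]; exact hk')
  exact huniq k' ⟨toTop_ext _ _, by simpa using h'⟩

/-- The prescribed type at each `ρ` is the restriction of the one at the identity of `Γ`, so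
`generalizesAt` applies with that type over the terminal object. -/
lemma hasEnoughGeneric_depTm (P : Presentation C) {Γ : C.Ob} (x : C.depTmFamily.base.obj (op Γ)) :
    HasEnoughGeneric (restrictedPresheaf C.depTmFamily.fib x) := by
  let D := Tel.display P x.1
  let F : (Over Γ)ᵒᵖ ⥤ C.Ty.Elements := restrictElements C.depTmFamily.base x ⋙
    totalElements (C.telExt ⋙ C.Ty) ⋙ pullElements C.telExt C.Ty
  let A (ρ : Over Γ) : C.Ty.obj (op (D.ext.obj ρ)) := (F.obj (op ρ)).2
  have hA {ρ ρ' : Over Γ} (f : ρ ⟶ ρ') : C.tySub (A ρ') (D.ext.map f) = A ρ := (F.map f.op).2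
  let toS {ρ : Over Γ} (a : (restrictedPresheaf C.depTmFamily.fib x).obj (op ρ)) :
      C.STm (D.ext.obj ρ) := ⟨A ρ, a⟩
  have toS_inj {ρ : Over Γ} {a b : (restrictedPresheaf C.depTmFamily.fib x).obj (op ρ)}
      (h : toS a = toS b) : a = b := eq_of_heq (Sigma.mk.inj h).2
  have hmap {ρ ρ' : Over Γ} (f : ρ ⟶ ρ')
      (a : (restrictedPresheaf C.depTmFamily.fib x).obj (op ρ')) :
      toS ((restrictedPresheaf C.depTmFamily.fib x).map f.op a) = (toS a).sub (D.ext.map f) :=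
    STm.mk_tmSub (C := C) (A := A ρ') a (D.ext.map f) (hA f)
  intro ρ a
  obtain ⟨ρ₂, f₂, t₂, g, ht₂, -, hg, hgen⟩ := D.generalizesAt _ (A (Over.mk (𝟙 Γ))) (toTop ρ)
    (toS a) (hA _).symm rfl
  obtain ⟨a₂, rfl⟩ := t₂.exists_of_fst_eq (ht₂.trans (hA f₂))
  refine ⟨ρ₂, a₂, g, toS_inj ((hmap g a₂).trans hg), fun ζ ρ u v a h => ?_⟩
  obtain ⟨k, ⟨-, hk⟩, huniq⟩ := hgen (toTop ρ) (toS a) u v (hA _).symm (toTop_ext _ _)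
    ((hmap u a₂).symm.trans ((congrArg toS h).trans (hmap v a)))
  exact ⟨k, toS_inj ((hmap k a₂).trans hk),
    fun k' hk' => huniq k' ⟨toTop_ext _ _, (hmap k' a₂).symm.trans (congrArg toS hk')⟩⟩

/-- Restriction does not change the kind of a sort, so over a fixed sort the presheaf is one of the
two already treated. -/
lemma hasEnoughGeneric_monoSorts (P : Presentation C) {Γ : C.Ob} (x : C.monoSorts.base.obj (op Γ)) :
    HasEnoughGeneric (restrictedPresheaf C.monoSorts.fib x) := by
  obtain ⟨Δ, (_ | A)⟩ := x
  · exact .of_iso (NatIso.ofComponents (fun ρ => Iso.refl _) (fun _ => rfl))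
      (P.hasEnoughGeneric_depTy Δ)
  · exact .of_iso (NatIso.ofComponents (fun ρ => Iso.refl _) (fun _ => rfl))
      (P.hasEnoughGeneric_depTm ⟨Δ, A⟩)

end Presentation

/-! ### Monomial sorts as a coproduct of families -/

/-- A monomial sort is a telescope, or a telescope with a type over it. -/
def monoSortsBaseIso (C : CwF.{u}) :
    C.monoSorts.base ≅ (PshFamily.sum C.depTyFamily C.depTmFamily).base :=
  NatIso.ofComponents
    (fun _ => Equiv.toIso
      { toFun := fun z => match z with
          | ⟨Δ, Sum.inl _⟩ => Sum.inl Δ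
          | ⟨Δ, Sum.inr A⟩ => Sum.inr ⟨Δ, A⟩
        invFun := fun z => match z with
          | Sum.inl Δ => ⟨Δ, Sum.inl PUnit.unit⟩
          | Sum.inr ⟨Δ, A⟩ => ⟨Δ, Sum.inr A⟩
        left_inv := by rintro ⟨Δ, (_ | A)⟩ <;> rfl
        right_inv := by rintro (Δ | ⟨Δ, A⟩) <;> rfl })
    (fun f => ConcreteCategory.hom_ext _ _ (by rintro ⟨Δ, (_ | A)⟩ <;> rfl))

/-- Whether a monomial sort is a sort of types. -/
def isTySort (C : CwF.{u}) {Γ : C.Obᵒᵖ} : C.monoSorts.base.obj Γ → Bool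
  | ⟨_, Sum.inl _⟩ => true
  | ⟨_, Sum.inr _⟩ => false

/-- The family of monomial sorts is the coproduct of the families of dependent types and of
dependent terms. -/
def monoSortsIso (C : CwF.{u}) :
    PshFamily.Iso C.monoSorts (PshFamily.sum C.depTyFamily C.depTmFamily) where
  base := C.monoSortsBaseIso
  fib := NatIso.ofComponents
    (fun z => match z with
      | ⟨_, ⟨_, Sum.inl _⟩⟩ => Iso.refl _
      | ⟨_, ⟨_, Sum.inr _⟩⟩ => Iso.refl _)
    (by
      rintro ⟨Γ, Δ, (_ | A)⟩ ⟨Γ', Δ', (_ | A')⟩ f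
      · rfl
      -- No morphism relates a sort of types to a sort of terms, because restriction preserves the
      -- kind.
      · exact absurd (congrArg C.isTySort f.2) Bool.noConfusion
      · exact absurd (congrArg C.isTySort f.2) Bool.noConfusion
      · rfl)

end CwF

theorem mainTheorem5 (C : CwF.{u}) (hC : C.IsCellular) :
    LocallyFamiliallyRepresentable C.substFamily.fib ∧
    LocallyFamiliallyRepresentable C.depTyFamily.fib ∧
    LocallyFamiliallyRepresentable C.depTmFamily.fib ∧
    Nonempty (PshFamily.Iso C.monoSorts (PshFamily.sum C.depTyFamily C.depTmFamily)) ∧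
    LocallyFamiliallyRepresentable C.monoSorts.fib := by
  obtain ⟨T⟩ := hC.nonempty_cellTower
  obtain ⟨P⟩ := T.nonempty_presentation
  exact ⟨fun _ x => (P.hasEnoughGeneric_subst x).familiallyRepresentable,
    fun _ x => (P.hasEnoughGeneric_depTy x).familiallyRepresentable,
    fun _ x => (P.hasEnoughGeneric_depTm x).familiallyRepresentable,
    ⟨C.monoSortsIso⟩,
    fun _ x => (P.hasEnoughGeneric_monoSorts x).familiallyRepresentable⟩
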